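/- Identify $\mathbb H_+=\{q\in\mathbb H:\operatorname{Re}q>0\}$ with $\mathbb R^3\times(0,\infty)$ by $(\underline q,y)\mapsto y+q_1\mathbf i+q_2\mathbf j+q_3\mathbf k$, and put $$D=\tfrac12\Big(\tfrac{\partial}{\partial y}+\mathbf i\tfrac{\partial}{\partial q_1}+\mathbf j\tfrac{\partial}{\partial q_2}+\mathbf k\tfrac{\partial}{\partial q_3}\Big),\qquad \bar D=\tfrac12\Big(\tfrac{\partial}{\partial y}-\mathbf i\tfrac{\partial}{\partial q_1}-\mathbf j\tfrac{\partial}{\partial q_2}-\mathbf k\tfrac{\partial}{\partial q_3}\Big),$$ both acting from the left. A $C^1$ function $F:\mathbb H_+\to\mathbb H$ is left-regular if $DF=0$. Let $\mathcal D(\mathbb H_+)$ be the space of real-valued harmonic functions $u$ on $\mathbb H_+$ with $$\sup_{y>0}\int_{\mathbb R^3}|u(\underline q,y)|^2\,d\underline q<\infty\quad\text{and}\quad\int_{\mathbb H_+}|\nabla u(\underline q,y)|^2\,d\underline q\,dy<\infty .$$ Theorem. Let $u\in\mathcal D(\mathbb H_+)$ and let $f$ be its boundary function on $\mathbb R^3$,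 i.e. $\lim_{y\to0^+}u(\underline q,y)=f(\underline q)$ for almost every $\underline q\in\mathbb R^3$. Then $f\in L^2(\mathbb R^3)$; the function $$F(q)=\frac1{\pi^2}\int_{\mathbb R^3}\frac{\overline{q-\underline t}}{|q-\underline t|^4}\,f(\underline t)\,d\underline t,\qquad q\in\mathbb H_+,\quad \underline t=t_1\mathbf i+t_2\mathbf j+t_3\mathbf k,$$ (the canonical left-regular function associated with $u$) is left-regular in $\mathbb H_+$ with real part $u$; and $$\int_{\mathbb H_+}|\nabla u|^2\,d\underline q\,dy=\int_{\mathbb H_+}|\bar DF|^2\,d\underline q\,dy=2\pi\int_{\mathbb R^3}|\underline t|\,|\hat f(\underline t)|^2\,d\underline t=\frac1{2\pi^2}\int_{\mathbb R^3}\int_{\mathbb R^3}\frac{|f(\underline{t_1})-f(\underline{t_2})|^2}{|\underline{t_1}-\underline{t_2}|^4}\,d\underline{t_1}\,d\underline{t_2},$$ where $\hat f$ is the $L^2$ Fourier transform, the extension to $L^2(\mathbb R^3)$ by continuity of $\hat f(\underline t)=\int_{\mathbb R^3}e^{2\pi \mathrm i\,\underline x\cdot\underline t}f(\underline x)\,d\underline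 x$. -/

import Mathlib

open MeasureTheory Set Filter Topology

noncomputable section

namespace QuatDirichlet

/-- Three-dimensional Euclidean space. -/
abbrev E3 : Type := EuclideanSpace ℝ (Fin 3)

/-- The quaternion `y + x₁ i + x₂ j + x₃ k`, i.e. the point `(x, y)` of `ℝ³ × ℝ`. -/
def pt (x : E3) (y : ℝ) : Quaternion ℝ := ⟨y, x 0, x 1, x 2⟩

/-- The upper half-space `{y + x : x ∈ ℝ³, y > 0}` of the quaternions. -/
def upperHalf : Set (Quaternion ℝ) := {q | 0 < q.re}

/-- The integral `∫_{ℝ³ × (0,∞)} g(x, y) dx dy` of a nonnegative function on the upper half-space. -/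
def integralUpper (g : Quaternion ℝ → ENNReal) : ENNReal :=
  ∫⁻ p in (univ : Set E3) ×ˢ Ioi (0 : ℝ), g (pt p.1 p.2) ∂(volume : Measure (E3 × ℝ))

/-- The energy `∫ |∇u|²` over the upper half-space. -/
def gradientEnergy (u : Quaternion ℝ → ℝ) : ENNReal :=
  integralUpper fun q => ENNReal.ofReal (‖gradient u q‖ ^ 2)

/-- The harmonic Hardy norm `sup_{y > 0} (∫_{ℝ³} |u(x, y)|² dx)^{1/2}`. -/
def hardyNorm (u : Quaternion ℝ → ℝ) : ENNReal :=
  ⨆ y : ℝ, ⨆ _ : 0 < y, eLpNorm (fun x : E3 => u (pt x y)) 2 volume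

/-- The harmonic Dirichlet space of the upper half-space: harmonic functions in the Hardy class
`h²` with finite gradient energy. -/
structure MemDirichlet (u : Quaternion ℝ → ℝ) : Prop where
  harmonic : InnerProductSpace.HarmonicOnNhd u upperHalf
  hardy : hardyNorm u < ⊤
  energy : gradientEnergy u < ⊤

/-- `f` is the boundary function of `u`: `u(x, y) → f(x)` as `y → 0⁺`, for almost every `x`. -/
def IsBoundaryFunction (u : Quaternion ℝ → ℝ) (f : E3 → ℝ) : Prop :=
  ∀ᵐ x : E3, Tendsto (fun y : ℝ => u (pt x y)) (𝓝[>] 0) (𝓝 (f x))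

/-- The imaginary units. -/
def qi : Quaternion ℝ := ⟨0, 1, 0, 0⟩
def qj : Quaternion ℝ := ⟨0, 0, 1, 0⟩
def qk : Quaternion ℝ := ⟨0, 0, 0, 1⟩

/-- `D = ½ (∂_y + i ∂₁ + j ∂₂ + k ∂₃)`, acting from the left. -/
def opD (F : Quaternion ℝ → Quaternion ℝ) (q : Quaternion ℝ) : Quaternion ℝ :=
  (1 / 2 : ℝ) • (fderiv ℝ F q 1 +
    (qi * fderiv ℝ F q qi + qj * fderiv ℝ F q qj + qk * fderiv ℝ F q qk))

/-- `D̄ = ½ (∂_y - i ∂₁ - j ∂₂ - k ∂₃)`, acting from the left. -/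
def opDbar (F : Quaternion ℝ → Quaternion ℝ) (q : Quaternion ℝ) : Quaternion ℝ :=
  (1 / 2 : ℝ) • (fderiv ℝ F q 1 -
    (qi * fderiv ℝ F q qi + qj * fderiv ℝ F q qj + qk * fderiv ℝ F q qk))

/-- `F` is left-regular in the open set `Ω`: it is `C¹` there and `D F = 0`. -/
def LeftRegularOn (F : Quaternion ℝ → Quaternion ℝ) (Ω : Set (Quaternion ℝ)) : Prop :=
  ContDiffOn ℝ 1 F Ω ∧ ∀ q ∈ Ω, opD F q = 0

/-- The canonical left-regular function with boundary data `f`, the Cauchy integral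
`F(q) = π⁻² ∫_{ℝ³} conj (q - t) / |q - t|⁴ f(t) dt` (`2 / ω₃ = π⁻²` as `ω₃ = 2 π²`). -/
def canonicalExtension (f : E3 → ℝ) (q : Quaternion ℝ) : Quaternion ℝ :=
  (1 / Real.pi ^ 2) • ∫ t : E3, (f t / ‖q - pt t 0‖ ^ 4) • star (q - pt t 0)

/-- The `L²` Fourier transform with kernel `e^{2π i x·t}` of a real function `f ∈ L²(ℝ³)`:
the unitary extension to `L²` of `f̂(t) = ∫ e^{2π i x·t} f(x) dx`, which in the sign convention of
the library is the inverse Fourier transform. -/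
def fourierL2 (f : E3 → ℝ) (hf : MemLp (fun x => (f x : ℂ)) 2 (volume : Measure E3)) :
    Lp ℂ 2 (volume : Measure E3) :=
  FourierTransformInv.fourierInv (hf.toLp (fun x => (f x : ℂ)))

end QuatDirichlet

end

/-! Everything is read off from one Fourier formula. With `g = fourierL2 f`, so that `𝓕 g = f`, the
function `u` satisfies `u(x, y) = 𝓕 (e^{-2πy|t|} g)(x)`: it is the Poisson integral of its boundary
function.

The real part of the Cauchy kernel `q̄/|q|⁴`, divided by `π²`, is the Poisson kernel, and
subordination of `e^{-2πy|t|}` to Gaussians identifies the Poisson kernel as a Fourier transform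
(`fourier_poissonSymbol`). So `Re F` is the Poisson integral of `f`. To see that it equals `u`, note
that finite energy and Cauchy-Schwarz on vertical segments give `‖u(·, y) - f‖² ≤ y · energy`; this
also puts `f` in `L²`. The Poisson integral tends to `f` in `L²` by Plancherel. The difference is
harmonic, has slices bounded in `L²`, and vanishes in `L²` at the boundary. Averaged horizontally
against a test function it becomes bounded and uniformly small near the boundary, hence zero by a
Phragmén-Lindelöf argument (`eq_zero_of_tendsto_lintegral`).

Regularity of `F` is inherited from the kernel by differentiating under the integral. Since `DF =
0`, `D̄F = ∂_y F`. The kernel is, up to signs of components, the gradient of `-1/(2|q|²)`, so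
symmetry of mixed derivatives makes the components of `∂_y F` those of `∇ Re F` up to sign. Hence
`|D̄F| = |∇u|` pointwise.

For the energy, Plancherel on each slice gives `8π² ∫ |t|² e^{-4πy|t|} |g|²`, and integration in `y`
leaves `2π ∫ |t| |g|²`. For the double integral, Plancherel applied to `f(x + h) - f(x)` reduces it
to `∫ |e^{2πi t·h} - 1|² |h|⁻⁴ dh = 4π³|t|` (`lintegral_char_sub_one_sq_div_norm_pow`), and `4π³ /
(2π²) = 2π`. -/

noncomputable section

namespace QuatDirichlet

/-! ### Plancherel, convolution and translation for the `L²` Fourier transform. -/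

section FourierLTwo

open scoped FourierTransform SchwartzMap ComplexConjugate ENNReal RealInnerProductSpace

variable {V : Type*} [NormedAddCommGroup V] [InnerProductSpace ℝ V] [FiniteDimensional ℝ V]
  [MeasurableSpace V] [BorelSpace V]

/-- The `L²` Fourier transform is symmetric for the pairing with Schwartz functions. -/
theorem integral_schwartz_mul_fourier_Lp (g : Lp ℂ 2 (volume : Measure V)) (φ : 𝓢(V, ℂ)) :
    ∫ x, φ x * (𝓕 g : Lp ℂ 2 (volume : Measure V)) x = ∫ x, 𝓕 (φ : V → ℂ) x * g x := by
  have h := congrArg (fun T => T φ) (Lp.fourier_toTemperedDistribution_eq g)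
  simp only [TemperedDistribution.fourier_apply, Lp.toTemperedDistribution_apply,
    smul_eq_mul] at h
  rw [← h, SchwartzMap.fourier_coe]

/-- Locally integrable functions with equal pairings with all Schwartz functions agree a.e. -/
theorem ae_eq_of_integral_schwartz_mul_eq {f g : V → ℂ} (hf : LocallyIntegrable f volume)
    (hg : LocallyIntegrable g volume)
    (h : ∀ φ : 𝓢(V, ℂ), ∫ x, φ x * f x = ∫ x, φ x * g x) : f =ᵐ[volume] g := by
  refine ae_eq_of_integral_contDiff_smul_eq hf hg fun ψ hψ hc => ?_
  have hg₁ : HasCompactSupport (Complex.ofRealCLM ∘ ψ) := hc.comp_left rfl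
  have hg₂ : ContDiff ℝ ((⊤ : ℕ∞) : WithTop ℕ∞) (Complex.ofRealCLM ∘ ψ) := by fun_prop
  simpa using h (hg₁.toSchwartzMap hg₂)

theorem fourier_continuous_of_integrable {G : V → ℂ} (hG : Integrable G volume) :
    Continuous (𝓕 G) :=
  VectorFourier.fourierIntegral_continuous Real.continuous_fourierChar
    (innerSL ℝ).continuous₂ hG

theorem integral_fourier_mul_eq_of_integrable {f g : V → ℂ} (hf : Integrable f volume)
    (hg : Integrable g volume) : ∫ x, 𝓕 f x * g x = ∫ x, f x * 𝓕 g x := by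
  have h := VectorFourier.integral_fourierIntegral_smul_eq_flip (L := innerₗ V)
    (e := Real.fourierChar) (μ := (volume : Measure V)) (ν := volume)
    Real.continuous_fourierChar continuous_inner hf hg
  rw [flip_innerₗ] at h
  exact h

/-- On `L¹ ∩ L²` the `L²` Fourier transform is the Fourier integral. -/
theorem fourier_toLp_ae_eq {G : V → ℂ} (h1 : Integrable G volume) (h2 : MemLp G 2 volume) :
    (𝓕 (h2.toLp G) : Lp ℂ 2 (volume : Measure V)) =ᵐ[volume] 𝓕 G := by
  refine ae_eq_of_integral_schwartz_mul_eq ((Lp.memLp _).locallyIntegrable (by norm_num))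
    (fourier_continuous_of_integrable h1).locallyIntegrable fun φ => ?_
  rw [integral_schwartz_mul_fourier_Lp, ← integral_fourier_mul_eq_of_integrable φ.integrable h1]
  refine integral_congr_ae ?_
  filter_upwards [h2.coeFn_toLp] with x hx
  rw [hx]

theorem lintegral_enorm_sq_eq_enorm_Lp (f : Lp ℂ 2 (volume : Measure V)) :
    ∫⁻ x, ‖f x‖ₑ ^ 2 = ‖f‖ₑ ^ 2 := by
  rw [Lp.enorm_def, eLpNorm_eq_lintegral_rpow_enorm_toReal (by norm_num) (by norm_num)]
  rw [← ENNReal.rpow_natCast, ← ENNReal.rpow_mul]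
  simp

theorem lintegral_enorm_sq_fourier_Lp (f : Lp ℂ 2 (volume : Measure V)) :
    ∫⁻ x, ‖(𝓕 f : Lp ℂ 2 (volume : Measure V)) x‖ₑ ^ 2 = ∫⁻ x, ‖f x‖ₑ ^ 2 := by
  rw [lintegral_enorm_sq_eq_enorm_Lp, lintegral_enorm_sq_eq_enorm_Lp, ← ofReal_norm,
    ← ofReal_norm, Lp.norm_fourier_eq]

theorem lintegral_enorm_sq_toLp {G : V → ℂ} (h2 : MemLp G 2 volume) :
    ∫⁻ x, ‖h2.toLp G x‖ₑ ^ 2 = ∫⁻ x, ‖G x‖ₑ ^ 2 := by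
  refine lintegral_congr_ae ?_
  filter_upwards [h2.coeFn_toLp] with x hx
  rw [hx]

/-- Plancherel for `L¹ ∩ L²`. -/
theorem lintegral_enorm_sq_fourier {G : V → ℂ} (h1 : Integrable G volume)
    (h2 : MemLp G 2 volume) : ∫⁻ x, ‖𝓕 G x‖ₑ ^ 2 = ∫⁻ x, ‖G x‖ₑ ^ 2 := by
  rw [← lintegral_enorm_sq_toLp h2, ← lintegral_enorm_sq_fourier_Lp]
  refine lintegral_congr_ae ?_
  filter_upwards [fourier_toLp_ae_eq h1 h2] with x hx
  rw [hx]

theorem memLp_two_char_mul {g : V → ℂ} (hg : MemLp g 2 volume) (h : V) :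
    MemLp (fun t => (Real.fourierChar (⟪t, h⟫) : ℂ) * g t) 2 volume := by
  refine hg.congr_norm ?_ (Eventually.of_forall fun t => by rw [norm_mul, Circle.norm_coe, one_mul])
  refine AEStronglyMeasurable.mul (Continuous.aestronglyMeasurable ?_) hg.1
  exact continuous_subtype_val.comp (Real.continuous_fourierChar.comp (by fun_prop))

/-- The convolution theorem for an `L¹ ∩ L²` multiplier acting on an `L²` function. -/
theorem integral_fourier_mul_fourier_Lp {a : V → ℂ} (h1 : Integrable a volume)
    (h2 : MemLp a 2 volume) (g : Lp ℂ 2 (volume : Measure V)) (x : V) :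
    ∫ t, 𝓕 a (x - t) * (𝓕 g : Lp ℂ 2 (volume : Measure V)) t = 𝓕 (fun s => a s * g s) x := by
  -- The function `b` is chosen so that the conjugate of its transform is `t ↦ 𝓕 a (x - t)`. The
  -- convolution is then the inner product of `𝓕 b` with `𝓕 g`, to which Plancherel applies.
  set b : V → ℂ := fun s => (Real.fourierChar (⟪s, x⟫) : ℂ) * conj (a s) with hb
  have h2c : MemLp (fun s => conj (a s)) 2 volume := h2.star
  have h1c : Integrable (fun s => conj (a s)) volume :=
    (Complex.conjLIE.toContinuousLinearEquiv.toContinuousLinearMap).integrable_comp h1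
  have hb2 : MemLp b 2 volume := memLp_two_char_mul h2c x
  have hb1 : Integrable b volume :=
    h1c.congr' hb2.1 (Eventually.of_forall fun t => by rw [hb, norm_mul, Circle.norm_coe, one_mul])
  have key : ∀ t, conj (𝓕 b t) = 𝓕 a (x - t) := by
    intro t
    rw [Real.fourier_eq, Real.fourier_eq, ← integral_conj]
    refine integral_congr_ae (Eventually.of_forall fun s => ?_)
    simp only [hb, Circle.smul_def, smul_eq_mul, map_mul, Complex.conj_conj]
    rw [inner_sub_right, neg_sub, sub_eq_add_neg, AddChar.map_add_eq_mul,
      AddChar.map_neg_eq_inv, AddChar.map_neg_eq_inv, Circle.coe_mul, Circle.coe_inv_eq_conj,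
      Circle.coe_inv_eq_conj]
    simp [mul_assoc]
  have hP := Lp.inner_fourier_eq (hb2.toLp b) g
  rw [MeasureTheory.L2.inner_def, MeasureTheory.L2.inner_def] at hP
  calc ∫ t, 𝓕 a (x - t) * (𝓕 g : Lp ℂ 2 (volume : Measure V)) t
      = ∫ t, inner ℂ ((𝓕 (hb2.toLp b) : Lp ℂ 2 (volume : Measure V)) t)
          ((𝓕 g : Lp ℂ 2 (volume : Measure V)) t) := by
        refine integral_congr_ae ?_
        filter_upwards [fourier_toLp_ae_eq hb1 hb2] with t ht
        rw [ht, RCLike.inner_apply, key, mul_comm]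
    _ = ∫ t, inner ℂ (hb2.toLp b t) (g t) := hP
    _ = 𝓕 (fun s => a s * g s) x := by
        rw [Real.fourier_eq]
        refine integral_congr_ae ?_
        filter_upwards [hb2.coeFn_toLp] with t ht
        rw [ht, RCLike.inner_apply, hb, Circle.smul_def, AddChar.map_neg_eq_inv,
          Circle.coe_inv_eq_conj]
        simp only [map_mul, Complex.conj_conj, smul_eq_mul]
        ring

theorem fourier_schwartz_sub (φ : 𝓢(V, ℂ)) (h t : V) :
    𝓕 (fun x => φ (x - h)) t = (Real.fourierChar (-⟪t, h⟫) : ℂ) * 𝓕 (φ : V → ℂ) t := by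
  have := congrFun (VectorFourier.fourierIntegral_comp_add_right Real.fourierChar
    (volume : Measure V) (innerₗ V) (φ : V → ℂ) (-h)) t
  simp only [innerₗ_apply_apply, inner_neg_left, Circle.smul_def, smul_eq_mul] at this
  rw [real_inner_comm]
  have e : (fun x => φ (x - h)) = (φ : V → ℂ) ∘ fun v => v + -h := by
    ext x; simp [sub_eq_add_neg]
  rw [e]
  exact this

/-- Translation of an `L²` Fourier transform is a modulation of the function. -/
theorem fourier_Lp_add_ae_eq (g : Lp ℂ 2 (volume : Measure V)) (h : V) :
    (fun x => (𝓕 g : Lp ℂ 2 (volume : Measure V)) (x + h)) =ᵐ[volume]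
      (𝓕 ((memLp_two_char_mul (Lp.memLp g) (-h)).toLp _) : Lp ℂ 2 (volume : Measure V)) := by
  have hmp : MeasurePreserving (fun x : V => x + h) volume volume :=
    measurePreserving_add_right volume h
  refine ae_eq_of_integral_schwartz_mul_eq
    (((Lp.memLp (𝓕 g : Lp ℂ 2 (volume : Measure V))).comp_measurePreserving
      hmp).locallyIntegrable (by norm_num))
    ((Lp.memLp _).locallyIntegrable (by norm_num)) fun φ => ?_
  rw [integral_schwartz_mul_fourier_Lp]
  have h1 : ∫ x, φ x * (𝓕 g : Lp ℂ 2 (volume : Measure V)) (x + h) =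
      ∫ x, φ.compSubConstCLM ℂ h x * (𝓕 g : Lp ℂ 2 (volume : Measure V)) x := by
    rw [← integral_add_right_eq_self (fun x => φ.compSubConstCLM ℂ h x *
      (𝓕 g : Lp ℂ 2 (volume : Measure V)) x) h]
    simp [SchwartzMap.compSubConstCLM_apply]
  rw [h1, integral_schwartz_mul_fourier_Lp]
  refine integral_congr_ae ?_
  filter_upwards [(memLp_two_char_mul (Lp.memLp g) (-h)).coeFn_toLp] with t ht
  rw [ht]
  have := fourier_schwartz_sub φ h t
  have e : (φ.compSubConstCLM ℂ h : V → ℂ) = fun x => φ (x - h) := by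
    ext x; simp [SchwartzMap.compSubConstCLM_apply]
  rw [e, this, inner_neg_right]
  ring

/-- Translating `𝓕 g` modulates `g`, so the difference is the transform of (character - 1) times
`g`, and Plancherel applies. This is the inner integral of the double integral at a fixed
displacement. -/
theorem lintegral_enorm_sq_fourier_Lp_add_sub (g : Lp ℂ 2 (volume : Measure V)) (h : V) :
    ∫⁻ x, ‖(𝓕 g : Lp ℂ 2 (volume : Measure V)) (x + h) -
        (𝓕 g : Lp ℂ 2 (volume : Measure V)) x‖ₑ ^ 2 =
      ∫⁻ t, ‖(Real.fourierChar (⟪t, -h⟫) : ℂ) - 1‖ₑ ^ 2 * ‖g t‖ₑ ^ 2 := by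
  set m := (memLp_two_char_mul (Lp.memLp g) (-h)).toLp _ with hm
  have h1 : ∀ᵐ x : V, (𝓕 g : Lp ℂ 2 (volume : Measure V)) (x + h) -
        (𝓕 g : Lp ℂ 2 (volume : Measure V)) x = (𝓕 (m - g) : Lp ℂ 2 (volume : Measure V)) x := by
    have e : (𝓕 (m - g) : Lp ℂ 2 (volume : Measure V)) = 𝓕 m - 𝓕 g :=
      map_sub (Lp.fourierTransformₗᵢ V ℂ) m g
    rw [e]
    filter_upwards [fourier_Lp_add_ae_eq g h, Lp.coeFn_sub (𝓕 m) (𝓕 g)] with x hx hx'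
    rw [hx', hx]; rfl
  rw [lintegral_congr_ae (h1.mono fun x hx => by rw [hx]), lintegral_enorm_sq_fourier_Lp]
  refine lintegral_congr_ae ?_
  filter_upwards [Lp.coeFn_sub m g,
    (memLp_two_char_mul (Lp.memLp g) (-h)).coeFn_toLp] with t ht ht'
  rw [ht, Pi.sub_apply, hm, ht', ← mul_pow, ← enorm_mul, sub_mul, one_mul]

end FourierLTwo

/-! ### One-dimensional Gaussian integrals. -/

section GaussianIntegrals

open scoped FourierTransform ENNReal RealInnerProductSpace

theorem image_div_Ioi {b : ℝ} (hb : 0 < b) : (fun x : ℝ => b / x) '' Ioi 0 = Ioi 0 := by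
  ext v
  simp only [mem_image, mem_Ioi]
  refine ⟨?_, fun hv => ⟨b / v, by positivity, by field_simp⟩⟩
  rintro ⟨x, hx, rfl⟩
  positivity

theorem hasDerivWithinAt_const_div {b x : ℝ} (hx : x ≠ 0) (s : Set ℝ) :
    HasDerivWithinAt (fun x : ℝ => b / x) (-(b / x ^ 2)) s x := by
  have := ((hasDerivAt_inv hx).const_mul b).hasDerivWithinAt (s := s)
  refine (this.congr_deriv (by ring)).congr (fun y _ => by rw [div_eq_mul_inv])
    (by rw [div_eq_mul_inv])

/-- The substitution `x ↦ b / x` on the half-line. -/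
theorem lintegral_Ioi_eq_comp_div {b : ℝ} (hb : 0 < b) (g : ℝ → ℝ≥0∞) :
    ∫⁻ x in Ioi (0 : ℝ), g x = ∫⁻ x in Ioi (0 : ℝ), ENNReal.ofReal (b / x ^ 2) * g (b / x) := by
  have h := lintegral_image_eq_lintegral_abs_deriv_mul (measurableSet_Ioi (a := (0 : ℝ)))
    (f := fun x : ℝ => b / x) (f' := fun x => -(b / x ^ 2))
    (fun x hx => hasDerivWithinAt_const_div (ne_of_gt hx) _)
    (fun x hx y hy hxy => by
      have hx' : x ≠ 0 := ne_of_gt hx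
      have hy' : y ≠ 0 := ne_of_gt hy
      field_simp at hxy
      exact hxy.symm) g
  rw [image_div_Ioi hb] at h
  rw [h]
  refine setLIntegral_congr_fun measurableSet_Ioi fun x hx => ?_
  rw [abs_neg, abs_of_nonneg (by positivity)]

theorem image_sub_div_Ioi {b : ℝ} (hb : 0 < b) :
    (fun x : ℝ => x - b / x) '' Ioi 0 = univ := by
  refine eq_univ_of_forall fun v => ?_
  have hs : √(v ^ 2 + 4 * b) ^ 2 = v ^ 2 + 4 * b := Real.sq_sqrt (by positivity)
  have hlt : |v| < √(v ^ 2 + 4 * b) := by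
    rw [← Real.sqrt_sq_eq_abs]
    exact Real.sqrt_lt_sqrt (sq_nonneg v) (by linarith)
  have hpos : 0 < v + √(v ^ 2 + 4 * b) := by linarith [neg_abs_le v]
  -- The positive root of `x² - v x - b = 0`.
  refine ⟨(v + √(v ^ 2 + 4 * b)) / 2, by simpa using hpos, ?_⟩
  simp only
  field_simp
  nlinarith

theorem lintegral_gaussian : ∫⁻ v : ℝ, ENNReal.ofReal (Real.exp (-v ^ 2)) =
    ENNReal.ofReal √Real.pi := by
  have h := integral_gaussian 1
  have hi := integrable_exp_neg_mul_sq one_pos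
  simp only [neg_mul, one_mul, div_one] at h hi
  rw [← h, ofReal_integral_eq_lintegral_ofReal hi (Eventually.of_forall fun x => by positivity)]

theorem lintegral_gaussian_Ioi : ∫⁻ v in Ioi (0 : ℝ), ENNReal.ofReal (Real.exp (-v ^ 2)) =
    ENNReal.ofReal (√Real.pi / 2) := by
  have h := integral_gaussian_Ioi 1
  have hi := (integrable_exp_neg_mul_sq one_pos).integrableOn (s := Ioi (0 : ℝ))
  simp only [neg_mul, one_mul, div_one] at h hi
  rw [← h, ofReal_integral_eq_lintegral_ofReal hi (Eventually.of_forall fun x => by positivity)]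

/-- The Cauchy-Schlömilch substitution for the Gaussian. -/
theorem lintegral_gaussian_sub_div {b : ℝ} (hb : 0 < b) :
    ∫⁻ x in Ioi (0 : ℝ), ENNReal.ofReal (Real.exp (-(x - b / x) ^ 2)) =
      ENNReal.ofReal (√Real.pi / 2) := by
  set J := ∫⁻ x in Ioi (0 : ℝ), ENNReal.ofReal (Real.exp (-(x - b / x) ^ 2)) with hJ
  -- The inversion `x ↦ b / x` only changes the sign of `x - b / x`. Adding the two forms of `J`
  -- produces the weight `1 + b / x²`, the Jacobian of `x ↦ x - b / x`, so `2J` is the Gaussian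
  -- integral over the whole line.
  have h1 : J = ∫⁻ x in Ioi (0 : ℝ), ENNReal.ofReal (b / x ^ 2) *
      ENNReal.ofReal (Real.exp (-(x - b / x) ^ 2)) := by
    rw [hJ, lintegral_Ioi_eq_comp_div hb]
    refine setLIntegral_congr_fun measurableSet_Ioi fun x hx => ?_
    have hx' : x ≠ 0 := ne_of_gt hx
    congr 4
    field_simp
    ring
  have h2 := lintegral_image_eq_lintegral_abs_deriv_mul (measurableSet_Ioi (a := (0 : ℝ)))
    (f := fun x : ℝ => x - b / x) (f' := fun x => 1 - -(b / x ^ 2))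
    (fun x hx => (hasDerivWithinAt_id x _).sub (hasDerivWithinAt_const_div (ne_of_gt hx) _))
    (fun x (hx : 0 < x) y (hy : 0 < y) hxy => by
      simp only at hxy
      have : (x - y) * (1 + b / (x * y)) = 0 := by
        have : (x - y) * (1 + b / (x * y)) = (x - b / x) - (y - b / y) := by
          field_simp; ring
        rw [this, hxy, sub_self]
      have h3 : 1 + b / (x * y) ≠ 0 := by positivity
      exact sub_eq_zero.mp ((mul_eq_zero.mp this).resolve_right h3))
    (fun v => ENNReal.ofReal (Real.exp (-v ^ 2)))
  rw [image_sub_div_Ioi hb, setLIntegral_univ, lintegral_gaussian] at h2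
  have h3 : J + J = ENNReal.ofReal √Real.pi := by
    nth_rewrite 2 [h1]
    rw [h2, hJ, ← lintegral_add_left (by fun_prop)]
    refine setLIntegral_congr_fun measurableSet_Ioi fun x hx => ?_
    rw [abs_of_nonneg (by rw [sub_neg_eq_add]; positivity), sub_neg_eq_add,
      ENNReal.ofReal_add zero_le_one (by positivity), add_mul, ENNReal.ofReal_one, one_mul]
  have h4 : ENNReal.ofReal (√Real.pi / 2) + ENNReal.ofReal (√Real.pi / 2) =
      ENNReal.ofReal √Real.pi := by
    rw [← ENNReal.ofReal_add (by positivity) (by positivity), add_halves]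
  rw [← h4, ← two_mul, ← two_mul] at h3
  exact (ENNReal.mul_right_inj (by norm_num) (by norm_num)).mp h3

/-- Subordination of the exponential to the Gaussian. -/
theorem lintegral_exp_neg_sq_sub_div_sq {b : ℝ} (hb : 0 ≤ b) :
    ∫⁻ x in Ioi (0 : ℝ), ENNReal.ofReal (Real.exp (-x ^ 2 - b ^ 2 / x ^ 2)) =
      ENNReal.ofReal (√Real.pi / 2 * Real.exp (-(2 * b))) := by
  rcases hb.eq_or_lt with rfl | hb
  · simpa using lintegral_gaussian_Ioi
  rw [ENNReal.ofReal_mul (by positivity), ← lintegral_gaussian_sub_div hb,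
    ← lintegral_mul_const _ (by fun_prop)]
  refine setLIntegral_congr_fun measurableSet_Ioi fun x hx => ?_
  have hx' : x ≠ 0 := ne_of_gt hx
  -- Completing the square: `-x² - b²/x² = -(x - b/x)² - 2b`.
  rw [← ENNReal.ofReal_mul (by positivity), ← Real.exp_add]
  congr 2
  field_simp
  ring

theorem integral_exp_neg_sq_sub_div_sq {b : ℝ} (hb : 0 ≤ b) :
    ∫ x in Ioi (0 : ℝ), Real.exp (-x ^ 2 - b ^ 2 / x ^ 2) =
      √Real.pi / 2 * Real.exp (-(2 * b)) := by
  rw [integral_eq_lintegral_of_nonneg_ae (Eventually.of_forall fun x => by positivity)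
    (by fun_prop), lintegral_exp_neg_sq_sub_div_sq hb, ENNReal.toReal_ofReal (by positivity)]

/-- Writes `A⁻²` as a superposition of Gaussians. It is used with `A = |h|²` for the singular kernel
`|h|⁻⁴` and with `A = 1 + |ξ|²/y²` for the Poisson kernel. -/
theorem integral_cube_mul_exp {A : ℝ} (hA : 0 < A) :
    ∫ x in Ioi (0 : ℝ), x ^ 3 * Real.exp (-A * x ^ 2) = 1 / (2 * A ^ 2) := by
  have h := integral_rpow_mul_exp_neg_mul_rpow (p := 2) (q := 3) two_pos (by norm_num) hA
  have e : ∀ x : ℝ, x ^ (3 : ℝ) * Real.exp (-A * x ^ (2 : ℝ)) =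
      x ^ 3 * Real.exp (-A * x ^ 2) := fun x => by norm_cast
  simp only [e] at h
  rw [h, show ((3 : ℝ) + 1) / 2 = (1 : ℕ) + 1 by norm_num, Real.Gamma_nat_eq_factorial,
    show -((3 : ℝ) + 1) / 2 = ((-2 : ℤ) : ℝ) by norm_num, Real.rpow_intCast]
  simp [zpow_neg]

theorem integrableOn_cube_mul_exp {A : ℝ} (hA : 0 < A) :
    IntegrableOn (fun x : ℝ => x ^ 3 * Real.exp (-A * x ^ 2)) (Ioi 0) := by
  have h := integrableOn_rpow_mul_exp_neg_mul_sq (s := 3) hA (by norm_num)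
  have e : ∀ x : ℝ, x ^ (3 : ℝ) = x ^ 3 := fun x => by norm_cast
  simpa only [e] using h

/-- Write the integrand as the integral over `b ∈ (0, c)` of its derivative in the parameter and
exchange the integrals. The substitution `x ↦ b / x` shows that each inner integral is `2 ∫ e^{-v²}
= √π`, whatever `b` is. -/
theorem lintegral_one_sub_exp_neg_div_sq {c : ℝ} (hc : 0 ≤ c) :
    ∫⁻ x in Ioi (0 : ℝ), ENNReal.ofReal (1 - Real.exp (-(c ^ 2 / x ^ 2))) =
      ENNReal.ofReal (c * √Real.pi) := by
  have h1 : ∀ x ∈ Ioi (0 : ℝ), ENNReal.ofReal (1 - Real.exp (-(c ^ 2 / x ^ 2))) =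
      ∫⁻ b in Ioc 0 c, ENNReal.ofReal (2 * b / x ^ 2 * Real.exp (-(b ^ 2 / x ^ 2))) := by
    intro x hx
    have hd : ∀ b ∈ uIcc 0 c, HasDerivAt (fun b => -Real.exp (-(b ^ 2 / x ^ 2)))
        (2 * b / x ^ 2 * Real.exp (-(b ^ 2 / x ^ 2))) b := by
      intro b _
      have := (((hasDerivAt_pow 2 b).div_const (x ^ 2)).neg.exp).neg
      refine this.congr_deriv ?_
      simp; ring
    have hcont : Continuous fun b => 2 * b / x ^ 2 * Real.exp (-(b ^ 2 / x ^ 2)) := by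
      have : x ≠ 0 := ne_of_gt hx
      fun_prop
    have h := intervalIntegral.integral_eq_sub_of_hasDerivAt hd (hcont.intervalIntegrable _ _)
    rw [intervalIntegral.integral_of_le hc] at h
    rw [← ofReal_integral_eq_lintegral_ofReal
      ((hcont.intervalIntegrable 0 c).1) ?_, h]
    · congr 1; simp; ring
    · filter_upwards [ae_restrict_mem measurableSet_Ioc] with b hb
      have := hb.1.le
      positivity
  rw [setLIntegral_congr_fun measurableSet_Ioi h1, lintegral_lintegral_swap (by fun_prop)]
  have h2 : ∀ b ∈ Ioc 0 c, ∫⁻ x in Ioi (0 : ℝ),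
      ENNReal.ofReal (2 * b / x ^ 2 * Real.exp (-(b ^ 2 / x ^ 2))) = ENNReal.ofReal √Real.pi := by
    intro b hb
    have h3 := lintegral_Ioi_eq_comp_div hb.1
      (fun v => ENNReal.ofReal (2 * Real.exp (-v ^ 2)))
    have h4 : ∫⁻ v in Ioi (0 : ℝ), ENNReal.ofReal (2 * Real.exp (-v ^ 2)) =
        ENNReal.ofReal √Real.pi := by
      simp only [ENNReal.ofReal_mul zero_le_two]
      rw [lintegral_const_mul _ (by fun_prop), lintegral_gaussian_Ioi,
        ← ENNReal.ofReal_mul zero_le_two]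
      congr 1; ring
    rw [← h4, h3]
    refine setLIntegral_congr_fun measurableSet_Ioi fun x hx => ?_
    have := hb.1
    rw [← ENNReal.ofReal_mul (by positivity)]
    congr 1
    rw [div_pow]; ring
  rw [setLIntegral_congr_fun measurableSet_Ioc h2, setLIntegral_const, Real.volume_Ioc, sub_zero,
    ← ENNReal.ofReal_mul (by positivity), mul_comm]

end GaussianIntegrals

/-! ### The Poisson kernel as a Fourier transform, and the Lévy-Khintchine integral. -/

section PoissonKernel

open scoped FourierTransform ENNReal RealInnerProductSpace

theorem pi_div_sq_rpow {β : ℝ} (hβ : 0 < β) :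
    (Real.pi / β ^ 2) ^ ((3 : ℝ) / 2) = (√Real.pi / β) ^ 3 := by
  have e : Real.pi / β ^ 2 = (√Real.pi / β) ^ (2 : ℝ) := by
    rw [Real.rpow_two, div_pow, Real.sq_sqrt Real.pi_pos.le]
  rw [e, ← Real.rpow_mul (by positivity), ← Real.rpow_natCast]
  norm_num

theorem integrable_exp_neg_mul_norm_sq {β : ℝ} (hβ : 0 < β) :
    Integrable (fun t : E3 => Real.exp (-(β ^ 2 * ‖t‖ ^ 2))) volume := by
  have hb : 0 < ((β ^ 2 : ℝ) : ℂ).re := by rw [Complex.ofReal_re]; positivity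
  have h := (GaussianFourier.integrable_cexp_neg_mul_sq_norm_add hb 0 (0 : E3)).re
  refine h.congr (Eventually.of_forall fun t => ?_)
  have : -((β ^ 2 : ℝ) : ℂ) * (‖t‖ : ℂ) ^ 2 + 0 * (⟪(0 : E3), t⟫ : ℂ) =
      ((-(β ^ 2 * ‖t‖ ^ 2) : ℝ) : ℂ) := by push_cast; ring
  simp only [this, ← Complex.ofReal_exp]
  exact Complex.ofReal_re _

theorem integral_exp_neg_mul_norm_sq {β : ℝ} (hβ : 0 < β) :
    ∫ t : E3, Real.exp (-(β ^ 2 * ‖t‖ ^ 2)) = (√Real.pi / β) ^ 3 := by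
  have h := GaussianFourier.integral_rexp_neg_mul_sq_norm (V := E3)
    (show 0 < β ^ 2 by positivity)
  rw [finrank_euclideanSpace_fin, Nat.cast_ofNat, pi_div_sq_rpow hβ] at h
  rw [← h]
  simp only [neg_mul]

theorem fourier_exp_neg_mul_norm_sq {β : ℝ} (hβ : 0 < β) (ξ : E3) :
    𝓕 (fun t : E3 => ((Real.exp (-(β ^ 2 * ‖t‖ ^ 2)) : ℝ) : ℂ)) ξ =
      (((√Real.pi / β) ^ 3 * Real.exp (-(Real.pi ^ 2 * ‖ξ‖ ^ 2 / β ^ 2)) : ℝ) : ℂ) := by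
  have hb : 0 < ((β ^ 2 : ℝ) : ℂ).re := by rw [Complex.ofReal_re]; positivity
  have h := fourier_gaussian_innerProductSpace hb ξ
  rw [finrank_euclideanSpace_fin] at h
  have e : (Real.pi : ℂ) / ((β ^ 2 : ℝ) : ℂ) = ((Real.pi / β ^ 2 : ℝ) : ℂ) := by push_cast; rfl
  have e2 : ((3 : ℕ) : ℂ) / 2 = (((3 : ℝ) / 2 : ℝ) : ℂ) := by push_cast; rfl
  rw [e, e2, ← Complex.ofReal_cpow (by positivity), pi_div_sq_rpow hβ] at h
  have efun : (fun t : E3 => ((Real.exp (-(β ^ 2 * ‖t‖ ^ 2)) : ℝ) : ℂ)) =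
      fun t => Complex.exp (-((β ^ 2 : ℝ) : ℂ) * ‖t‖ ^ 2) := by
    ext t
    push_cast
    ring_nf
  rw [efun, h]
  push_cast
  ring_nf

/-- The Poisson kernel of the half-space at height `y`. -/
def poissonKernel (y : ℝ) (x : E3) : ℝ := y / (Real.pi ^ 2 * (‖x‖ ^ 2 + y ^ 2) ^ 2)

/-- The Fourier multiplier of the Poisson semigroup. -/
def poissonSymbol (y : ℝ) (t : E3) : ℝ := Real.exp (-(2 * Real.pi * y * ‖t‖))

theorem continuous_poissonSymbol (y : ℝ) : Continuous (poissonSymbol y) := by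
  unfold poissonSymbol; fun_prop

/-- Subordination with `b = πy|t|`: the symbol becomes an average of Gaussians in `t`, whose Fourier
transforms are explicit. -/
theorem poissonSymbol_eq_integral {y : ℝ} (hy : 0 < y) (t : E3) :
    poissonSymbol y t = 2 / √Real.pi * ∫ x in Ioi (0 : ℝ),
      Real.exp (-x ^ 2) * Real.exp (-((Real.pi * y / x) ^ 2 * ‖t‖ ^ 2)) := by
  have h := integral_exp_neg_sq_sub_div_sq (b := Real.pi * y * ‖t‖) (by positivity)
  have e : ∀ x : ℝ, Real.exp (-x ^ 2) * Real.exp (-((Real.pi * y / x) ^ 2 * ‖t‖ ^ 2)) =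
      Real.exp (-x ^ 2 - (Real.pi * y * ‖t‖) ^ 2 / x ^ 2) := by
    intro x
    rw [← Real.exp_add]
    congr 1
    ring
  simp only [e]
  rw [h, poissonSymbol]
  have : √Real.pi ≠ 0 := by positivity
  field_simp

/-- This licenses Fubini in the transform of the symbol. Integrating the Gaussian over `t` first
gives a constant times `x³ e^{-x²}`. -/
theorem integrable_subordination {y : ℝ} (hy : 0 < y) :
    Integrable (fun p : E3 × ℝ =>
      Real.exp (-p.2 ^ 2) * Real.exp (-((Real.pi * y / p.2) ^ 2 * ‖p.1‖ ^ 2)))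
      ((volume : Measure E3).prod (volume.restrict (Ioi (0 : ℝ)))) := by
  rw [integrable_prod_iff' (by fun_prop)]
  constructor
  · filter_upwards [ae_restrict_mem measurableSet_Ioi] with x hx
    have hx : 0 < x := hx
    exact (integrable_exp_neg_mul_norm_sq (by positivity)).const_mul _
  · have h := ((integrableOn_cube_mul_exp one_pos).const_mul ((√Real.pi / (Real.pi * y)) ^ 3))
    refine (integrable_congr ?_).mp h
    filter_upwards [ae_restrict_mem measurableSet_Ioi] with x hx
    have hx : 0 < x := hx
    simp only [norm_mul, Real.norm_eq_abs, Real.abs_exp]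
    rw [integral_const_mul, integral_exp_neg_mul_norm_sq (by positivity)]
    rw [neg_one_mul]
    field_simp

/-- The Fourier transform of `e^{-2π y |t|}` on `ℝ³` is the Poisson kernel. -/
theorem fourier_poissonSymbol {y : ℝ} (hy : 0 < y) (ξ : E3) :
    𝓕 (fun t : E3 => (poissonSymbol y t : ℂ)) ξ = (poissonKernel y ξ : ℂ) := by
  have hI := (integrable_subordination hy).ofReal (𝕜 := ℂ)
  have hI2 : Integrable (fun p : E3 × ℝ => (Real.fourierChar (-⟪p.1, ξ⟫) : ℂ) *
      ((Real.exp (-p.2 ^ 2) * Real.exp (-((Real.pi * y / p.2) ^ 2 * ‖p.1‖ ^ 2)) : ℝ) : ℂ))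
      ((volume : Measure E3).prod (volume.restrict (Ioi (0 : ℝ)))) := by
    refine hI.congr' ?_ (Eventually.of_forall fun p => by rw [norm_mul, Circle.norm_coe, one_mul]; rfl)
    refine AEStronglyMeasurable.mul (Continuous.aestronglyMeasurable ?_) hI.1
    exact continuous_subtype_val.comp (Real.continuous_fourierChar.comp (by fun_prop))
  -- With `β = πy/x` the transformed Gaussian has exponent `-x²|ξ|²/y²`. Together with the factor
  -- `e^{-x²}` the total rate in `x²` is this quantity.
  have hA : 0 < 1 + ‖ξ‖ ^ 2 / y ^ 2 := by positivity
  calc 𝓕 (fun t : E3 => (poissonSymbol y t : ℂ)) ξ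
      = ∫ t : E3, ((2 / √Real.pi : ℝ) : ℂ) * ∫ x in Ioi (0 : ℝ),
          (Real.fourierChar (-⟪t, ξ⟫) : ℂ) * ((Real.exp (-x ^ 2) *
            Real.exp (-((Real.pi * y / x) ^ 2 * ‖t‖ ^ 2)) : ℝ) : ℂ) := by
        rw [Real.fourier_eq]
        refine integral_congr_ae (Eventually.of_forall fun t => ?_)
        simp only
        rw [poissonSymbol_eq_integral hy, integral_const_mul, integral_complex_ofReal,
          Circle.smul_def, smul_eq_mul]
        push_cast
        ring
    _ = ((2 / √Real.pi : ℝ) : ℂ) * ∫ x in Ioi (0 : ℝ), ∫ t : E3,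
          (Real.fourierChar (-⟪t, ξ⟫) : ℂ) * ((Real.exp (-x ^ 2) *
            Real.exp (-((Real.pi * y / x) ^ 2 * ‖t‖ ^ 2)) : ℝ) : ℂ) := by
        rw [integral_const_mul, integral_integral_swap hI2]
    _ = ((2 / √Real.pi : ℝ) : ℂ) * ∫ x in Ioi (0 : ℝ),
          (((1 / (√Real.pi * y)) ^ 3 *
            (x ^ 3 * Real.exp (-(1 + ‖ξ‖ ^ 2 / y ^ 2) * x ^ 2)) : ℝ) : ℂ) := by
        congr 1
        refine setIntegral_congr_fun measurableSet_Ioi fun x hx => ?_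
        have hx : 0 < x := hx
        have h := fourier_exp_neg_mul_norm_sq (β := Real.pi * y / x) (by positivity) ξ
        rw [Real.fourier_eq] at h
        have e : ∀ t : E3, (Real.fourierChar (-⟪t, ξ⟫) : ℂ) * ((Real.exp (-x ^ 2) *
            Real.exp (-((Real.pi * y / x) ^ 2 * ‖t‖ ^ 2)) : ℝ) : ℂ) =
            ((Real.exp (-x ^ 2) : ℝ) : ℂ) * (Real.fourierChar (-⟪t, ξ⟫) •
              ((Real.exp (-((Real.pi * y / x) ^ 2 * ‖t‖ ^ 2)) : ℝ) : ℂ)) := by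
          intro t
          rw [Circle.smul_def, smul_eq_mul]
          push_cast
          ring
        simp only [e]
        rw [integral_const_mul, h, ← Complex.ofReal_mul, Complex.ofReal_inj]
        have e2 : √Real.pi / (Real.pi * y / x) = 1 / (√Real.pi * y) * x := by
          have := Real.mul_self_sqrt Real.pi_pos.le
          have h0 : √Real.pi ≠ 0 := by positivity
          field_simp
          linarith
        have e3 : Real.exp (-x ^ 2) * Real.exp (-(Real.pi ^ 2 * ‖ξ‖ ^ 2 / (Real.pi * y / x) ^ 2)) =
            Real.exp (-(1 + ‖ξ‖ ^ 2 / y ^ 2) * x ^ 2) := by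
          rw [← Real.exp_add]
          congr 1
          field_simp
          ring
        rw [e2, ← e3]
        ring
    _ = (poissonKernel y ξ : ℂ) := by
        rw [integral_complex_ofReal, integral_const_mul, integral_cube_mul_exp hA,
          ← Complex.ofReal_mul, Complex.ofReal_inj, poissonKernel]
        have h4 : √Real.pi ^ 4 = Real.pi ^ 2 := by
          rw [show (4 : ℕ) = 2 * 2 by rfl, pow_mul, Real.sq_sqrt Real.pi_pos.le]
        have h0 : √Real.pi ≠ 0 := by positivity
        rw [← h4]
        field_simp
        ring

theorem norm_fourierChar_sub_one_sq (θ : ℝ) :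
    ‖(Real.fourierChar θ : ℂ) - 1‖ ^ 2 = 2 - 2 * Real.cos (2 * Real.pi * θ) := by
  rw [Real.fourierChar_apply, ← Complex.normSq_eq_norm_sq, Complex.normSq_apply]
  have := Real.sin_sq_add_cos_sq (2 * Real.pi * θ)
  rw [Complex.sub_re, Complex.sub_im, Complex.exp_ofReal_mul_I_re, Complex.exp_ofReal_mul_I_im]
  simp only [Complex.one_re, Complex.one_im]
  nlinarith

/-- The cosine term is the real part of the Fourier transform of a Gaussian. The factor `x³` cancels
the Gaussian mass `(√π/x)³`, which leaves a function of `x` with a known integral. -/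
theorem lintegral_gaussian_mul_char {x : ℝ} (hx : 0 < x) (t : E3) :
    ∫⁻ h : E3, ENNReal.ofReal ((2 - 2 * Real.cos (2 * Real.pi * ⟪t, -h⟫)) *
        (2 * (x ^ 3 * Real.exp (-(x ^ 2 * ‖h‖ ^ 2))))) =
      ENNReal.ofReal (4 * √Real.pi ^ 3) *
        ENNReal.ofReal (1 - Real.exp (-((Real.pi * ‖t‖) ^ 2 / x ^ 2))) := by
  have hg := integrable_exp_neg_mul_norm_sq hx
  have hF := fourier_exp_neg_mul_norm_sq hx t
  have hcos : ∫ h : E3, Real.cos (2 * Real.pi * ⟪t, -h⟫) * Real.exp (-(x ^ 2 * ‖h‖ ^ 2)) =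
      (√Real.pi / x) ^ 3 * Real.exp (-(Real.pi ^ 2 * ‖t‖ ^ 2 / x ^ 2)) := by
    have h := congrArg Complex.re hF
    rw [Complex.ofReal_re, Real.fourier_eq] at h
    rw [← h, ← RCLike.re_eq_complex_re, ← integral_re]
    · refine integral_congr_ae (Eventually.of_forall fun s => ?_)
      simp only [Circle.smul_def, smul_eq_mul, Real.fourierChar_apply, RCLike.re_eq_complex_re,
        Complex.re_mul_ofReal, Complex.exp_ofReal_mul_I_re]
      rw [inner_neg_right, real_inner_comm]
    · exact (Real.fourierIntegral_convergent_iff t).2 hg.ofReal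
  have hci : Integrable (fun h : E3 => Real.cos (2 * Real.pi * ⟪t, -h⟫) *
      Real.exp (-(x ^ 2 * ‖h‖ ^ 2))) volume := by
    refine hg.bdd_mul (c := 1) (Continuous.aestronglyMeasurable (by fun_prop))
      (Eventually.of_forall fun h => ?_)
    exact Real.abs_cos_le_one _
  have e : ∀ h : E3, (2 - 2 * Real.cos (2 * Real.pi * ⟪t, -h⟫)) *
        (2 * (x ^ 3 * Real.exp (-(x ^ 2 * ‖h‖ ^ 2)))) =
      4 * x ^ 3 * (Real.exp (-(x ^ 2 * ‖h‖ ^ 2)) -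
        Real.cos (2 * Real.pi * ⟪t, -h⟫) * Real.exp (-(x ^ 2 * ‖h‖ ^ 2))) := by
    intro h; ring
  rw [← ofReal_integral_eq_lintegral_ofReal]
  · simp only [e]
    rw [integral_const_mul, integral_sub hg hci, hcos, integral_exp_neg_mul_norm_sq hx,
      ← ENNReal.ofReal_mul (by positivity)]
    congr 1
    rw [mul_pow]
    field_simp
  · simp only [e]
    exact (hg.sub hci).const_mul _
  · refine Eventually.of_forall fun h => ?_
    have : 0 ≤ 2 - 2 * Real.cos (2 * Real.pi * ⟪t, -h⟫) := by
      linarith [Real.cos_le_one (2 * Real.pi * ⟪t, -h⟫)]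
    simp only [Pi.zero_apply]
    positivity

/-- The Lévy-Khintchine integral `∫ |e^{2πi t·h} - 1|² |h|⁻⁴ dh = 4 π³ |t|` on `ℝ³`. -/
theorem lintegral_char_sub_one_sq_div_norm_pow (t : E3) :
    ∫⁻ h : E3, ENNReal.ofReal (‖(Real.fourierChar ⟪t, -h⟫ : ℂ) - 1‖ ^ 2 / ‖h‖ ^ 4) =
      ENNReal.ofReal (4 * Real.pi ^ 3 * ‖t‖) := by
  have hne : ∀ᵐ h : E3, h ≠ 0 := by
    simp [ae_iff]
  -- Uses `|h|⁻⁴ = ∫₀^∞ 2x³ e^{-x²|h|²} dx`, which is available only for `h ≠ 0`. After exchanging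
  -- the integrals, the one over `h` is a Gaussian one.
  have h1 : ∀ᵐ h : E3, ENNReal.ofReal (‖(Real.fourierChar ⟪t, -h⟫ : ℂ) - 1‖ ^ 2 / ‖h‖ ^ 4) =
      ∫⁻ x in Ioi (0 : ℝ), ENNReal.ofReal ((2 - 2 * Real.cos (2 * Real.pi * ⟪t, -h⟫)) *
        (2 * (x ^ 3 * Real.exp (-(x ^ 2 * ‖h‖ ^ 2))))) := by
    filter_upwards [hne] with h hh
    have hpos : 0 < ‖h‖ ^ 2 := by positivity
    have hc : 0 ≤ 2 - 2 * Real.cos (2 * Real.pi * ⟪t, -h⟫) := by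
      linarith [Real.cos_le_one (2 * Real.pi * ⟪t, -h⟫)]
    have e : ∀ x : ℝ, x ^ 3 * Real.exp (-(x ^ 2 * ‖h‖ ^ 2)) =
        x ^ 3 * Real.exp (-(‖h‖ ^ 2) * x ^ 2) := fun x => by ring_nf
    rw [← ofReal_integral_eq_lintegral_ofReal]
    · rw [integral_const_mul, integral_const_mul]
      simp only [e]
      rw [integral_cube_mul_exp hpos, norm_fourierChar_sub_one_sq]
      congr 1
      field_simp
    · simp only [e]
      exact ((integrableOn_cube_mul_exp hpos).const_mul _).const_mul _
    · filter_upwards [ae_restrict_mem measurableSet_Ioi] with x hx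
      have : 0 < x := hx
      simp only [Pi.zero_apply]
      positivity
  rw [lintegral_congr_ae h1, lintegral_lintegral_swap (by fun_prop)]
  rw [setLIntegral_congr_fun measurableSet_Ioi fun x hx => lintegral_gaussian_mul_char hx t]
  rw [lintegral_const_mul _ (by fun_prop), lintegral_one_sub_exp_neg_div_sq (by positivity),
    ← ENNReal.ofReal_mul (by positivity)]
  congr 1
  have h4 : √Real.pi ^ 4 = Real.pi ^ 2 := by
    rw [show (4 : ℕ) = 2 * 2 by rfl, pow_mul, Real.sq_sqrt Real.pi_pos.le]
  linear_combination 4 * Real.pi * ‖t‖ * h4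

end PoissonKernel

/-! ### A Phragmén-Lindelöf maximum principle on the half-space. -/

section Harmonic

open scoped RealInnerProductSpace

/-- Second order necessary condition at a point where a quadratic touches from above along a
line. -/
theorem fderiv_fderiv_le_of_isLocalMax {E : Type*} [NormedAddCommGroup E] [NormedSpace ℝ E]
    {v : E → ℝ} {q e : E}
    (h1 : ∀ᶠ p in 𝓝 q, DifferentiableAt ℝ v p) (h2 : DifferentiableAt ℝ (fderiv ℝ v) q)
    {a b c : ℝ}
    (hmax : IsLocalMax (fun τ : ℝ => v (q + τ • e) - (a + b * τ + c * τ ^ 2)) 0) :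
    fderiv ℝ (fderiv ℝ v) q e e ≤ 2 * c := by
  set g : ℝ → ℝ := fun τ => v (q + τ • e) - (a + b * τ + c * τ ^ 2) with hg
  have hline : ∀ τ : ℝ, HasDerivAt (fun τ : ℝ => q + τ • e) e τ := fun τ => by
    simpa using ((hasDerivAt_id τ).smul_const e).const_add q
  have htend : Tendsto (fun τ : ℝ => q + τ • e) (𝓝 0) (𝓝 q) := by
    have := (hline 0).continuousAt.tendsto
    simpa using this
  have hd : ∀ᶠ τ in 𝓝 (0 : ℝ), deriv g τ = fderiv ℝ v (q + τ • e) e - (b + 2 * c * τ) := by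
    filter_upwards [htend.eventually h1] with τ hτ
    have hv := hτ.hasFDerivAt.comp_hasDerivAt τ (hline τ)
    have hp : HasDerivAt (fun τ : ℝ => a + b * τ + c * τ ^ 2) (b + 2 * c * τ) τ := by
      have := (((hasDerivAt_id τ).const_mul b).const_add a).add
        ((hasDerivAt_pow 2 τ).const_mul c)
      refine this.congr_deriv ?_
      simp; ring
    exact (hv.sub hp).deriv
  have hdd : HasDerivAt (deriv g) (fderiv ℝ (fderiv ℝ v) q e e - 2 * c) 0 := by
    have h2' : HasFDerivAt (fun p => fderiv ℝ v p e) ((fderiv ℝ (fderiv ℝ v) q).flip e)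
        (q + (0 : ℝ) • e) := by
      rw [zero_smul, add_zero]
      have h0 := (ContinuousLinearMap.apply ℝ ℝ e).hasFDerivAt.comp q h2.hasFDerivAt
      exact h0
    have h3 : HasDerivAt (fun τ : ℝ => fderiv ℝ v (q + τ • e) e)
        (fderiv ℝ (fderiv ℝ v) q e e) 0 := by
      have := HasFDerivAt.comp_hasDerivAt (0 : ℝ) h2' (hline 0)
      exact this
    have hp : HasDerivAt (fun τ : ℝ => b + 2 * c * τ) (2 * c) 0 := by
      simpa using ((hasDerivAt_id (0 : ℝ)).const_mul (2 * c)).const_add b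
    have h4 := h3.sub hp
    exact HasDerivAt.congr_of_eventuallyEq h4 hd
  have hcont : ContinuousAt g 0 := by
    have hv : ContinuousAt v (q + (0 : ℝ) • e) := by
      simpa using h1.self_of_nhds.continuousAt
    have hv' := ContinuousAt.comp (f := fun τ : ℝ => q + τ • e) hv (hline 0).continuousAt
    exact hv'.sub (by fun_prop)
  -- A positive second derivative of `g` at a critical point makes it a local minimum too. Then `g`
  -- is locally constant, and its second derivative is zero after all.
  by_contra! hlt
  have hpos : 0 < deriv (deriv g) 0 := by rw [hdd.deriv]; linarith
  have hmin := isLocalMin_of_deriv_deriv_pos hpos hmax.deriv_eq_zero hcont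
  have hconst : g =ᶠ[𝓝 0] fun _ => g 0 := by
    filter_upwards [hmin, hmax] with τ h1 h2 using le_antisymm h2 h1
  have : deriv g =ᶠ[𝓝 0] fun _ => 0 := by
    have := hconst.deriv
    simpa using this
  have h0 := this.deriv_eq
  rw [deriv_const] at h0
  exact hpos.ne' h0

theorem fderiv_fun_neg_eq {E : Type*} [NormedAddCommGroup E] [NormedSpace ℝ E] (v : E → ℝ) :
    fderiv ℝ (fun q => -v q) = fun q => -fderiv ℝ v q := by
  ext1 q; exact fderiv_fun_neg

theorem differentiableAt_fderiv_neg {E : Type*} [NormedAddCommGroup E] [NormedSpace ℝ E]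
    {v : E → ℝ} {q : E} (h : DifferentiableAt ℝ (fderiv ℝ v) q) :
    DifferentiableAt ℝ (fderiv ℝ fun q => -v q) q := by
  rw [fderiv_fun_neg_eq]; exact h.neg

theorem fderiv_fderiv_neg {E : Type*} [NormedAddCommGroup E] [NormedSpace ℝ E]
    (v : E → ℝ) (q : E) :
    fderiv ℝ (fderiv ℝ fun q => -v q) q = -fderiv ℝ (fderiv ℝ v) q := by
  rw [fderiv_fun_neg_eq]; exact fderiv_fun_neg

instance : FiniteDimensional ℝ (Quaternion ℝ) :=
  Quaternion.linearIsometryEquivTuple.symm.toLinearEquiv.finiteDimensional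

instance : ProperSpace (Quaternion ℝ) := FiniteDimensional.proper ℝ _

/-- The orthonormal basis `1, i, j, k` of the quaternions. -/
def quatBasis : OrthonormalBasis (Fin 4) ℝ (Quaternion ℝ) :=
  OrthonormalBasis.ofRepr Quaternion.linearIsometryEquivTuple

theorem quatBasis_apply (i : Fin 4) : quatBasis i = ![1, qi, qj, qk] i := by
  have h : quatBasis i = Quaternion.linearIsometryEquivTuple.symm (EuclideanSpace.single i 1) := by
    rw [← OrthonormalBasis.repr_symm_single]; rfl
  rw [h, Quaternion.linearIsometryEquivTuple_symm_apply]
  fin_cases i <;> ext <;> simp [qi, qj, qk] <;> rfl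

/-- The trace of a bilinear form over `1, i, j, k`. -/
def quatTrace (B : Quaternion ℝ →L[ℝ] Quaternion ℝ →L[ℝ] ℝ) : ℝ :=
  B 1 1 + (B qi qi + B qj qj + B qk qk)

theorem laplacian_eq_quatTrace (u : Quaternion ℝ → ℝ) (q : Quaternion ℝ) :
    (Laplacian.laplacian u) q = quatTrace (fderiv ℝ (fderiv ℝ u) q) := by
  rw [InnerProductSpace.laplacian_eq_iteratedFDeriv_orthonormalBasis u quatBasis]
  simp only [iteratedFDeriv_two_apply, Fin.sum_univ_four, quatBasis_apply]
  simp [quatTrace]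
  ring

theorem norm_gradient_sq (u : Quaternion ℝ → ℝ) (q : Quaternion ℝ) :
    ‖gradient u q‖ ^ 2 = fderiv ℝ u q 1 ^ 2 +
      (fderiv ℝ u q qi ^ 2 + fderiv ℝ u q qj ^ 2 + fderiv ℝ u q qk ^ 2) := by
  rw [← quatBasis.sum_sq_norm_inner_left (gradient u q)]
  simp only [gradient, InnerProductSpace.toDual_symm_apply, Fin.sum_univ_four, quatBasis_apply]
  simp
  ring

theorem isOpen_upperHalf : IsOpen upperHalf :=
  isOpen_lt continuous_const Quaternion.continuous_re

/-- Twice differentiable on the half-space with vanishing Laplacian. -/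
structure TwiceDiffHarmonic (v : Quaternion ℝ → ℝ) : Prop where
  diff : ∀ q ∈ upperHalf, DifferentiableAt ℝ v q
  diff2 : ∀ q ∈ upperHalf, DifferentiableAt ℝ (fderiv ℝ v) q
  trace : ∀ q ∈ upperHalf, quatTrace (fderiv ℝ (fderiv ℝ v) q) = 0

theorem TwiceDiffHarmonic.neg {v : Quaternion ℝ → ℝ} (hv : TwiceDiffHarmonic v) :
    TwiceDiffHarmonic (fun q => -v q) := by
  refine ⟨fun q hq => (hv.diff q hq).neg, fun q hq => differentiableAt_fderiv_neg (hv.diff2 q hq),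
    fun q hq => ?_⟩
  have h := hv.trace q hq
  have e := fderiv_fderiv_neg v q
  have e' : ∀ a b, fderiv ℝ (fderiv ℝ fun q => -v q) q a b = -fderiv ℝ (fderiv ℝ v) q a b :=
    fun a b => by
      have := congrArg (fun T : Quaternion ℝ →L[ℝ] Quaternion ℝ →L[ℝ] ℝ => T a b) e
      exact this
  simp only [quatTrace, e'] at h ⊢
  linarith

theorem norm_add_smul_sq (q e : Quaternion ℝ) (he : ‖e‖ = 1) (τ : ℝ) :
    ‖q + τ • e‖ ^ 2 = ‖q‖ ^ 2 + 2 * ⟪q, e⟫ * τ + τ ^ 2 := by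
  rw [norm_add_sq_real, norm_smul, he, inner_smul_right]
  simp; ring

theorem norm_quatUnits : ‖(1 : Quaternion ℝ)‖ = 1 ∧ ‖qi‖ = 1 ∧ ‖qj‖ = 1 ∧ ‖qk‖ = 1 := by
  have h := fun i => quatBasis.norm_eq_one i
  simp only [quatBasis_apply] at h
  exact ⟨by simp, by simpa using h 1, by simpa using h 2, by simpa using h 3⟩

theorem re_sq_le_norm_sq (q : Quaternion ℝ) : q.re ^ 2 ≤ ‖q‖ ^ 2 := by
  rw [sq ‖q‖, ← Quaternion.normSq_eq_norm_mul_self, Quaternion.normSq_def']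
  nlinarith [sq_nonneg q.imI, sq_nonneg q.imJ, sq_nonneg q.imK]

/-- Phragmén-Lindelöf maximum principle for bounded harmonic functions on the half-space. -/
theorem TwiceDiffHarmonic.nonpos {v : Quaternion ℝ → ℝ} (hv : TwiceDiffHarmonic v) {M : ℝ}
    (hM : ∀ q ∈ upperHalf, v q ≤ M)
    (hb : ∀ ε > 0, ∃ δ > 0, ∀ q : Quaternion ℝ, 0 < q.re → q.re < δ → v q ≤ ε)
    {q₀ : Quaternion ℝ} (hq₀ : q₀ ∈ upperHalf) : v q₀ ≤ 0 := by
  by_contra! hpos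
  have hy : 0 < q₀.re := hq₀
  have hM0 : 0 < M := hpos.trans_le (hM q₀ hq₀)
  -- Each of the three terms of the barrier `B` below will be at most `ε` at `q₀`, so `B q₀ ≤ 3ε < v
  -- q₀`.
  set ε := v q₀ / 4 with hε
  have hε0 : 0 < ε := by positivity
  obtain ⟨δ, hδ, hbδ⟩ := hb ε hε0
  set κ := ε / q₀.re with hκ
  have hκ0 : 0 < κ := by positivity
  have hκy : κ * q₀.re = ε := by rw [hκ]; field_simp
  set d := min (δ / 2) (q₀.re / 2) with hd
  have hd0 : 0 < d := by positivity
  have hdδ : d < δ := (min_le_left _ _).trans_lt (by linarith)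
  have hdy : d < q₀.re := (min_le_right _ _).trans_lt (by linarith)
  -- The height of the box: on its top face the linear term `κ · Re q` alone is `M + ε`.
  set L := M / κ + q₀.re with hL
  have hκL : M < κ * L := by
    have : κ * L = M + ε := by rw [hL, mul_add, hκy]; field_simp
    linarith
  have hyL : q₀.re < L := by
    have : 0 < M / κ := by positivity
    linarith
  set η := ε / (‖q₀‖ ^ 2 + 4 * L ^ 2) with hη
  have hL0 : 0 < L := hy.trans hyL
  have hη0 : 0 < η := by positivity
  have hηq : η * (‖q₀‖ ^ 2 + 4 * L ^ 2) = ε := by rw [hη]; field_simp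
  -- The radius is such that on `|q| = R`, `Re q ≤ L`, the quadratic term of the barrier, at least
  -- `η (R² - L²)`, exceeds `M`.
  set R := √(L ^ 2 + M / η + ‖q₀‖ ^ 2 + 1) with hR
  have hR2 : R ^ 2 = L ^ 2 + M / η + ‖q₀‖ ^ 2 + 1 := Real.sq_sqrt (by positivity)
  have hR0 : 0 ≤ R := Real.sqrt_nonneg _
  have hηR : M < η * (R ^ 2 - L ^ 2) := by
    have : η * (R ^ 2 - L ^ 2) = M + η * (‖q₀‖ ^ 2 + 1) := by rw [hR2]; field_simp; ring
    have : 0 < η * (‖q₀‖ ^ 2 + 1) := by positivity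
    linarith
  have hqR : ‖q₀‖ < R := by
    refine lt_of_pow_lt_pow_left₀ 2 hR0 ?_
    have : 0 < M / η := by positivity
    nlinarith
  -- The quadratic part is `η(|x|² - 4y² + 4L²)`: nonnegative for `0 ≤ y ≤ L`, large for large
  -- `|x|`, and with Laplacian `η(6 - 8) = -2η < 0`. Strict superharmonicity forbids an interior
  -- maximum of `v - B`.
  set B : Quaternion ℝ → ℝ := fun q =>
    ε + κ * q.re + η * (‖q‖ ^ 2 - 5 * q.re ^ 2 + 4 * L ^ 2) with hB
  set S : Set (Quaternion ℝ) := {q | d ≤ q.re ∧ q.re ≤ L ∧ ‖q‖ ≤ R} with hS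
  have hre := Quaternion.continuous_re
  have hSc : IsCompact S := by
    refine Metric.isCompact_of_isClosed_isBounded ?_ ?_
    · exact (isClosed_le continuous_const hre).inter
        ((isClosed_le hre continuous_const).inter (isClosed_le continuous_norm continuous_const))
    · exact (Metric.isBounded_closedBall (x := (0 : Quaternion ℝ)) (r := R)).subset
        fun q hq => mem_closedBall_zero_iff.mpr hq.2.2
  have hSU : S ⊆ upperHalf := fun q hq => hd0.trans_le hq.1
  have hq₀S : q₀ ∈ S := ⟨hdy.le, hyL.le, hqR.le⟩
  have hBc : Continuous B := by
    simp only [hB]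
    fun_prop
  have hvc : ContinuousOn (fun q => v q - B q) S :=
    ContinuousOn.sub (fun q hq => (hv.diff q (hSU hq)).continuousAt.continuousWithinAt)
      hBc.continuousOn
  obtain ⟨p, hpS, hpmax⟩ := hSc.exists_isMaxOn ⟨q₀, hq₀S⟩ hvc
  have hp0 : 0 < v p - B p := by
    refine lt_of_lt_of_le ?_ (hpmax hq₀S)
    have h1 : B q₀ ≤ 3 * ε := by
      simp only [hB]
      rw [hκy]
      have : η * (‖q₀‖ ^ 2 - 5 * q₀.re ^ 2 + 4 * L ^ 2) ≤ ε := by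
        rw [← hηq]
        gcongr
        nlinarith
      linarith
    show 0 < v q₀ - B q₀
    linarith
  have hpU := hSU hpS
  have hpre : 0 < p.re := hpU
  have hquad : 0 ≤ ‖p‖ ^ 2 - 5 * p.re ^ 2 + 4 * L ^ 2 := by
    nlinarith [re_sq_le_norm_sq p, hpS.2.1]
  have hB0 : 0 ≤ η * (‖p‖ ^ 2 - 5 * p.re ^ 2 + 4 * L ^ 2) := by positivity
  have hBp : B p = ε + κ * p.re + η * (‖p‖ ^ 2 - 5 * p.re ^ 2 + 4 * L ^ 2) := rfl
  -- A positive maximum of `v - B` cannot lie on the boundary of the box: `v ≤ ε` on the bottom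
  -- face, while `B > M` on the other faces.
  have hc1 : d < p.re := by
    refine lt_of_le_of_ne hpS.1 fun h => ?_
    have := hbδ p hpre (by rw [← h]; exact hdδ)
    have : 0 < κ * p.re := by positivity
    linarith
  have hc2 : p.re < L := by
    refine lt_of_le_of_ne hpS.2.1 fun h => ?_
    have := hM p hpU
    rw [h] at hBp hB0
    linarith
  have hc3 : ‖p‖ < R := by
    refine lt_of_le_of_ne hpS.2.2 fun h => ?_
    have := hM p hpU
    have h3 : 0 < κ * p.re := by positivity
    have h4 : η * (R ^ 2 - L ^ 2) ≤ η * (‖p‖ ^ 2 - 5 * p.re ^ 2 + 4 * L ^ 2) := by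
      rw [h]
      gcongr ?_ * ?_
      nlinarith
    linarith
  have hSn : S ∈ 𝓝 p := by
    have ho : IsOpen {q : Quaternion ℝ | d < q.re ∧ q.re < L ∧ ‖q‖ < R} :=
      (isOpen_lt continuous_const hre).inter
        ((isOpen_lt hre continuous_const).inter (isOpen_lt continuous_norm continuous_const))
    exact mem_of_superset (ho.mem_nhds ⟨hc1, hc2, hc3⟩)
      fun q hq => ⟨hq.1.le, hq.2.1.le, hq.2.2.le⟩
  have hloc : ∀ e : Quaternion ℝ, IsLocalMax (fun τ : ℝ => v (p + τ • e) - B (p + τ • e)) 0 := by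
    intro e
    have hcont : ContinuousAt (fun τ : ℝ => p + τ • e) 0 := by fun_prop
    have h := hcont.tendsto
    simp only [zero_smul, add_zero] at h
    filter_upwards [h hSn] with τ hτ
    simpa using hpmax hτ
  have hev : ∀ᶠ q in 𝓝 p, DifferentiableAt ℝ v q := by
    filter_upwards [isOpen_upperHalf.mem_nhds hpU] with q hq using hv.diff q hq
  have hunits := norm_quatUnits
  have hone : fderiv ℝ (fderiv ℝ v) p 1 1 ≤ 2 * (-4 * η) := by
    refine fderiv_fderiv_le_of_isLocalMax (a := B p)
      (b := κ + η * (2 * ⟪p, 1⟫ - 10 * p.re)) hev (hv.diff2 p hpU) ?_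
    convert! hloc 1 using 3 with τ
    simp only [hB]
    rw [norm_add_smul_sq p 1 hunits.1]
    have h1 : (p + τ • (1 : Quaternion ℝ)).re = p.re + τ := by
      rw [Quaternion.re_add, Quaternion.re_smul, Quaternion.re_one, smul_eq_mul, mul_one]
    rw [h1]
    ring
  have hoth : ∀ e : Quaternion ℝ, ‖e‖ = 1 → e.re = 0 →
      fderiv ℝ (fderiv ℝ v) p e e ≤ 2 * η := by
    intro e he he0
    refine fderiv_fderiv_le_of_isLocalMax (a := B p)
      (b := η * (2 * ⟪p, e⟫)) hev (hv.diff2 p hpU) ?_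
    convert! hloc e using 3 with τ
    simp only [hB]
    rw [norm_add_smul_sq p e he]
    simp [he0]
    ring
  have ht := hv.trace p hpU
  rw [quatTrace] at ht
  have h1 := hoth qi hunits.2.1 rfl
  have h2 := hoth qj hunits.2.2.1 rfl
  have h3 := hoth qk hunits.2.2.2 rfl
  linarith

theorem TwiceDiffHarmonic.eq_zero {v : Quaternion ℝ → ℝ} (hv : TwiceDiffHarmonic v) {M : ℝ}
    (hM : ∀ q ∈ upperHalf, |v q| ≤ M)
    (hb : ∀ ε > 0, ∃ δ > 0, ∀ q : Quaternion ℝ, 0 < q.re → q.re < δ → |v q| ≤ ε)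
    {q : Quaternion ℝ} (hq : q ∈ upperHalf) : v q = 0 := by
  refine le_antisymm (hv.nonpos (fun q hq => (abs_le.mp (hM q hq)).2) ?_ hq) ?_
  · intro ε hε
    obtain ⟨δ, hδ, h⟩ := hb ε hε
    exact ⟨δ, hδ, fun q h1 h2 => (abs_le.mp (h q h1 h2)).2⟩
  · have h := hv.neg.nonpos (M := M) (fun q hq => ?_) ?_ hq
    · linarith
    · linarith [(abs_le.mp (hM q hq)).1]
    · intro ε hε
      obtain ⟨δ, hδ, h⟩ := hb ε hε
      exact ⟨δ, hδ, fun q h1 h2 => by linarith [(abs_le.mp (h q h1 h2)).1]⟩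

end Harmonic

/-! ### Differentiation of potentials and bounds for homogeneous kernels. -/

section Potential

set_option linter.unusedSectionVars false

variable {E V : Type*} [NormedAddCommGroup E] [NormedSpace ℝ E] [NormedAddCommGroup V]
  [NormedSpace ℝ V]

/-- The superposition `∫ f(t) k(q - s(t)) dt` of translates of a kernel. -/
def potential (f : E3 → ℝ) (s : E3 → E) (k : E → V) (q : E) : V := ∫ t, f t • k (q - s t)

/-- The integrand of the potential is dominated by an integrable function locally uniformly. -/
def LocallyDominated (f : E3 → ℝ) (s : E3 → E) (U : Set E) (k : E → V) : Prop :=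
  ∀ q₀ ∈ U, ∃ r > 0, ∃ b : E3 → ℝ, Integrable b volume ∧
    ∀ q ∈ Metric.ball q₀ r ∩ U, ∀ t, ‖f t • k (q - s t)‖ ≤ b t

variable {f : E3 → ℝ} {s : E3 → E} {U : Set E} {k : E → V}

theorem aestronglyMeasurable_potential (hf : AEStronglyMeasurable f volume) (hs : Continuous s)
    (hsU : ∀ q ∈ U, ∀ t, q - s t ∈ U) (hk : ContinuousOn k U) {q : E} (hq : q ∈ U) :
    AEStronglyMeasurable (fun t => f t • k (q - s t)) volume :=
  hf.smul (hk.comp_continuous (by fun_prop) fun t => hsU q hq t).aestronglyMeasurable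

theorem integrable_potential (hf : AEStronglyMeasurable f volume) (hs : Continuous s)
    (hsU : ∀ q ∈ U, ∀ t, q - s t ∈ U) (hk : ContinuousOn k U) (hd : LocallyDominated f s U k)
    {q : E} (hq : q ∈ U) : Integrable (fun t => f t • k (q - s t)) volume := by
  obtain ⟨r, hr, b, hb, hle⟩ := hd q hq
  exact hb.mono' (aestronglyMeasurable_potential hf hs hsU hk hq)
    (Eventually.of_forall fun t => hle q ⟨Metric.mem_ball_self hr, hq⟩ t)

theorem continuousOn_potential (hU : IsOpen U) (hf : AEStronglyMeasurable f volume)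
    (hs : Continuous s) (hsU : ∀ q ∈ U, ∀ t, q - s t ∈ U) (hk : ContinuousOn k U)
    (hd : LocallyDominated f s U k) : ContinuousOn (potential f s k) U := by
  intro q hq
  obtain ⟨r, hr, b, hb, hle⟩ := hd q hq
  have hn : Metric.ball q r ∩ U ∈ 𝓝 q :=
    inter_mem (Metric.ball_mem_nhds q hr) (hU.mem_nhds hq)
  refine ContinuousAt.continuousWithinAt ?_
  refine continuousAt_of_dominated (bound := b) ?_ ?_ hb ?_
  · filter_upwards [hn] with p hp using aestronglyMeasurable_potential hf hs hsU hk hp.2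
  · filter_upwards [hn] with p hp using Eventually.of_forall fun t => hle p hp t
  · refine Eventually.of_forall fun t => ContinuousAt.const_smul ?_ (f t)
    have h1 : ContinuousAt k (q - s t) := hk.continuousAt (hU.mem_nhds (hsU q hq t))
    exact ContinuousAt.comp (f := fun q => q - s t) h1 (by fun_prop)

/-- Differentiation under the integral. The derivative is again a potential, with the differentiated
kernel, so the result iterates to second derivatives. -/
theorem hasFDerivAt_potential (hU : IsOpen U) (hf : AEStronglyMeasurable f volume)
    (hs : Continuous s) (hsU : ∀ q ∈ U, ∀ t, q - s t ∈ U) (hk : ContDiffOn ℝ 1 k U)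
    (hd : LocallyDominated f s U k) (hd' : LocallyDominated f s U (fderiv ℝ k))
    {q : E} (hq : q ∈ U) :
    HasFDerivAt (potential f s k) (potential f s (fderiv ℝ k) q) q := by
  obtain ⟨r, hr, b, hb, hle⟩ := hd' q hq
  have hn : Metric.ball q r ∩ U ∈ 𝓝 q :=
    inter_mem (Metric.ball_mem_nhds q hr) (hU.mem_nhds hq)
  have hk' : ContinuousOn (fderiv ℝ k) U := hk.continuousOn_fderiv_of_isOpen hU le_rfl
  refine hasFDerivAt_integral_of_dominated_of_fderiv_le (bound := b)
    (F := fun q t => f t • k (q - s t)) (F' := fun q t => f t • fderiv ℝ k (q - s t)) hn ?_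
    (integrable_potential hf hs hsU hk.continuousOn hd hq)
    (aestronglyMeasurable_potential hf hs hsU hk' hq) ?_ hb ?_
  · filter_upwards [hn] with p hp using
      aestronglyMeasurable_potential hf hs hsU hk.continuousOn hp.2
  · exact Eventually.of_forall fun t p hp => hle p hp t
  · refine Eventually.of_forall fun t p hp => ?_
    have h1 : HasFDerivAt k (fderiv ℝ k (p - s t)) (p - s t) :=
      ((hk.differentiableOn (by norm_num)).differentiableAt
        (hU.mem_nhds (hsU p hp.2 t))).hasFDerivAt
    have h2 : HasFDerivAt (fun q => q - s t) (ContinuousLinearMap.id ℝ E) p :=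
      (hasFDerivAt_id p).sub_const (s t)
    have h3 := (h1.comp p h2).const_smul (f t)
    rw [ContinuousLinearMap.comp_id] at h3
    exact h3

theorem fderiv_potential_eventuallyEq (hU : IsOpen U) (hf : AEStronglyMeasurable f volume)
    (hs : Continuous s) (hsU : ∀ q ∈ U, ∀ t, q - s t ∈ U) (hk : ContDiffOn ℝ 1 k U)
    (hd : LocallyDominated f s U k) (hd' : LocallyDominated f s U (fderiv ℝ k))
    {q : E} (hq : q ∈ U) :
    fderiv ℝ (potential f s k) =ᶠ[𝓝 q] potential f s (fderiv ℝ k) := by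
  filter_upwards [hU.mem_nhds hq] with p hp
  exact (hasFDerivAt_potential hU hf hs hsU hk hd hd' hp).fderiv

theorem contDiffOn_one_potential (hU : IsOpen U) (hf : AEStronglyMeasurable f volume)
    (hs : Continuous s) (hsU : ∀ q ∈ U, ∀ t, q - s t ∈ U) (hk : ContDiffOn ℝ 1 k U)
    (hd : LocallyDominated f s U k) (hd' : LocallyDominated f s U (fderiv ℝ k)) :
    ContDiffOn ℝ 1 (potential f s k) U := by
  have h1 := fun q (hq : q ∈ U) => hasFDerivAt_potential hU hf hs hsU hk hd hd' hq
  rw [show (1 : WithTop ℕ∞) = 0 + 1 from (zero_add 1).symm, contDiffOn_succ_iff_fderiv_of_isOpen hU]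
  refine ⟨fun q hq => (h1 q hq).differentiableAt.differentiableWithinAt, by simp, ?_⟩
  rw [contDiffOn_zero]
  exact (continuousOn_potential hU hf hs hsU (hk.continuousOn_fderiv_of_isOpen hU le_rfl)
    hd').congr fun q hq => (h1 q hq).fderiv

theorem contDiffOn_two_potential (hU : IsOpen U) (hf : AEStronglyMeasurable f volume)
    (hs : Continuous s) (hsU : ∀ q ∈ U, ∀ t, q - s t ∈ U) (hk : ContDiffOn ℝ 2 k U)
    (hd : LocallyDominated f s U k) (hd' : LocallyDominated f s U (fderiv ℝ k))
    (hd'' : LocallyDominated f s U (fderiv ℝ (fderiv ℝ k))) :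
    ContDiffOn ℝ 2 (potential f s k) U := by
  have hk1 : ContDiffOn ℝ 1 k U := hk.of_le (by norm_num)
  have hk2 : ContDiffOn ℝ 1 (fderiv ℝ k) U := hk.fderiv_of_isOpen hU (by norm_num)
  have h1 := fun q (hq : q ∈ U) => hasFDerivAt_potential hU hf hs hsU hk1 hd hd' hq
  rw [show (2 : WithTop ℕ∞) = 1 + 1 by norm_num, contDiffOn_succ_iff_fderiv_of_isOpen hU]
  refine ⟨fun q hq => (h1 q hq).differentiableAt.differentiableWithinAt, by simp, ?_⟩
  exact (contDiffOn_one_potential hU hf hs hsU hk2 hd' hd'').congr fun q hq => (h1 q hq).fderiv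

theorem hasFDerivAt_fderiv_potential (hU : IsOpen U) (hf : AEStronglyMeasurable f volume)
    (hs : Continuous s) (hsU : ∀ q ∈ U, ∀ t, q - s t ∈ U) (hk : ContDiffOn ℝ 2 k U)
    (hd : LocallyDominated f s U k) (hd' : LocallyDominated f s U (fderiv ℝ k))
    (hd'' : LocallyDominated f s U (fderiv ℝ (fderiv ℝ k))) {q : E} (hq : q ∈ U) :
    HasFDerivAt (fderiv ℝ (potential f s k)) (potential f s (fderiv ℝ (fderiv ℝ k)) q) q := by
  have hk1 : ContDiffOn ℝ 1 k U := hk.of_le (by norm_num)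
  have hk2 : ContDiffOn ℝ 1 (fderiv ℝ k) U := hk.fderiv_of_isOpen hU (by norm_num)
  exact (hasFDerivAt_potential hU hf hs hsU hk2 hd' hd'' hq).congr_of_eventuallyEq
    (fderiv_potential_eventuallyEq hU hf hs hsU hk1 hd hd' hq)

/-- For `q` in a small closed ball and `t` in the support of `f`, the points `q - s t` fill a
compact subset of `U`, on which the kernel is bounded. -/
theorem locallyDominated_of_hasCompactSupport [ProperSpace E] (hU : IsOpen U) (hs : Continuous s)
    (hsU : ∀ q ∈ U, ∀ t, q - s t ∈ U) (hk : ContinuousOn k U) (hf : Continuous f)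
    (hc : HasCompactSupport f) : LocallyDominated f s U k := by
  intro q₀ hq₀
  obtain ⟨r, hr, hrU⟩ := Metric.nhds_basis_closedBall.mem_iff.mp (hU.mem_nhds hq₀)
  have hK : IsCompact ((fun p : E × E3 => p.1 - s p.2) ''
      (Metric.closedBall q₀ r ×ˢ tsupport f)) :=
    ((isCompact_closedBall q₀ r).prod hc).image (by fun_prop)
  have hKU : ((fun p : E × E3 => p.1 - s p.2) '' (Metric.closedBall q₀ r ×ˢ tsupport f)) ⊆ U := by
    rintro _ ⟨p, hp, rfl⟩
    exact hsU _ (hrU hp.1) _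
  obtain ⟨C, hC⟩ := hK.exists_bound_of_continuousOn (hk.mono hKU)
  refine ⟨r, hr, fun t => ‖f t‖ * C, ((hf.integrable_of_hasCompactSupport hc).norm).mul_const C, ?_⟩
  intro q hq t
  rw [norm_smul]
  by_cases ht : t ∈ tsupport f
  · exact mul_le_mul_of_nonneg_left
      (hC _ ⟨(q, t), ⟨Metric.ball_subset_closedBall hq.1, ht⟩, rfl⟩) (norm_nonneg _)
  · simp [image_eq_zero_of_notMem_tsupport ht]

/-- A kernel smooth away from the origin and homogeneous of degree `-m`. -/
structure IsHomKernel (m : ℕ) (k : E → V) : Prop where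
  smooth : ContDiffOn ℝ ((⊤ : ℕ∞) : WithTop ℕ∞) k {0}ᶜ
  hom : ∀ c : ℝ, 0 < c → ∀ q : E, q ≠ 0 → k (c • q) = (c⁻¹) ^ m • k q

/-- Differentiate `p ↦ k (c • p)` by the chain rule and through homogeneity; uniqueness of the
derivative gives one more factor `c⁻¹`. -/
theorem IsHomKernel.fderiv {m : ℕ} (hk : IsHomKernel m k) :
    IsHomKernel (m + 1) (fderiv ℝ k) := by
  refine ⟨hk.smooth.fderiv_of_isOpen isOpen_compl_singleton (by simp), fun c hc q hq => ?_⟩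
  have hcq : c • q ≠ 0 := smul_ne_zero hc.ne' hq
  have hd : ∀ p : E, p ≠ 0 → DifferentiableAt ℝ k p := fun p hp =>
    (hk.smooth.differentiableOn (by simp)).differentiableAt (isOpen_compl_singleton.mem_nhds hp)
  have h1 : HasFDerivAt (fun p => k (c • p)) (c • _root_.fderiv ℝ k (c • q)) q := by
    have h2 : HasFDerivAt (fun p : E => c • p) (c • ContinuousLinearMap.id ℝ E) q :=
      (hasFDerivAt_id q).const_smul c
    have h3 := (hd _ hcq).hasFDerivAt.comp q h2
    refine h3.congr_fderiv ?_
    ext v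
    simp
  have h2 : HasFDerivAt (fun p => k (c • p)) ((c⁻¹) ^ m • _root_.fderiv ℝ k q) q := by
    refine ((hd q hq).hasFDerivAt.const_smul ((c⁻¹) ^ m)).congr_of_eventuallyEq ?_
    filter_upwards [isOpen_compl_singleton.mem_nhds hq] with p hp using hk.hom c hc p hp
  have h3 := h1.unique h2
  rw [pow_succ', mul_smul, ← h3, inv_smul_smul₀ hc.ne']

/-- Homogeneity reduces the bound to the unit sphere, which is compact. -/
theorem IsHomKernel.exists_bound [ProperSpace E] {m : ℕ} (hk : IsHomKernel m k) :
    ∃ C, 0 ≤ C ∧ ∀ q : E, q ≠ 0 → ‖k q‖ ≤ C * (‖q‖⁻¹) ^ m := by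
  obtain ⟨C, hC⟩ := (isCompact_sphere (0 : E) 1).exists_bound_of_continuousOn
    (hk.smooth.continuousOn.mono fun q hq => by
      rw [mem_sphere_zero_iff_norm] at hq
      exact norm_ne_zero_iff.mp (by rw [hq]; norm_num))
  refine ⟨max C 0, le_max_right _ _, fun q hq => ?_⟩
  have hn : 0 < ‖q‖ := norm_pos_iff.mpr hq
  have h1 : ‖q‖⁻¹ • q ∈ Metric.sphere (0 : E) 1 := by
    rw [mem_sphere_zero_iff_norm, norm_smul, norm_inv, norm_norm, inv_mul_cancel₀ hn.ne']
  have h2 := hk.hom ‖q‖ hn (‖q‖⁻¹ • q) (smul_ne_zero (inv_ne_zero hn.ne') hq)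
  rw [smul_inv_smul₀ hn.ne'] at h2
  rw [h2, norm_smul, norm_pow, norm_inv, norm_norm, mul_comm]
  gcongr
  exact (hC _ h1).trans (le_max_left _ _)

end Potential

/-! ### First and second derivatives of `σ(q)/|q|⁴`. -/

section RieszKernel

open scoped RealInnerProductSpace

variable {E V : Type*} [NormedAddCommGroup E] [InnerProductSpace ℝ E] [NormedAddCommGroup V]
  [NormedSpace ℝ V]

/-- The kernel `σ(q) / |q|⁴` for a linear map `σ`. -/
def quarticKernel (σ : E →L[ℝ] V) (q : E) : V := (‖q‖ ^ 4)⁻¹ • σ q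

theorem isHomKernel_quarticKernel (σ : E →L[ℝ] V) : IsHomKernel 3 (quarticKernel σ) := by
  constructor
  · refine ContDiffOn.smul (ContDiffOn.inv ?_ fun q hq => ?_) σ.contDiff.contDiffOn
    · have : ContDiff ℝ ((⊤ : ℕ∞) : WithTop ℕ∞) fun q : E => ‖q‖ ^ 4 := by
        have h : (fun q : E => ‖q‖ ^ 4) = fun q : E => (‖q‖ ^ 2) ^ 2 := by ext q; ring
        rw [h]
        exact (contDiff_norm_sq ℝ).pow 2
      exact this.contDiffOn
    · exact pow_ne_zero 4 (norm_ne_zero_iff.mpr hq)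
  · intro c hc q hq
    simp only [quarticKernel, norm_smul, Real.norm_of_nonneg hc.le, map_smul, smul_smul]
    congr 1
    have : ‖q‖ ≠ 0 := norm_ne_zero_iff.mpr hq
    field_simp

theorem fderiv_quarticKernel_apply (σ : E →L[ℝ] V) {q : E} (hq : q ≠ 0) (h : E) :
    fderiv ℝ (quarticKernel σ) q h =
      (‖q‖ ^ 4)⁻¹ • σ h - (4 * ⟪q, h⟫ * (‖q‖ ^ 6)⁻¹) • σ q := by
  have hn : ‖q‖ ≠ 0 := norm_ne_zero_iff.mpr hq
  have h1 : HasFDerivAt (fun q : E => ‖q‖ ^ 2) (2 • innerSL ℝ q) q :=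
    (hasStrictFDerivAt_norm_sq q).hasFDerivAt
  have h2 : HasDerivAt (fun x : ℝ => (x ^ 2)⁻¹) (-(2 * ‖q‖ ^ 2) / ((‖q‖ ^ 2) ^ 2) ^ 2)
      (‖q‖ ^ 2) := by
    have := (hasDerivAt_pow 2 (‖q‖ ^ 2)).inv (by positivity)
    refine this.congr_deriv ?_
    simp
  have h3 := h2.comp_hasFDerivAt q h1
  have h4 := h3.smul (σ.hasFDerivAt (x := q))
  have e : quarticKernel σ = fun q => ((fun x : ℝ => (x ^ 2)⁻¹) ∘ fun q : E => ‖q‖ ^ 2) q • σ q := by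
    ext q
    simp only [quarticKernel, Function.comp_apply]
    rw [← pow_mul]
  rw [e]
  erw [h4.fderiv]
  simp only [Function.comp_apply, add_apply, smul_apply,
    ContinuousLinearMap.smulRight_apply, innerSL_apply_apply]
  rw [← pow_mul, sub_eq_add_neg, ← neg_smul]
  congr 2
  simp
  field_simp
  norm_num
  ring

theorem fderiv_fderiv_quarticKernel_apply (σ : E →L[ℝ] ℝ) {q : E} (hq : q ≠ 0) (e : E) :
    fderiv ℝ (fderiv ℝ (quarticKernel σ)) q e e =
      -(8 * ⟪q, e⟫ * σ e * (‖q‖ ^ 6)⁻¹) - 4 * ‖e‖ ^ 2 * σ q * (‖q‖ ^ 6)⁻¹ +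
        24 * ⟪q, e⟫ ^ 2 * σ q * (‖q‖ ^ 8)⁻¹ := by
  have hn : ‖q‖ ≠ 0 := norm_ne_zero_iff.mpr hq
  have hline : HasDerivAt (fun τ : ℝ => q + τ • e) e 0 := by
    simpa using ((hasDerivAt_id (0 : ℝ)).smul_const e).const_add q
  have hs := (isHomKernel_quarticKernel σ).fderiv.smooth
  have hd : HasFDerivAt (fderiv ℝ (quarticKernel σ)) (fderiv ℝ (fderiv ℝ (quarticKernel σ)) q)
      (q + (0 : ℝ) • e) := by
    rw [zero_smul, add_zero]
    exact ((hs.differentiableOn (by simp)).differentiableAt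
      (isOpen_compl_singleton.mem_nhds hq)).hasFDerivAt
  have h0 : HasFDerivAt (fun p => fderiv ℝ (quarticKernel σ) p e)
      ((fderiv ℝ (fderiv ℝ (quarticKernel σ)) q).flip e) (q + (0 : ℝ) • e) :=
    (ContinuousLinearMap.apply ℝ ℝ e).hasFDerivAt.comp _ hd
  have h1 : HasDerivAt (fun τ : ℝ => fderiv ℝ (quarticKernel σ) (q + τ • e) e)
      (fderiv ℝ (fderiv ℝ (quarticKernel σ)) q e e) 0 := by
    have := HasFDerivAt.comp_hasDerivAt (0 : ℝ) h0 hline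
    exact this
  -- Along the line `q + τ e` the squared norm is this polynomial, so the first-derivative formula
  -- becomes a rational function of `τ`. Only pure second derivatives are needed, as they determine
  -- the Laplacian.
  set N : ℝ → ℝ := fun τ => ‖q‖ ^ 2 + 2 * ⟪q, e⟫ * τ + ‖e‖ ^ 2 * τ ^ 2 with hN
  have hNn : ∀ τ : ℝ, ‖q + τ • e‖ ^ 2 = N τ := by
    intro τ
    rw [norm_add_sq_real, norm_smul, inner_smul_right, mul_pow, Real.norm_eq_abs, sq_abs]
    simp only [hN]; ring
  have hNd : HasDerivAt N (2 * ⟪q, e⟫) 0 := by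
    have := (((hasDerivAt_id (0 : ℝ)).const_mul (2 * ⟪q, e⟫)).const_add (‖q‖ ^ 2)).add
      ((hasDerivAt_pow 2 (0 : ℝ)).const_mul (‖e‖ ^ 2))
    refine this.congr_deriv ?_
    simp
  have hN0 : N 0 = ‖q‖ ^ 2 := by simp [hN]
  have hev : (fun τ : ℝ => fderiv ℝ (quarticKernel σ) (q + τ • e) e) =ᶠ[𝓝 0] fun τ =>
      (N τ ^ 2)⁻¹ * σ e -
        (4 * (⟪q, e⟫ + τ * ‖e‖ ^ 2) * (N τ ^ 3)⁻¹) * (σ q + τ * σ e) := by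
    have hc : ContinuousAt (fun τ : ℝ => q + τ • e) 0 := hline.continuousAt
    have : ∀ᶠ τ in 𝓝 (0 : ℝ), q + τ • e ≠ 0 := hc.eventually_ne (by simpa using hq)
    filter_upwards [this] with τ hτ
    rw [fderiv_quarticKernel_apply σ hτ, ← hNn, ← pow_mul, ← pow_mul, inner_add_left,
      inner_smul_left, real_inner_self_eq_norm_sq]
    simp
  have hl1 : HasDerivAt (fun τ : ℝ => ⟪q, e⟫ + τ * ‖e‖ ^ 2) (‖e‖ ^ 2) 0 := by
    simpa using ((hasDerivAt_id (0 : ℝ)).mul_const (‖e‖ ^ 2)).const_add ⟪q, e⟫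
  have hl2 : HasDerivAt (fun τ : ℝ => σ q + τ * σ e) (σ e) 0 := by
    simpa using ((hasDerivAt_id (0 : ℝ)).mul_const (σ e)).const_add (σ q)
  have hi2 := (hNd.pow 2).inv (by simp only [Pi.pow_apply]; rw [hN0]; positivity)
  have hi3 := (hNd.pow 3).inv (by simp only [Pi.pow_apply]; rw [hN0]; positivity)
  have h2 := ((hi2.mul_const (σ e)).sub (((hl1.const_mul 4).mul hi3).mul hl2))
  have h3 := h1.unique (HasDerivAt.congr_of_eventuallyEq h2 hev)
  rw [h3]
  simp only [Pi.pow_apply, Pi.inv_apply, Pi.mul_apply, hN0]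
  simp
  field_simp
  ring

end RieszKernel

/-! ### The Cauchy integral as a potential on the half-space. -/

section CanonicalExtension

open scoped RealInnerProductSpace

@[simp] theorem re_pt (x : E3) (y : ℝ) : (pt x y).re = y := rfl
@[simp] theorem imI_pt (x : E3) (y : ℝ) : (pt x y).imI = x 0 := rfl
@[simp] theorem imJ_pt (x : E3) (y : ℝ) : (pt x y).imJ = x 1 := rfl
@[simp] theorem imK_pt (x : E3) (y : ℝ) : (pt x y).imK = x 2 := rfl

/-- The linear isomorphism `(x, y) ↦ y + x₁ i + x₂ j + x₃ k` as a continuous linear map. -/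
def ptL : E3 × ℝ →L[ℝ] Quaternion ℝ :=
  LinearMap.toContinuousLinearMap
    { toFun := fun p => pt p.1 p.2
      map_add' := fun p p' => by ext <;> simp
      map_smul' := fun c p => by ext <;> simp }

theorem ptL_apply (p : E3 × ℝ) : ptL p = pt p.1 p.2 := rfl

theorem continuous_pt : Continuous fun p : E3 × ℝ => pt p.1 p.2 := ptL.continuous

theorem continuous_pt_zero : Continuous fun t : E3 => pt t 0 :=
  continuous_pt.comp (by fun_prop : Continuous fun t : E3 => (t, (0 : ℝ)))

theorem norm_pt_sq (x : E3) (y : ℝ) : ‖pt x y‖ ^ 2 = ‖x‖ ^ 2 + y ^ 2 := by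
  rw [sq, ← Quaternion.normSq_eq_norm_mul_self, Quaternion.normSq_def', EuclideanSpace.norm_sq_eq,
    Fin.sum_univ_three]
  simp
  ring

theorem norm_pt_zero (x : E3) : ‖pt x 0‖ = ‖x‖ := by
  have h := norm_pt_sq x 0
  rw [zero_pow two_ne_zero, add_zero] at h
  exact (pow_left_inj₀ (norm_nonneg _) (norm_nonneg _) two_ne_zero).mp h

theorem pt_sub_pt (x t : E3) (y : ℝ) : pt x y - pt t 0 = pt (x - t) y := by
  ext <;> simp

theorem sub_pt_mem_upperHalf : ∀ q ∈ upperHalf, ∀ t : E3, q - pt t 0 ∈ upperHalf := by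
  intro q hq t
  have : (q - pt t 0).re = q.re := by simp
  show 0 < (q - pt t 0).re
  rw [this]; exact hq

theorem pt_mem_upperHalf {x : E3} {y : ℝ} (hy : 0 < y) : pt x y ∈ upperHalf := hy

theorem ne_zero_of_mem_upperHalf {q : Quaternion ℝ} (hq : q ∈ upperHalf) : q ≠ 0 := by
  rintro rfl
  exact lt_irrefl _ (show (0 : ℝ) < 0 from hq)

theorem re_le_norm (q : Quaternion ℝ) : q.re ≤ ‖q‖ :=
  (le_abs_self _).trans (abs_le_of_sq_le_sq (re_sq_le_norm_sq q) (norm_nonneg q))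

/-- The weight paired with `f ∈ L²` by Cauchy-Schwarz. Its square decays like `|t|⁻⁴`, integrable in
dimension three. -/
theorem memLp_two_one_add_norm_inv_sq :
    MemLp (fun t : E3 => ((1 + ‖t‖)⁻¹) ^ 2) 2 volume := by
  refine (memLp_two_iff_integrable_sq (Continuous.aestronglyMeasurable ?_)).mpr ?_
  · have : ∀ t : E3, 1 + ‖t‖ ≠ 0 := fun t => by positivity
    fun_prop (disch := assumption)
  · have h := integrable_one_add_norm (E := E3) (μ := volume) (r := 4) (by simp; norm_num)
    refine h.congr (Eventually.of_forall fun t => ?_)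
    simp only
    rw [← pow_mul, Real.rpow_neg (by positivity), inv_pow]
    norm_cast

/-- Within half the height of `q₀`, `|q - t| ≥ r` and `1 + |t| ≤ A |q - t|`. Two of the `m` powers
of `|q - t|⁻¹` supply the `L²` weight and the remaining ones are bounded by powers of `r⁻¹`. -/
theorem locallyDominated_of_isHomKernel {V : Type*} [NormedAddCommGroup V] [NormedSpace ℝ V]
    {m : ℕ} (hm : 2 ≤ m) {k : Quaternion ℝ → V} (hk : IsHomKernel m k) {f : E3 → ℝ}
    (hf : MemLp f 2 volume) : LocallyDominated f (fun t => pt t 0) upperHalf k := by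
  intro q₀ hq₀
  obtain ⟨C, hC0, hC⟩ := hk.exists_bound
  have hy : 0 < q₀.re := hq₀
  set r := q₀.re / 2 with hr
  have hr0 : 0 < r := by positivity
  set A := (1 + ‖q₀‖ + r) / r + 1 with hA
  have hA1 : 1 ≤ A := by
    have : 0 ≤ (1 + ‖q₀‖ + r) / r := by positivity
    linarith
  have hint : Integrable (fun t : E3 => ‖f t‖ * ((1 + ‖t‖)⁻¹) ^ 2) volume :=
    (hf.norm).integrable_mul memLp_two_one_add_norm_inv_sq
  refine ⟨r, hr0, fun t => C * (r⁻¹ ^ (m - 2) * A ^ 2) * (‖f t‖ * ((1 + ‖t‖)⁻¹) ^ 2),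
    hint.const_mul _, fun q hq t => ?_⟩
  have hqr : ‖q - q₀‖ < r := by simpa [dist_eq_norm] using hq.1
  have hre : r ≤ (q - pt t 0).re := by
    have h1 : (q - pt t 0).re = q.re := by simp
    have h2 : (q₀ - q).re ≤ ‖q₀ - q‖ := re_le_norm _
    rw [norm_sub_rev, Quaternion.re_sub] at h2
    rw [h1]
    linarith
  have hrn : r ≤ ‖q - pt t 0‖ := hre.trans (re_le_norm _)
  have hn0 : 0 < ‖q - pt t 0‖ := hr0.trans_le hrn
  have hne : q - pt t 0 ≠ 0 := norm_pos_iff.mp hn0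
  have h1t : 1 + ‖t‖ ≤ A * ‖q - pt t 0‖ := by
    have h1 : ‖pt t 0‖ ≤ ‖q‖ + ‖q - pt t 0‖ := by
      have := norm_sub_le q (q - pt t 0)
      simpa using this
    have h2 : ‖q‖ ≤ ‖q₀‖ + r := by
      have := norm_add_le q₀ (q - q₀)
      rw [add_sub_cancel] at this
      linarith
    have h3 : 1 + ‖q₀‖ + r ≤ (1 + ‖q₀‖ + r) / r * ‖q - pt t 0‖ := by
      rw [div_mul_eq_mul_div, le_div_iff₀ hr0]
      gcongr
    rw [norm_pt_zero] at h1
    rw [hA, add_mul, one_mul]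
    linarith
  have hinv : ‖q - pt t 0‖⁻¹ ≤ A * (1 + ‖t‖)⁻¹ := by
    rw [← div_eq_mul_inv, le_div_iff₀ (by positivity), inv_mul_le_iff₀ hn0, mul_comm _ A]
    exact h1t
  rw [norm_smul]
  calc ‖f t‖ * ‖k (q - pt t 0)‖ ≤ ‖f t‖ * (C * (‖q - pt t 0‖⁻¹) ^ m) := by
        gcongr; exact hC _ hne
    _ = ‖f t‖ * (C * ((‖q - pt t 0‖⁻¹) ^ (m - 2) * (‖q - pt t 0‖⁻¹) ^ 2)) := by
        rw [← pow_add, Nat.sub_add_cancel hm]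
    _ ≤ ‖f t‖ * (C * ((r⁻¹) ^ (m - 2) * (A * (1 + ‖t‖)⁻¹) ^ 2)) := by
        gcongr
    _ = C * (r⁻¹ ^ (m - 2) * A ^ 2) * (‖f t‖ * ((1 + ‖t‖)⁻¹) ^ 2) := by ring

/-- Quaternionic conjugation as a continuous linear map. -/
def quatConjL : Quaternion ℝ →L[ℝ] Quaternion ℝ :=
  LinearMap.toContinuousLinearMap
    { toFun := star
      map_add' := star_add
      map_smul' := fun c q => by ext <;> simp }

/-- The real part as a continuous linear functional. -/
def quatReL : Quaternion ℝ →L[ℝ] ℝ :=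
  LinearMap.toContinuousLinearMap
    { toFun := fun q => q.re
      map_add' := Quaternion.re_add
      map_smul' := fun c q => Quaternion.re_smul q c }

theorem quatConjL_apply (q : Quaternion ℝ) : quatConjL q = star q := rfl

theorem quatReL_apply (q : Quaternion ℝ) : quatReL q = q.re := rfl

theorem canonicalExtension_eq (f : E3 → ℝ) (q : Quaternion ℝ) :
    canonicalExtension f q =
      (1 / Real.pi ^ 2) • potential f (fun t => pt t 0) (quarticKernel quatConjL) q := by
  simp only [canonicalExtension, potential, quarticKernel, smul_smul, div_eq_mul_inv,
    quatConjL_apply]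

variable {V : Type*} [NormedAddCommGroup V] [NormedSpace ℝ V]

theorem contDiffOn_of_isHomKernel {m : ℕ} {k : Quaternion ℝ → V} (hk : IsHomKernel m k)
    {n : ℕ} : ContDiffOn ℝ n k upperHalf :=
  (hk.smooth.of_le (by exact_mod_cast le_top)).mono fun _ hq => ne_zero_of_mem_upperHalf hq

theorem contDiffOn_two_quarticPotential {f : E3 → ℝ} (hf : MemLp f 2 volume)
    (σ : Quaternion ℝ →L[ℝ] V) :
    ContDiffOn ℝ 2 (potential f (fun t => pt t 0) (quarticKernel σ)) upperHalf :=
  have hk := isHomKernel_quarticKernel σ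
  contDiffOn_two_potential isOpen_upperHalf hf.1 continuous_pt_zero sub_pt_mem_upperHalf
    (contDiffOn_of_isHomKernel hk (n := 2))
    (locallyDominated_of_isHomKernel (by norm_num) hk hf)
    (locallyDominated_of_isHomKernel (by norm_num) hk.fderiv hf)
    (locallyDominated_of_isHomKernel (by norm_num) hk.fderiv.fderiv hf)

theorem hasFDerivAt_quarticPotential {f : E3 → ℝ} (hf : MemLp f 2 volume)
    (σ : Quaternion ℝ →L[ℝ] V) {q : Quaternion ℝ} (hq : q ∈ upperHalf) :
    HasFDerivAt (potential f (fun t => pt t 0) (quarticKernel σ))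
      (potential f (fun t => pt t 0) (fderiv ℝ (quarticKernel σ)) q) q :=
  have hk := isHomKernel_quarticKernel σ
  hasFDerivAt_potential isOpen_upperHalf hf.1 continuous_pt_zero sub_pt_mem_upperHalf
    (contDiffOn_of_isHomKernel hk (n := 1))
    (locallyDominated_of_isHomKernel (by norm_num) hk hf)
    (locallyDominated_of_isHomKernel (by norm_num) hk.fderiv hf) hq

end CanonicalExtension

/-! ### Left-regularity, the identity `|D̄F| = |∇ Re F|`, and harmonicity. -/

section Regularity

open scoped RealInnerProductSpace Quaternion

/-- A continuous linear map commutes with the integral. Taking for `k` a first or second derivative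
of a kernel, this transfers linear differential equations from the kernel to its potential. -/
theorem clm_potential_eq_zero {E V W : Type*} [NormedAddCommGroup E] [NormedSpace ℝ E]
    [NormedAddCommGroup V]
    [NormedSpace ℝ V] [NormedAddCommGroup W] [NormedSpace ℝ W] [CompleteSpace V] [CompleteSpace W]
    {f : E3 → ℝ} {s : E3 → E} {U : Set E} {k : E → V} (hf : AEStronglyMeasurable f volume)
    (hs : Continuous s) (hsU : ∀ q ∈ U, ∀ t, q - s t ∈ U) (hk : ContinuousOn k U)
    (hd : LocallyDominated f s U k) (Λ : V →L[ℝ] W) (h0 : ∀ q ∈ U, Λ (k q) = 0) {q : E}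
    (hq : q ∈ U) : Λ (potential f s k q) = 0 := by
  rw [potential, ← Λ.integral_comp_comm (integrable_potential hf hs hsU hk hd hq)]
  simp [h0 _ (hsU q hq _)]

theorem clm_fderiv_quarticPotential_eq_zero {V W : Type*} [NormedAddCommGroup V]
    [NormedSpace ℝ V] [NormedAddCommGroup W] [NormedSpace ℝ W] [CompleteSpace V] [CompleteSpace W]
    {f : E3 → ℝ} (hf : MemLp f 2 volume) (σ : Quaternion ℝ →L[ℝ] V)
    (Λ : (Quaternion ℝ →L[ℝ] V) →L[ℝ] W)
    (h0 : ∀ q ∈ upperHalf, Λ (fderiv ℝ (quarticKernel σ) q) = 0) {q : Quaternion ℝ}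
    (hq : q ∈ upperHalf) :
    Λ (fderiv ℝ (potential f (fun t => pt t 0) (quarticKernel σ)) q) = 0 := by
  have hk := (isHomKernel_quarticKernel σ).fderiv
  have h := clm_potential_eq_zero hf.1 continuous_pt_zero sub_pt_mem_upperHalf
    (contDiffOn_of_isHomKernel hk (n := 0)).continuousOn
    (locallyDominated_of_isHomKernel (by norm_num) hk hf) Λ h0 hq
  rw [← (hasFDerivAt_quarticPotential hf σ hq).fderiv] at h
  exact h

/-- The symbol of `D` as a linear map on differentials. -/
def symbolD : (Quaternion ℝ →L[ℝ] Quaternion ℝ) →L[ℝ] Quaternion ℝ :=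
  LinearMap.toContinuousLinearMap
    { toFun := fun T => (1 / 2 : ℝ) • (T 1 + (qi * T qi + qj * T qj + qk * T qk))
      map_add' := fun S T => by
        simp only [add_apply, mul_add, ← smul_add]
        congr 1
        abel
      map_smul' := fun c T => by
        simp only [smul_apply, mul_smul_comm, ← smul_add, RingHom.id_apply]
        rw [smul_comm] }

theorem symbolD_apply (T : Quaternion ℝ →L[ℝ] Quaternion ℝ) :
    symbolD T = (1 / 2 : ℝ) • (T 1 + (qi * T qi + qj * T qj + qk * T qk)) := rfl

@[simp] theorem re_qi : qi.re = 0 := rfl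
@[simp] theorem imI_qi : qi.imI = 1 := rfl
@[simp] theorem imJ_qi : qi.imJ = 0 := rfl
@[simp] theorem imK_qi : qi.imK = 0 := rfl
@[simp] theorem re_qj : qj.re = 0 := rfl
@[simp] theorem imI_qj : qj.imI = 0 := rfl
@[simp] theorem imJ_qj : qj.imJ = 1 := rfl
@[simp] theorem imK_qj : qj.imK = 0 := rfl
@[simp] theorem re_qk : qk.re = 0 := rfl
@[simp] theorem imI_qk : qk.imI = 0 := rfl
@[simp] theorem imJ_qk : qk.imJ = 0 := rfl
@[simp] theorem imK_qk : qk.imK = 1 := rfl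

theorem inner_quatUnits (q : Quaternion ℝ) :
    ⟪q, (1 : Quaternion ℝ)⟫ = q.re ∧ ⟪q, qi⟫ = q.imI ∧ ⟪q, qj⟫ = q.imJ ∧ ⟪q, qk⟫ = q.imK := by
  simp [Quaternion.inner_def]

theorem norm_sq_eq_components (q : Quaternion ℝ) :
    ‖q‖ ^ 2 = q.re ^ 2 + (q.imI ^ 2 + q.imJ ^ 2 + q.imK ^ 2) := by
  rw [sq, ← Quaternion.normSq_eq_norm_mul_self, Quaternion.normSq_def']
  ring

theorem fderiv_cauchyKernel_apply {q : Quaternion ℝ} (hq : q ≠ 0) (h : Quaternion ℝ) :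
    fderiv ℝ (quarticKernel quatConjL) q h =
      (‖q‖ ^ 6)⁻¹ • (‖q‖ ^ 2 • star h - (4 * ⟪q, h⟫) • star q) := by
  have hn : ‖q‖ ≠ 0 := norm_ne_zero_iff.mpr hq
  have h1 := fderiv_quarticKernel_apply quatConjL hq h
  refine h1.trans ?_
  rw [quatConjL_apply, quatConjL_apply, smul_sub, smul_smul, smul_smul]
  congr 2
  · field_simp
  · ring

/-- Over the units `e`, `∑ e ē = 4` and `∑ ⟪q, e⟫ e = q`, so up to a scalar the sum is `4|q|² - 4 q
q̄ = 0`. The check is made in coordinates. -/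
theorem symbolD_fderiv_cauchyKernel {q : Quaternion ℝ} (hq : q ≠ 0) :
    symbolD (fderiv ℝ (quarticKernel quatConjL) q) = 0 := by
  obtain ⟨h1, h2, h3, h4⟩ := inner_quatUnits q
  rw [symbolD_apply, fderiv_cauchyKernel_apply hq, fderiv_cauchyKernel_apply hq,
    fderiv_cauchyKernel_apply hq, fderiv_cauchyKernel_apply hq, h1, h2, h3, h4]
  have hN := norm_sq_eq_components q
  simp only [mul_smul_comm, ← smul_add]
  rw [smul_eq_zero_of_right]
  rw [smul_eq_zero_of_right]
  rw [hN]
  ext <;> simp <;> ring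

/-- The combination `Im_e (∂_y K) + ∂_e (Re K)` for an imaginary unit read off by `c`. -/
def symbolCR (c : Quaternion ℝ →L[ℝ] ℝ) (e : Quaternion ℝ) :
    (Quaternion ℝ →L[ℝ] Quaternion ℝ) →L[ℝ] ℝ :=
  LinearMap.toContinuousLinearMap
    { toFun := fun T => c (T 1) + quatReL (T e)
      map_add' := fun S T => by simp only [add_apply, map_add]; ring
      map_smul' := fun a T => by
        simp only [smul_apply, map_smul, smul_eq_mul, RingHom.id_apply]; ring }

theorem symbolCR_apply (c : Quaternion ℝ →L[ℝ] ℝ) (e : Quaternion ℝ)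
    (T : Quaternion ℝ →L[ℝ] Quaternion ℝ) : symbolCR c e T = c (T 1) + (T e).re := rfl

/-- The `i`-component as a continuous linear functional. -/
def quatImIL : Quaternion ℝ →L[ℝ] ℝ :=
  LinearMap.toContinuousLinearMap
    { toFun := fun q => q.imI, map_add' := Quaternion.imI_add
      map_smul' := fun c q => Quaternion.imI_smul q c }

/-- The `j`-component as a continuous linear functional. -/
def quatImJL : Quaternion ℝ →L[ℝ] ℝ :=
  LinearMap.toContinuousLinearMap
    { toFun := fun q => q.imJ, map_add' := Quaternion.imJ_add
      map_smul' := fun c q => Quaternion.imJ_smul q c }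

/-- The `k`-component as a continuous linear functional. -/
def quatImKL : Quaternion ℝ →L[ℝ] ℝ :=
  LinearMap.toContinuousLinearMap
    { toFun := fun q => q.imK, map_add' := Quaternion.imK_add
      map_smul' := fun c q => Quaternion.imK_smul q c }

/-- With `φ = -1/(2|q|²)` the kernel has real part `∂_y φ` and imaginary components `-∂_e φ`, so the
identities express `∂_y ∂_e φ = ∂_e ∂_y φ`. They are verified from the explicit derivative. -/
theorem symbolCR_fderiv_cauchyKernel {q : Quaternion ℝ} (hq : q ≠ 0) :
    symbolCR quatImIL qi (fderiv ℝ (quarticKernel quatConjL) q) = 0 ∧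
    symbolCR quatImJL qj (fderiv ℝ (quarticKernel quatConjL) q) = 0 ∧
    symbolCR quatImKL qk (fderiv ℝ (quarticKernel quatConjL) q) = 0 := by
  obtain ⟨h1, h2, h3, h4⟩ := inner_quatUnits q
  simp only [symbolCR_apply, fderiv_cauchyKernel_apply hq, h1, h2, h3, h4]
  refine ⟨?_, ?_, ?_⟩ <;> simp only [quatImIL, quatImJL, quatImKL,
    LinearMap.coe_toContinuousLinearMap', LinearMap.coe_mk, AddHom.coe_mk] <;> simp <;> ring

section Canonical

variable {f : E3 → ℝ}

theorem contDiffOn_canonicalExtension (hf : MemLp f 2 volume) :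
    ContDiffOn ℝ 2 (canonicalExtension f) upperHalf := by
  have h := (contDiffOn_two_quarticPotential hf quatConjL).const_smul (1 / Real.pi ^ 2 : ℝ)
  exact h.congr fun q _ => canonicalExtension_eq f q

theorem fderiv_canonicalExtension (hf : MemLp f 2 volume) (q : Quaternion ℝ) (hq : q ∈ upperHalf) :
    fderiv ℝ (canonicalExtension f) q = (1 / Real.pi ^ 2 : ℝ) •
      fderiv ℝ (potential f (fun t => pt t 0) (quarticKernel quatConjL)) q := by
  have h1 := (hasFDerivAt_quarticPotential hf quatConjL hq).differentiableAt.hasFDerivAt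
  have h := h1.const_smul (1 / Real.pi ^ 2 : ℝ)
  have e : canonicalExtension f = fun q => (1 / Real.pi ^ 2 : ℝ) •
      potential f (fun t => pt t 0) (quarticKernel quatConjL) q :=
    funext (canonicalExtension_eq f)
  rw [e]
  exact h.fderiv

theorem opD_canonicalExtension (hf : MemLp f 2 volume) {q : Quaternion ℝ} (hq : q ∈ upperHalf) :
    opD (canonicalExtension f) q = 0 := by
  have h := clm_fderiv_quarticPotential_eq_zero hf quatConjL symbolD
    (fun q hq => symbolD_fderiv_cauchyKernel (ne_zero_of_mem_upperHalf hq)) hq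
  have h2 : opD (canonicalExtension f) q = symbolD (fderiv ℝ (canonicalExtension f) q) := rfl
  rw [h2, fderiv_canonicalExtension hf q hq]
  exact (symbolD.map_smul _ _).trans (by rw [h, smul_zero])

theorem leftRegularOn_canonicalExtension (hf : MemLp f 2 volume) :
    LeftRegularOn (canonicalExtension f) upperHalf :=
  ⟨(contDiffOn_canonicalExtension hf).of_le (by norm_num),
    fun _ hq => opD_canonicalExtension hf hq⟩

theorem symbolCR_canonicalExtension (hf : MemLp f 2 volume) {c : Quaternion ℝ →L[ℝ] ℝ}
    {e : Quaternion ℝ}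
    (h0 : ∀ q : Quaternion ℝ, q ≠ 0 →
      symbolCR c e (fderiv ℝ (quarticKernel quatConjL) q) = 0) {q : Quaternion ℝ}
    (hq : q ∈ upperHalf) :
    c (fderiv ℝ (canonicalExtension f) q 1) = -(fderiv ℝ (canonicalExtension f) q e).re := by
  have h := clm_fderiv_quarticPotential_eq_zero hf quatConjL (symbolCR c e)
    (fun q hq => h0 q (ne_zero_of_mem_upperHalf hq)) hq
  have h2 : symbolCR c e (fderiv ℝ (canonicalExtension f) q) = 0 := by
    rw [fderiv_canonicalExtension hf q hq]
    exact ((symbolCR c e).map_smul _ _).trans (by rw [h, smul_zero])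
  rw [symbolCR_apply] at h2
  linarith

/-- By `DF = 0` the horizontal part of `D̄F` equals the vertical part, so the two halves add up to
`∂_y F`. -/
theorem opDbar_canonicalExtension (hf : MemLp f 2 volume) {q : Quaternion ℝ} (hq : q ∈ upperHalf) :
    opDbar (canonicalExtension f) q = fderiv ℝ (canonicalExtension f) q 1 := by
  have h := opD_canonicalExtension hf hq
  rw [opD, smul_eq_zero_iff_right (by norm_num)] at h
  rw [opDbar, sub_eq_add_neg, ← eq_neg_of_add_eq_zero_left h, ← two_smul ℝ, smul_smul]
  norm_num

theorem norm_opDbar_canonicalExtension_sq (hf : MemLp f 2 volume)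
    {q : Quaternion ℝ} (hq : q ∈ upperHalf) :
    ‖opDbar (canonicalExtension f) q‖ ^ 2 =
      (fderiv ℝ (canonicalExtension f) q 1).re ^ 2 +
        ((fderiv ℝ (canonicalExtension f) q qi).re ^ 2 +
          (fderiv ℝ (canonicalExtension f) q qj).re ^ 2 +
          (fderiv ℝ (canonicalExtension f) q qk).re ^ 2) := by
  rw [opDbar_canonicalExtension hf hq, norm_sq_eq_components]
  have h1 : (fderiv ℝ (canonicalExtension f) q 1).imI = _ :=
    symbolCR_canonicalExtension hf (fun q hq => (symbolCR_fderiv_cauchyKernel hq).1) hq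
  have h2 : (fderiv ℝ (canonicalExtension f) q 1).imJ = _ :=
    symbolCR_canonicalExtension hf (fun q hq => (symbolCR_fderiv_cauchyKernel hq).2.1) hq
  have h3 : (fderiv ℝ (canonicalExtension f) q 1).imK = _ :=
    symbolCR_canonicalExtension hf (fun q hq => (symbolCR_fderiv_cauchyKernel hq).2.2) hq
  rw [h1, h2, h3, neg_sq, neg_sq, neg_sq]

/-- If `u` is the real part of the canonical extension then `|D̄F| = |∇u|`. -/
theorem norm_gradient_sq_eq_opDbar (hf : MemLp f 2 volume) {u : Quaternion ℝ → ℝ}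
    (hu : ∀ q ∈ upperHalf, (canonicalExtension f q).re = u q) {q : Quaternion ℝ}
    (hq : q ∈ upperHalf) :
    ‖gradient u q‖ ^ 2 = ‖opDbar (canonicalExtension f) q‖ ^ 2 := by
  have hF : HasFDerivAt (canonicalExtension f) (fderiv ℝ (canonicalExtension f) q) q :=
    (((contDiffOn_canonicalExtension hf).differentiableOn (by norm_num)).differentiableAt
      (isOpen_upperHalf.mem_nhds hq)).hasFDerivAt
  have hu' : HasFDerivAt u (quatReL.comp (fderiv ℝ (canonicalExtension f) q)) q := by
    refine (quatReL.hasFDerivAt.comp q hF).congr_of_eventuallyEq ?_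
    filter_upwards [isOpen_upperHalf.mem_nhds hq] with p hp using (hu p hp).symm
  rw [norm_gradient_sq, norm_opDbar_canonicalExtension_sq hf hq, hu'.fderiv]
  rfl

end Canonical

/-- The Poisson integral in kernel form. -/
theorem re_canonicalExtension (f : E3 → ℝ) (q : Quaternion ℝ)
    (hi : Integrable (fun t => f t • quarticKernel quatConjL (q - pt t 0)) volume) :
    (canonicalExtension f q).re =
      (1 / Real.pi ^ 2) * potential f (fun t => pt t 0) (quarticKernel quatReL) q := by
  rw [canonicalExtension_eq, Quaternion.re_smul, smul_eq_mul]
  congr 1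
  have h := quatReL.integral_comp_comm hi
  rw [quatReL_apply] at h
  refine h.symm.trans ?_
  rw [potential]
  congr 1
  ext t
  simp [quarticKernel, quatReL_apply, quatConjL_apply]

/-- The trace of bilinear forms over `1, i, j, k` as a continuous linear functional. -/
def quatTraceL : (Quaternion ℝ →L[ℝ] Quaternion ℝ →L[ℝ] ℝ) →L[ℝ] ℝ :=
  LinearMap.toContinuousLinearMap
    { toFun := quatTrace
      map_add' := fun S T => by simp only [quatTrace, add_apply]; ring
      map_smul' := fun c T => by
        simp only [quatTrace, smul_apply, smul_eq_mul, RingHom.id_apply]; ring }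

/-- Harmonicity of `Re q/|q|⁴`: the three terms of the second-derivative formula sum to `(-8 - 16 +
24) Re q/|q|⁶`, where the `16` is four times the dimension. -/
theorem quatTrace_fderiv_fderiv_poisson {q : Quaternion ℝ} (hq : q ≠ 0) :
    quatTrace (fderiv ℝ (fderiv ℝ (quarticKernel quatReL)) q) = 0 := by
  have h := fun e => fderiv_fderiv_quarticKernel_apply quatReL hq e
  obtain ⟨h1, h2, h3, h4⟩ := inner_quatUnits q
  obtain ⟨n1, n2, n3, n4⟩ := norm_quatUnits
  have hn : ‖q‖ ≠ 0 := norm_ne_zero_iff.mpr hq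
  have hN := norm_sq_eq_components q
  have e1 := h 1
  have e2 := h qi
  have e3 := h qj
  have e4 := h qk
  rw [h1, n1] at e1
  rw [h2, n2] at e2
  rw [h3, n3] at e3
  rw [h4, n4] at e4
  refine (congrArg₂ (· + ·) e1 (congrArg₂ (· + ·) (congrArg₂ (· + ·) e2 e3) e4)).trans ?_
  simp only [quatReL_apply, Quaternion.re_one, re_qi, re_qj, re_qk]
  have h8 : (‖q‖ ^ 6)⁻¹ = ‖q‖ ^ 2 * (‖q‖ ^ 8)⁻¹ := by field_simp
  rw [h8, hN]
  ring

theorem quatTrace_fderiv_fderiv_poissonPotential {f : E3 → ℝ} (hf : MemLp f 2 volume)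
    {q : Quaternion ℝ} (hq : q ∈ upperHalf) :
    quatTrace (fderiv ℝ (fderiv ℝ
      (potential f (fun t => pt t 0) (quarticKernel quatReL))) q) = 0 := by
  have hk := isHomKernel_quarticKernel quatReL
  have h1 := hasFDerivAt_fderiv_potential isOpen_upperHalf hf.1 continuous_pt_zero
    sub_pt_mem_upperHalf (contDiffOn_of_isHomKernel hk (n := 2))
    (locallyDominated_of_isHomKernel (by norm_num) hk hf)
    (locallyDominated_of_isHomKernel (by norm_num) hk.fderiv hf)
    (locallyDominated_of_isHomKernel (by norm_num) hk.fderiv.fderiv hf) hq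
  have h2 := clm_potential_eq_zero hf.1 continuous_pt_zero sub_pt_mem_upperHalf
    (contDiffOn_of_isHomKernel hk.fderiv.fderiv (n := 0)).continuousOn
    (locallyDominated_of_isHomKernel (by norm_num) hk.fderiv.fderiv hf) quatTraceL
    (fun q hq => quatTrace_fderiv_fderiv_poisson (ne_zero_of_mem_upperHalf hq)) hq
  rw [← h1.fderiv] at h2
  exact h2

end Regularity

/-! ### Convergence of slices in `L²` from finite energy. -/

section Boundary

open scoped ENNReal

theorem eLpNorm_two_sq {α G : Type*} [MeasurableSpace α] [NormedAddCommGroup G] {μ : Measure α}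
    (f : α → G) : eLpNorm f 2 μ ^ 2 = ∫⁻ x, ‖f x‖ₑ ^ 2 ∂μ := by
  rw [eLpNorm_eq_lintegral_rpow_enorm_toReal (by norm_num) (by norm_num), ← ENNReal.rpow_natCast,
    ← ENNReal.rpow_mul]
  simp

theorem lintegral_sq_le {α : Type*} [MeasurableSpace α] {μ : Measure α} {f : α → ℝ≥0∞}
    (hf : AEMeasurable f μ) : (∫⁻ x, f x ∂μ) ^ 2 ≤ μ univ * ∫⁻ x, f x ^ 2 ∂μ := by
  have h := ENNReal.lintegral_mul_le_Lp_mul_Lq μ Real.HolderConjugate.two_two hf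
    (aemeasurable_const (b := (1 : ℝ≥0∞)))
  simp only [Pi.mul_apply, mul_one, ENNReal.one_rpow, lintegral_one] at h
  calc (∫⁻ x, f x ∂μ) ^ 2
      ≤ ((∫⁻ x, f x ^ (2 : ℝ) ∂μ) ^ (1 / 2 : ℝ) * μ univ ^ (1 / 2 : ℝ)) ^ 2 := by gcongr
    _ = μ univ * ∫⁻ x, f x ^ 2 ∂μ := by
      rw [mul_pow, ← ENNReal.rpow_natCast, ← ENNReal.rpow_natCast, ← ENNReal.rpow_mul,
        ← ENNReal.rpow_mul, mul_comm]
      simp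

theorem continuousOn_norm_gradient_sq {u : Quaternion ℝ → ℝ} (hu : ContDiffOn ℝ 1 u upperHalf) :
    ContinuousOn (fun q => ENNReal.ofReal (‖gradient u q‖ ^ 2)) upperHalf := by
  have h : ContinuousOn (fderiv ℝ u) upperHalf :=
    hu.continuousOn_fderiv_of_isOpen isOpen_upperHalf le_rfl
  have he : ∀ e : Quaternion ℝ, ContinuousOn (fun q => fderiv ℝ u q e) upperHalf := fun e =>
    (ContinuousLinearMap.apply ℝ ℝ e).continuous.comp_continuousOn h
  simp only [norm_gradient_sq]
  exact ENNReal.continuous_ofReal.comp_continuousOn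
    (((he 1).pow 2).add ((((he qi).pow 2).add ((he qj).pow 2)).add ((he qk).pow 2)))

theorem aemeasurable_upper {g : Quaternion ℝ → ℝ≥0∞} (hg : ContinuousOn g upperHalf) :
    AEMeasurable (fun p : E3 × ℝ => g (pt p.1 p.2))
      ((volume : Measure E3).prod (volume.restrict (Ioi (0 : ℝ)))) := by
  have h : (volume : Measure E3).prod (volume.restrict (Ioi (0 : ℝ))) =
      ((volume : Measure E3).prod volume).restrict (univ ×ˢ Ioi (0 : ℝ)) := by
    rw [← Measure.prod_restrict, Measure.restrict_univ]
  rw [h]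
  refine ContinuousOn.aemeasurable ?_ (MeasurableSet.univ.prod measurableSet_Ioi)
  exact hg.comp continuous_pt.continuousOn fun p hp => hp.2

theorem integralUpper_eq_prod (g : Quaternion ℝ → ℝ≥0∞) :
    integralUpper g = ∫⁻ p : E3 × ℝ, g (pt p.1 p.2)
      ∂((volume : Measure E3).prod (volume.restrict (Ioi (0 : ℝ)))) := by
  rw [integralUpper, Measure.volume_eq_prod, ← Measure.prod_restrict, Measure.restrict_univ]

theorem integralUpper_eq {g : Quaternion ℝ → ℝ≥0∞} (hg : ContinuousOn g upperHalf) :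
    integralUpper g = ∫⁻ x : E3, ∫⁻ y in Ioi (0 : ℝ), g (pt x y) := by
  rw [integralUpper_eq_prod, lintegral_prod _ (aemeasurable_upper hg)]

theorem integralUpper_eq_symm {g : Quaternion ℝ → ℝ≥0∞} (hg : ContinuousOn g upperHalf) :
    integralUpper g = ∫⁻ y in Ioi (0 : ℝ), ∫⁻ x : E3, g (pt x y) := by
  rw [integralUpper_eq_prod, lintegral_prod_symm _ (aemeasurable_upper hg)]

theorem hasDerivAt_pt_right (x : E3) (y : ℝ) : HasDerivAt (fun s : ℝ => pt x s) 1 y := by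
  have h1 : HasDerivAt (fun s : ℝ => (x, s)) ((0 : E3), (1 : ℝ)) y :=
    (hasDerivAt_const y x).prodMk (hasDerivAt_id y)
  have h2 := ptL.hasFDerivAt.comp_hasDerivAt y h1
  have e : ptL ((0 : E3), (1 : ℝ)) = 1 := by
    rw [ptL_apply]; rfl
  rw [e] at h2
  exact h2

/-- The fundamental theorem of calculus on the vertical segment, Cauchy-Schwarz against the constant
`1`, and `|∂_y u| ≤ |∇u|`. -/
theorem enorm_sub_sq_le_lintegral {u : Quaternion ℝ → ℝ} (hu : ContDiffOn ℝ 1 u upperHalf)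
    (x : E3) {a b : ℝ} (ha : 0 < a) (hab : a ≤ b) :
    ‖u (pt x b) - u (pt x a)‖ₑ ^ 2 ≤ ENNReal.ofReal (b - a) *
      ∫⁻ s in Ioi (0 : ℝ), ENNReal.ofReal (‖gradient u (pt x s)‖ ^ 2) := by
  have hd : ∀ s ∈ uIcc a b, HasDerivAt (fun s => u (pt x s)) (fderiv ℝ u (pt x s) 1) s := by
    intro s hs
    rw [uIcc_of_le hab] at hs
    have hmem : pt x s ∈ upperHalf := ha.trans_le hs.1
    have h1 : HasFDerivAt u (fderiv ℝ u (pt x s)) (pt x s) :=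
      ((hu.differentiableOn (by norm_num)).differentiableAt
        (isOpen_upperHalf.mem_nhds hmem)).hasFDerivAt
    exact h1.comp_hasDerivAt s (hasDerivAt_pt_right x s)
  have h : ContinuousOn (fderiv ℝ u) upperHalf :=
    hu.continuousOn_fderiv_of_isOpen isOpen_upperHalf le_rfl
  have hcont : ContinuousOn (fun s => fderiv ℝ u (pt x s) 1) (uIcc a b) := by
    have he : ContinuousOn (fun q => fderiv ℝ u q 1) upperHalf :=
      (ContinuousLinearMap.apply ℝ ℝ (1 : Quaternion ℝ)).continuous.comp_continuousOn h
    refine he.comp (fun s _ => (hasDerivAt_pt_right x s).continuousAt.continuousWithinAt) ?_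
    intro s hs
    rw [uIcc_of_le hab] at hs
    exact ha.trans_le hs.1
  have hint := hcont.intervalIntegrable (μ := volume)
  rw [← intervalIntegral.integral_eq_sub_of_hasDerivAt hd hint,
    intervalIntegral.integral_of_le hab]
  calc ‖∫ s in Ioc a b, fderiv ℝ u (pt x s) 1‖ₑ ^ 2
      ≤ (∫⁻ s in Ioc a b, ‖fderiv ℝ u (pt x s) 1‖ₑ) ^ 2 := by
        gcongr; exact enorm_integral_le_lintegral_enorm _
    _ ≤ volume.restrict (Ioc a b) univ * ∫⁻ s in Ioc a b, ‖fderiv ℝ u (pt x s) 1‖ₑ ^ 2 :=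
        lintegral_sq_le hint.1.aestronglyMeasurable.enorm
    _ ≤ ENNReal.ofReal (b - a) *
        ∫⁻ s in Ioi (0 : ℝ), ENNReal.ofReal (‖gradient u (pt x s)‖ ^ 2) := by
        rw [Measure.restrict_apply_univ, Real.volume_Ioc]
        refine mul_le_mul' le_rfl ?_
        calc ∫⁻ s in Ioc a b, ‖fderiv ℝ u (pt x s) 1‖ₑ ^ 2
            ≤ ∫⁻ s in Ioc a b, ENNReal.ofReal (‖gradient u (pt x s)‖ ^ 2) := by
              refine lintegral_mono fun s => ?_
              simp only
              rw [← ofReal_norm, ← ENNReal.ofReal_pow (norm_nonneg _), norm_gradient_sq]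
              refine ENNReal.ofReal_le_ofReal ?_
              rw [Real.norm_eq_abs, sq_abs]
              have := sq_nonneg (fderiv ℝ u (pt x s) qi)
              have := sq_nonneg (fderiv ℝ u (pt x s) qj)
              have := sq_nonneg (fderiv ℝ u (pt x s) qk)
              linarith
          _ ≤ _ := lintegral_mono_set fun s hs => ha.trans hs.1

theorem lintegral_enorm_sub_sq_le {u : Quaternion ℝ → ℝ} (hu : ContDiffOn ℝ 1 u upperHalf)
    {a b : ℝ} (ha : 0 < a) (hab : a ≤ b) :
    ∫⁻ x : E3, ‖u (pt x b) - u (pt x a)‖ₑ ^ 2 ≤ ENNReal.ofReal (b - a) * gradientEnergy u := by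
  rw [gradientEnergy, integralUpper_eq (continuousOn_norm_gradient_sq hu),
    ← lintegral_const_mul' _ _ ENNReal.ofReal_ne_top]
  exact lintegral_mono fun x => enorm_sub_sq_le_lintegral hu x ha hab

theorem continuous_slice {u : Quaternion ℝ → ℝ} (hu : ContinuousOn u upperHalf) {y : ℝ}
    (hy : 0 < y) : Continuous fun x : E3 => u (pt x y) :=
  hu.comp_continuous (continuous_pt.comp (by fun_prop : Continuous fun x : E3 => (x, y)))
    fun _ => hy

variable {u : Quaternion ℝ → ℝ} {f : E3 → ℝ}

theorem MemDirichlet.contDiffOn (hu : MemDirichlet u) : ContDiffOn ℝ 2 u upperHalf := fun q hq =>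
  (hu.harmonic q hq).1.contDiffWithinAt

theorem MemDirichlet.contDiffOn_one (hu : MemDirichlet u) : ContDiffOn ℝ 1 u upperHalf :=
  hu.contDiffOn.of_le (by norm_num)

theorem eLpNorm_slice_le_hardyNorm (u : Quaternion ℝ → ℝ) {y : ℝ} (hy : 0 < y) :
    eLpNorm (fun x : E3 => u (pt x y)) 2 volume ≤ hardyNorm u :=
  le_iSup₂ (f := fun (y : ℝ) (_ : 0 < y) => eLpNorm (fun x : E3 => u (pt x y)) 2 volume) y hy

theorem MemDirichlet.memLp_slice (hu : MemDirichlet u) {y : ℝ} (hy : 0 < y) :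
    MemLp (fun x : E3 => u (pt x y)) 2 volume :=
  ⟨(continuous_slice hu.contDiffOn.continuousOn hy).aestronglyMeasurable,
    (eLpNorm_slice_le_hardyNorm u hy).trans_lt hu.hardy⟩

theorem IsBoundaryFunction.tendsto_seq (hf : IsBoundaryFunction u f) : ∀ᵐ x : E3,
    Tendsto (fun n : ℕ => u (pt x (1 / ((n : ℝ) + 1)))) atTop (𝓝 (f x)) := by
  have h : Tendsto (fun n : ℕ => 1 / ((n : ℝ) + 1)) atTop (𝓝[>] 0) :=
    tendsto_nhdsWithin_iff.mpr ⟨tendsto_one_div_add_atTop_nhds_zero_nat,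
      Eventually.of_forall fun n => show 0 < 1 / ((n : ℝ) + 1) by positivity⟩
  filter_upwards [hf] with x hx using hx.comp h

theorem IsBoundaryFunction.aestronglyMeasurable (hf : IsBoundaryFunction u f)
    (hu : MemDirichlet u) : AEStronglyMeasurable f volume :=
  aestronglyMeasurable_of_tendsto_ae atTop
    (fun n : ℕ => (continuous_slice hu.contDiffOn.continuousOn
      (show 0 < 1 / ((n : ℝ) + 1) by positivity)).aestronglyMeasurable) (hf.tendsto_seq)

/-- The slices converge to the boundary function in `L²`, at rate `√y`. -/
theorem IsBoundaryFunction.lintegral_enorm_sub_sq_le (hf : IsBoundaryFunction u f)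
    (hu : MemDirichlet u) {y : ℝ} (hy : 0 < y) :
    ∫⁻ x : E3, ‖u (pt x y) - f x‖ₑ ^ 2 ≤ ENNReal.ofReal y * gradientEnergy u := by
  set a : ℕ → ℝ := fun n => 1 / ((n : ℝ) + 1) with ha
  have ha0 : ∀ n, 0 < a n := fun n => by positivity
  have hle : ∀ᶠ n in atTop, a n ≤ y :=
    (tendsto_one_div_add_atTop_nhds_zero_nat.eventually (gt_mem_nhds hy)).mono fun n h => h.le
  -- Fatou's lemma along the heights `1/(n+1)`, applied to the increment estimate between that
  -- height and `y`.
  calc ∫⁻ x : E3, ‖u (pt x y) - f x‖ₑ ^ 2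
      = ∫⁻ x : E3, liminf (fun n => ‖u (pt x y) - u (pt x (a n))‖ₑ ^ 2) atTop := by
        refine lintegral_congr_ae ?_
        filter_upwards [hf.tendsto_seq] with x hx
        exact ((((ENNReal.continuous_pow 2).tendsto _).comp
          ((continuous_enorm.tendsto _).comp (tendsto_const_nhds.sub hx))).liminf_eq).symm
    _ ≤ liminf (fun n => ∫⁻ x : E3, ‖u (pt x y) - u (pt x (a n))‖ₑ ^ 2) atTop := by
        refine lintegral_liminf_le' fun n => ?_
        exact ((((continuous_slice hu.contDiffOn.continuousOn hy).sub
          (continuous_slice hu.contDiffOn.continuousOn (ha0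
            n))).enorm).measurable.pow_const 2).aemeasurable
    _ ≤ ENNReal.ofReal y * gradientEnergy u := by
        refine liminf_le_of_frequently_le' (Eventually.frequently ?_)
        filter_upwards [hle] with n hn
        refine (QuatDirichlet.lintegral_enorm_sub_sq_le hu.contDiffOn_one (ha0 n) hn).trans ?_
        gcongr
        linarith [ha0 n]

/-- `f` is the slice at height `1` minus its difference from `f`. The first is in `L²` by the Hardy
bound, the second by finite energy. -/
theorem IsBoundaryFunction.memLp (hf : IsBoundaryFunction u f) (hu : MemDirichlet u) :
    MemLp f 2 volume := by
  have h1 := hu.memLp_slice one_pos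
  have hm := hf.aestronglyMeasurable hu
  have h2 : MemLp (fun x : E3 => u (pt x 1) - f x) 2 volume := by
    refine ⟨h1.1.sub hm, ?_⟩
    have h3 : eLpNorm (fun x : E3 => u (pt x 1) - f x) 2 volume ^ 2 < ⊤ := by
      rw [eLpNorm_two_sq]
      exact (hf.lintegral_enorm_sub_sq_le hu one_pos).trans_lt
        (ENNReal.mul_lt_top ENNReal.ofReal_lt_top hu.energy)
    exact (ENNReal.pow_lt_top_iff).mp h3 |>.resolve_right (by norm_num)
  have h4 := h1.sub h2
  refine h4.ae_eq (Eventually.of_forall fun x => ?_)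
  simp

end Boundary

/-! ### The Poisson integral on the Fourier side. -/

section PoissonIntegral

open scoped FourierTransform ENNReal

theorem poissonSymbol_nonneg (y : ℝ) (t : E3) : 0 ≤ poissonSymbol y t := (Real.exp_pos _).le

theorem poissonSymbol_le_one {y : ℝ} (hy : 0 ≤ y) (t : E3) : poissonSymbol y t ≤ 1 := by
  rw [poissonSymbol, Real.exp_le_one_iff, neg_nonpos]
  have := Real.pi_pos
  positivity

/-- The real part of the canonical extension is the Poisson integral. -/
theorem re_canonicalExtension_pt {f : E3 → ℝ} (hf : MemLp f 2 volume) (x : E3) {y : ℝ}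
    (hy : 0 < y) :
    (canonicalExtension f (pt x y)).re = ∫ t, poissonKernel y (x - t) * f t := by
  have hk := isHomKernel_quarticKernel quatConjL
  have hi := integrable_potential hf.1 continuous_pt_zero sub_pt_mem_upperHalf
    (contDiffOn_of_isHomKernel hk (n := 0)).continuousOn
    (locallyDominated_of_isHomKernel (by norm_num) hk hf) (pt_mem_upperHalf (x := x) hy)
  rw [re_canonicalExtension f _ hi, potential, ← integral_const_mul]
  congr 1
  ext t
  rw [pt_sub_pt, quarticKernel, quatReL_apply, re_pt, poissonKernel, ← norm_pt_sq, smul_eq_mul,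
    smul_eq_mul]
  have h0 : ‖pt (x - t) y‖ ≠ 0 :=
    norm_ne_zero_iff.mpr (ne_zero_of_mem_upperHalf (pt_mem_upperHalf hy))
  have := Real.pi_ne_zero
  field_simp

/-- `(1 + r)^(n+4) e^{-cr}` is bounded on the half-line, so the integrand is at most a multiple of
the integrable `(1 + |t|)⁻⁴`. -/
theorem integrable_norm_pow_mul_exp {c : ℝ} (hc : 0 < c) (n : ℕ) :
    Integrable (fun t : E3 => ‖t‖ ^ n * Real.exp (-(c * ‖t‖))) volume := by
  have h1 := integrable_one_add_norm (E := E3) (μ := volume) (r := 4) (by simp; norm_num)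
  obtain ⟨C, hC⟩ : ∃ C : ℝ, ∀ r : ℝ, 0 ≤ r → (1 + r) ^ (n + 4) * Real.exp (-(c * r)) ≤ C := by
    have h2 : Tendsto (fun r : ℝ => (1 + r) ^ (n + 4) * Real.exp (-(c * r))) atTop (𝓝 0) := by
      have h3 := (tendsto_rpow_mul_exp_neg_mul_atTop_nhds_zero (n + 4 : ℕ) c hc).comp
        (tendsto_atTop_add_const_left atTop (1 : ℝ) tendsto_id)
      have h4 := h3.const_mul (Real.exp c)
      rw [mul_zero] at h4
      refine h4.congr fun r => ?_
      simp only [Function.comp_apply, id]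
      rw [Real.rpow_natCast, mul_left_comm, ← Real.exp_add]
      congr 2
      ring
    have h3 : ContinuousOn (fun r : ℝ => (1 + r) ^ (n + 4) * Real.exp (-(c * r))) (Ici 0) := by
      fun_prop
    obtain ⟨R, hR⟩ := eventually_atTop.mp (h2.eventually (gt_mem_nhds one_pos))
    obtain ⟨C, hC⟩ := (isCompact_Icc (a := (0 : ℝ)) (b := R)).exists_bound_of_continuousOn
      (h3.mono Icc_subset_Ici_self)
    refine ⟨max C 1, fun r hr => ?_⟩
    rcases le_total R r with h | h
    · exact (hR r h).le.trans (le_max_right _ _)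
    · exact ((le_abs_self _).trans (hC r ⟨hr, h⟩)).trans (le_max_left _ _)
  refine (h1.const_mul C).mono' (Continuous.aestronglyMeasurable (by fun_prop))
    (Eventually.of_forall fun t => ?_)
  rw [Real.norm_of_nonneg (by positivity), Real.rpow_neg (by positivity), ← div_eq_mul_inv,
    le_div_iff₀ (by positivity)]
  refine le_trans ?_ (hC ‖t‖ (norm_nonneg t))
  have e : (1 + ‖t‖) ^ (4 : ℝ) = (1 + ‖t‖) ^ 4 := by norm_cast
  rw [e, pow_add, mul_right_comm]
  gcongr
  linarith

theorem integrable_norm_pow_mul_poissonSymbol {y : ℝ} (hy : 0 < y) (n : ℕ) :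
    Integrable (fun t : E3 => ‖t‖ ^ n * poissonSymbol y t) volume :=
  integrable_norm_pow_mul_exp (by positivity) n

theorem memLp_norm_pow_mul_poissonSymbol {y : ℝ} (hy : 0 < y) (n : ℕ) :
    MemLp (fun t : E3 => ‖t‖ ^ n * poissonSymbol y t) 2 volume := by
  refine (memLp_two_iff_integrable_sq (Continuous.aestronglyMeasurable ?_)).mpr ?_
  · have := continuous_poissonSymbol y
    fun_prop
  · refine (integrable_norm_pow_mul_poissonSymbol (show 0 < 2 * y by positivity) (2 * n)).congr
      (Eventually.of_forall fun t => ?_)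
    simp only [poissonSymbol]
    rw [mul_pow, ← Real.exp_nat_mul]
    push_cast
    ring_nf

theorem integrable_poissonSymbol {y : ℝ} (hy : 0 < y) :
    Integrable (fun t : E3 => (poissonSymbol y t : ℂ)) volume := by
  simpa using (integrable_norm_pow_mul_poissonSymbol hy 0).ofReal (𝕜 := ℂ)

theorem memLp_poissonSymbol {y : ℝ} (hy : 0 < y) :
    MemLp (fun t : E3 => (poissonSymbol y t : ℂ)) 2 volume := by
  simpa using (memLp_norm_pow_mul_poissonSymbol hy 0).ofReal (K := ℂ)

variable {f : E3 → ℝ}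

theorem memLp_ofReal (hf : MemLp f 2 volume) : MemLp (fun x => (f x : ℂ)) 2 volume :=
  hf.ofReal

theorem fourier_fourierL2 (hf : MemLp (fun x => (f x : ℂ)) 2 (volume : Measure E3)) :
    (𝓕 (fourierL2 f hf) : Lp ℂ 2 (volume : Measure E3)) = hf.toLp _ :=
  FourierTransform.fourier_fourierInv_eq _

/-- Fourier representation of the Poisson integral. -/
theorem re_canonicalExtension_eq_fourier (hf : MemLp f 2 volume) (x : E3) {y : ℝ} (hy : 0 < y) :
    ((canonicalExtension f (pt x y)).re : ℂ) =
      𝓕 (fun t => (poissonSymbol y t : ℂ) * fourierL2 f (memLp_ofReal hf) t) x := by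
  rw [← integral_fourier_mul_fourier_Lp (integrable_poissonSymbol hy) (memLp_poissonSymbol hy),
    re_canonicalExtension_pt hf x hy, ← integral_complex_ofReal, fourier_fourierL2]
  refine integral_congr_ae ?_
  filter_upwards [(memLp_ofReal hf).coeFn_toLp] with t ht
  rw [ht, fourier_poissonSymbol hy, Complex.ofReal_mul]

theorem memLp_poissonSymbol_mul {y : ℝ} (hy : 0 ≤ y) (g : Lp ℂ 2 (volume : Measure E3)) :
    MemLp (fun t => (poissonSymbol y t : ℂ) * g t) 2 volume := by
  have hm : AEStronglyMeasurable (fun t => (poissonSymbol y t : ℂ) * g t) volume :=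
    (Complex.continuous_ofReal.comp (continuous_poissonSymbol y)).aestronglyMeasurable.mul
      (Lp.memLp g).1
  refine (Lp.memLp g).mono hm (Eventually.of_forall fun t => ?_)
  rw [norm_mul, Complex.norm_of_nonneg (poissonSymbol_nonneg y t)]
  exact mul_le_of_le_one_left (norm_nonneg _) (poissonSymbol_le_one hy t)

theorem integrable_poissonSymbol_mul {y : ℝ} (hy : 0 < y) (g : Lp ℂ 2 (volume : Measure E3)) :
    Integrable (fun t => (poissonSymbol y t : ℂ) * g t) volume :=
  (memLp_poissonSymbol hy).integrable_mul (Lp.memLp g)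

theorem enorm_ofReal (r : ℝ) : ‖(r : ℂ)‖ₑ = ‖r‖ₑ := by
  rw [← ofReal_norm, ← ofReal_norm, Complex.norm_real]

theorem lintegral_enorm_sq_poisson_le (hf : MemLp f 2 volume) {y : ℝ} (hy : 0 < y) :
    ∫⁻ x : E3, ‖(canonicalExtension f (pt x y)).re‖ₑ ^ 2 ≤
      ∫⁻ t, ‖fourierL2 f (memLp_ofReal hf) t‖ₑ ^ 2 := by
  simp only [← enorm_ofReal, re_canonicalExtension_eq_fourier hf _ hy]
  rw [lintegral_enorm_sq_fourier (integrable_poissonSymbol_mul hy _)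
    (memLp_poissonSymbol_mul hy.le _)]
  refine lintegral_mono fun t => ?_
  simp only [enorm_mul]
  gcongr
  refine mul_le_of_le_one_left' ?_
  rw [enorm_ofReal, Real.enorm_of_nonneg (poissonSymbol_nonneg y t)]
  exact ENNReal.ofReal_le_one.mpr (poissonSymbol_le_one hy.le t)

theorem lintegral_enorm_sq_poisson_sub (hf : MemLp f 2 volume) {y : ℝ} (hy : 0 < y) :
    ∫⁻ x : E3, ‖(canonicalExtension f (pt x y)).re - f x‖ₑ ^ 2 =
      ∫⁻ t, ‖((poissonSymbol y t : ℂ) - 1) * fourierL2 f (memLp_ofReal hf) t‖ₑ ^ 2 := by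
  set g := fourierL2 f (memLp_ofReal hf) with hg
  have h2 := memLp_poissonSymbol_mul hy.le g
  have hF := fourier_toLp_ae_eq (integrable_poissonSymbol_mul hy g) h2
  have h1 : ∀ᵐ x : E3, (((canonicalExtension f (pt x y)).re - f x : ℝ) : ℂ) =
      (𝓕 (h2.toLp _ - g) : Lp ℂ 2 (volume : Measure E3)) x := by
    have e : (𝓕 (h2.toLp _ - g) : Lp ℂ 2 (volume : Measure E3)) = 𝓕 (h2.toLp _) - 𝓕 g :=
      map_sub (Lp.fourierTransformₗᵢ E3 ℂ) _ g
    have e' : (𝓕 g : Lp ℂ 2 (volume : Measure E3)) = (memLp_ofReal hf).toLp _ :=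
      fourier_fourierL2 _
    rw [e, e']
    filter_upwards [hF, Lp.coeFn_sub (𝓕 (h2.toLp _)) ((memLp_ofReal hf).toLp _),
      (memLp_ofReal hf).coeFn_toLp] with x hx hx' hx''
    rw [hx', Pi.sub_apply, hx, hx'', Complex.ofReal_sub, re_canonicalExtension_eq_fourier hf _ hy]
  simp only [← enorm_ofReal]
  rw [lintegral_congr_ae (h1.mono fun x hx => by rw [hx]), lintegral_enorm_sq_fourier_Lp]
  refine lintegral_congr_ae ?_
  filter_upwards [Lp.coeFn_sub (h2.toLp _) g, h2.coeFn_toLp] with t ht ht'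
  rw [ht, Pi.sub_apply, ht', sub_mul, one_mul]

/-- Plancherel turns the difference into the multiplier `e^{-2πy|t|} - 1`, bounded by `1` and
tending pointwise to `0`; dominated convergence concludes. -/
theorem tendsto_lintegral_enorm_sq_poisson_sub (hf : MemLp f 2 volume) :
    Tendsto (fun y : ℝ => ∫⁻ x : E3, ‖(canonicalExtension f (pt x y)).re - f x‖ₑ ^ 2)
      (𝓝[>] 0) (𝓝 0) := by
  set g := fourierL2 f (memLp_ofReal hf) with hg
  have h1 : Tendsto (fun y : ℝ => ∫⁻ t, ‖((poissonSymbol y t : ℂ) - 1) * g t‖ₑ ^ 2)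
      (𝓝[>] 0) (𝓝 (∫⁻ _ : E3, 0)) := by
    refine tendsto_lintegral_filter_of_dominated_convergence' (fun t => ‖g t‖ₑ ^ 2) ?_ ?_ ?_ ?_
    · refine Eventually.of_forall fun y => ?_
      have : AEStronglyMeasurable (fun t => ((poissonSymbol y t : ℂ) - 1) * g t) volume :=
        ((Complex.continuous_ofReal.comp (continuous_poissonSymbol y)).sub
          continuous_const).aestronglyMeasurable.mul (Lp.memLp g).1
      exact this.enorm.pow_const 2
    · filter_upwards [self_mem_nhdsWithin] with y hy
      refine Eventually.of_forall fun t => ?_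
      have hy : 0 < y := hy
      gcongr
      rw [enorm_mul]
      refine mul_le_of_le_one_left' ?_
      rw [← Complex.ofReal_one, ← Complex.ofReal_sub, enorm_ofReal, ← ofReal_norm]
      refine ENNReal.ofReal_le_one.mpr ?_
      rw [Real.norm_eq_abs, abs_le]
      constructor <;> linarith [poissonSymbol_nonneg y t, poissonSymbol_le_one hy.le t]
    · rw [← lintegral_enorm_sq_fourier_Lp, hg, fourier_fourierL2, lintegral_enorm_sq_toLp,
        ← eLpNorm_two_sq]
      exact (ENNReal.pow_lt_top (memLp_ofReal hf).2).ne
    · refine Eventually.of_forall fun t => ?_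
      have hc : Continuous fun y : ℝ => ‖((poissonSymbol y t : ℂ) - 1) * g t‖ₑ ^ 2 := by
        refine (ENNReal.continuous_pow 2).comp (continuous_enorm.comp ?_)
        unfold poissonSymbol
        fun_prop
      have h := (hc.tendsto 0).mono_left (nhdsWithin_le_nhds (s := Ioi 0))
      simpa [poissonSymbol] using h
  rw [lintegral_zero] at h1
  refine h1.congr' ?_
  filter_upwards [self_mem_nhdsWithin] with y hy
  exact (lintegral_enorm_sq_poisson_sub hf hy).symm

end PoissonIntegral

/-! ### Uniqueness for harmonic functions with `L²` slices. -/

section Uniqueness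

open scoped ENNReal

theorem fderiv_fderiv_sub_const_mul {E : Type*} [NormedAddCommGroup E] [NormedSpace ℝ E]
    {U : Set E} (hU : IsOpen U) {u p w : E → ℝ} (hu : ContDiffOn ℝ 2 u U)
    (hp : ContDiffOn ℝ 2 p U) {c : ℝ} (hw : ∀ q ∈ U, w q = u q - c * p q) {q : E} (hq : q ∈ U) :
    fderiv ℝ (fderiv ℝ w) q = fderiv ℝ (fderiv ℝ u) q - c • fderiv ℝ (fderiv ℝ p) q := by
  have hd : ∀ {v : E → ℝ}, ContDiffOn ℝ 2 v U → ∀ x ∈ U, HasFDerivAt v (fderiv ℝ v x) x :=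
    fun hv x hx => ((hv.differentiableOn (by norm_num)).differentiableAt
      (hU.mem_nhds hx)).hasFDerivAt
  have hd2 : ∀ {v : E → ℝ}, ContDiffOn ℝ 2 v U →
      HasFDerivAt (fderiv ℝ v) (fderiv ℝ (fderiv ℝ v) q) q := fun hv =>
    (((hv.fderiv_of_isOpen (m := 1) hU (by norm_num)).differentiableOn
      (by norm_num)).differentiableAt (hU.mem_nhds hq)).hasFDerivAt
  have h1 : ∀ x ∈ U, fderiv ℝ w x = fderiv ℝ u x - c • fderiv ℝ p x := fun x hx =>
    (((hd hu x hx).sub ((hd hp x hx).const_mul c)).congr_of_eventuallyEq (by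
      filter_upwards [hU.mem_nhds hx] with z hz using hw z hz)).fderiv
  refine (((hd2 hu).sub ((hd2 hp).const_smul c)).congr_of_eventuallyEq ?_).fderiv
  filter_upwards [hU.mem_nhds hq] with z hz using h1 z hz

theorem continuousOn_fderiv_fderiv {E V : Type*} [NormedAddCommGroup E] [NormedSpace ℝ E]
    [NormedAddCommGroup V] [NormedSpace ℝ V] {U : Set E} {k : E → V} (hU : IsOpen U)
    (hk : ContDiffOn ℝ 2 k U) : ContinuousOn (fderiv ℝ (fderiv ℝ k)) U :=
  (hk.fderiv_of_isOpen (m := 1) hU (by norm_num)).continuousOn_fderiv_of_isOpen hU le_rfl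

theorem locallyDominated_fderiv_fderiv {E V : Type*} [NormedAddCommGroup E] [NormedSpace ℝ E]
    [NormedAddCommGroup V] [NormedSpace ℝ V] [ProperSpace E] {U : Set E} {s : E3 → E} {k : E → V}
    {f : E3 → ℝ} (hU : IsOpen U) (hs : Continuous s) (hsU : ∀ q ∈ U, ∀ t, q - s t ∈ U)
    (hk : ContDiffOn ℝ 2 k U) (hf : Continuous f) (hc : HasCompactSupport f) :
    LocallyDominated f s U (fderiv ℝ (fderiv ℝ k)) :=
  locallyDominated_of_hasCompactSupport hU hs hsU (continuousOn_fderiv_fderiv hU hk) hf hc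

theorem lintegral_mul_sq_le {α : Type*} [MeasurableSpace α] {μ : Measure α} {f g : α → ℝ≥0∞}
    (hf : AEMeasurable f μ) (hg : AEMeasurable g μ) :
    (∫⁻ x, f x * g x ∂μ) ^ 2 ≤ (∫⁻ x, f x ^ 2 ∂μ) * ∫⁻ x, g x ^ 2 ∂μ := by
  have h := ENNReal.lintegral_mul_le_Lp_mul_Lq μ Real.HolderConjugate.two_two hf hg
  simp only [Pi.mul_apply] at h
  calc (∫⁻ x, f x * g x ∂μ) ^ 2
      ≤ ((∫⁻ x, f x ^ (2 : ℝ) ∂μ) ^ (1 / 2 : ℝ) * (∫⁻ x, g x ^ (2 : ℝ) ∂μ) ^ (1 / 2 : ℝ)) ^ 2 := by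
        gcongr
    _ = (∫⁻ x, f x ^ 2 ∂μ) * ∫⁻ x, g x ^ 2 ∂μ := by
      rw [mul_pow, ← ENNReal.rpow_natCast, ← ENNReal.rpow_natCast, ← ENNReal.rpow_mul,
        ← ENNReal.rpow_mul]
      simp

/-- Cauchy-Schwarz and translation invariance: after averaging against `ψ`, `L²` control of a slice
becomes control uniform in `x`, as the maximum principle requires. -/
theorem enorm_potential_sq_le {w : Quaternion ℝ → ℝ} (hw : ContinuousOn w upperHalf) {ψ : E3 → ℝ}
    (hψ : Continuous ψ) (x : E3) {y : ℝ} (hy : 0 < y) :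
    ‖potential ψ (fun t => pt t 0) w (pt x y)‖ₑ ^ 2 ≤
      (∫⁻ t, ‖ψ t‖ₑ ^ 2) * ∫⁻ t : E3, ‖w (pt t y)‖ₑ ^ 2 := by
  have hc := continuous_slice hw hy
  have e : potential ψ (fun t => pt t 0) w (pt x y) = ∫ t, ψ t * w (pt (x - t) y) := by
    simp only [potential, pt_sub_pt, smul_eq_mul]
  rw [e, ← lintegral_sub_left_eq_self (fun t : E3 => ‖w (pt t y)‖ₑ ^ 2) x]
  refine le_trans ?_ (lintegral_mul_sq_le hψ.enorm.measurable.aemeasurable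
    (hc.comp (continuous_const.sub continuous_id)).enorm.measurable.aemeasurable)
  gcongr
  refine (enorm_integral_le_lintegral_enorm _).trans (le_of_eq ?_)
  simp only [enorm_mul]

theorem twiceDiffHarmonic_potential {w : Quaternion ℝ → ℝ} (hw : ContDiffOn ℝ 2 w upperHalf)
    (h0 : ∀ q ∈ upperHalf, quatTrace (fderiv ℝ (fderiv ℝ w) q) = 0) {ψ : E3 → ℝ}
    (hψ : Continuous ψ) (hc : HasCompactSupport ψ) :
    TwiceDiffHarmonic (potential ψ (fun t => pt t 0) w) := by
  have hw1 : ContDiffOn ℝ 1 (fderiv ℝ w) upperHalf :=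
    hw.fderiv_of_isOpen isOpen_upperHalf (by norm_num)
  have hm : AEStronglyMeasurable ψ volume := hψ.aestronglyMeasurable
  have d0 := locallyDominated_of_hasCompactSupport isOpen_upperHalf continuous_pt_zero
    sub_pt_mem_upperHalf hw.continuousOn hψ hc
  have d1 := locallyDominated_of_hasCompactSupport isOpen_upperHalf continuous_pt_zero
    sub_pt_mem_upperHalf hw1.continuousOn hψ hc
  have d2 := locallyDominated_fderiv_fderiv isOpen_upperHalf continuous_pt_zero
    sub_pt_mem_upperHalf hw hψ hc
  have h2 := fun q hq => hasFDerivAt_fderiv_potential isOpen_upperHalf hm continuous_pt_zero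
    sub_pt_mem_upperHalf hw d0 d1 d2 (q := q) hq
  refine ⟨fun q hq => (hasFDerivAt_potential isOpen_upperHalf hm continuous_pt_zero
    sub_pt_mem_upperHalf (hw.of_le (by norm_num)) d0 d1 hq).differentiableAt,
    fun q hq => (h2 q hq).differentiableAt, fun q hq => ?_⟩
  have h3 := clm_potential_eq_zero hm continuous_pt_zero sub_pt_mem_upperHalf
    (continuousOn_fderiv_fderiv isOpen_upperHalf hw) d2 quatTraceL h0 hq
  rw [← (h2 q hq).fderiv] at h3
  exact h3

/-- A harmonic function whose slices are bounded in `L²` and tend to zero in `L²` at the boundary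
vanishes. -/
theorem eq_zero_of_tendsto_lintegral {w : Quaternion ℝ → ℝ} (hw : ContDiffOn ℝ 2 w upperHalf)
    (h0 : ∀ q ∈ upperHalf, quatTrace (fderiv ℝ (fderiv ℝ w) q) = 0) {M : ℝ≥0∞} (hM : M ≠ ⊤)
    (hb : ∀ y : ℝ, 0 < y → ∫⁻ t : E3, ‖w (pt t y)‖ₑ ^ 2 ≤ M)
    (hlim : Tendsto (fun y : ℝ => ∫⁻ t : E3, ‖w (pt t y)‖ₑ ^ 2) (𝓝[>] 0) (𝓝 0))
    {q : Quaternion ℝ} (hq : q ∈ upperHalf) : w q = 0 := by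
  have key : ∀ ψ : E3 → ℝ, Continuous ψ → HasCompactSupport ψ → ∀ q ∈ upperHalf,
      potential ψ (fun t => pt t 0) w q = 0 := by
    intro ψ hψ hc q hq
    set A := ∫⁻ t, ‖ψ t‖ₑ ^ 2 with hA
    have hA' : A ≠ ⊤ := by
      rw [hA, ← eLpNorm_two_sq]
      exact (ENNReal.pow_lt_top (hψ.memLp_of_hasCompactSupport hc).2).ne
    have hle : ∀ q ∈ upperHalf, ‖potential ψ (fun t => pt t 0) w q‖ₑ ^ 2 ≤
        A * ∫⁻ t : E3, ‖w (pt t q.re)‖ₑ ^ 2 := fun q hq =>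
      enorm_potential_sq_le hw.continuousOn hψ !₂[q.imI, q.imJ, q.imK] hq
    have hsq : ∀ r : ℝ, ‖r‖ₑ ^ 2 = ENNReal.ofReal (|r| ^ 2) := fun r => by
      rw [ENNReal.ofReal_pow (abs_nonneg r), ← Real.norm_eq_abs, ofReal_norm]
    -- The estimate bounds the square of the potential, and `|r| ≤ r² + 1` turns this into a bound
    -- on its absolute value.
    refine (twiceDiffHarmonic_potential hw h0 hψ hc).eq_zero (M := (A * M).toReal + 1)
      (fun q hq => ?_) (fun ε hε => ?_) hq
    · have h1 := (hle q hq).trans (mul_le_mul' le_rfl (hb q.re hq))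
      rw [hsq, ENNReal.ofReal_le_iff_le_toReal (ENNReal.mul_ne_top hA' hM)] at h1
      nlinarith [sq_nonneg (|potential ψ (fun t => pt t 0) w q| - 1 / 2)]
    · have h1 : Tendsto (fun y : ℝ => A * ∫⁻ t : E3, ‖w (pt t y)‖ₑ ^ 2) (𝓝[>] 0) (𝓝 0) := by
        simpa using ENNReal.Tendsto.const_mul hlim (Or.inr hA')
      have h2 := h1.eventually
        (gt_mem_nhds (show (0 : ℝ≥0∞) < ENNReal.ofReal (ε ^ 2) by simpa using pow_pos hε 2))
      obtain ⟨δ, hδ, h3⟩ := (mem_nhdsGT_iff_exists_Ioo_subset).mp h2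
      refine ⟨δ, hδ, fun q hq hqδ => ?_⟩
      have h4 := (hle q hq).trans (le_of_lt (h3 ⟨hq, hqδ⟩))
      rw [hsq, ENNReal.ofReal_le_ofReal_iff (by positivity)] at h4
      exact abs_le_of_sq_le_sq' h4 hε.le |>.2
  have hy : 0 < q.re := hq
  -- Above the origin the potential pairs `ψ` with the reflected slice. Vanishing for every test
  -- function kills the slice almost everywhere, and by continuity everywhere.
  have hc : Continuous fun t : E3 => w (pt (-t) q.re) :=
    (continuous_slice hw.continuousOn hy).comp continuous_neg
  have hae : ∀ᵐ t : E3, w (pt (-t) q.re) = 0 := by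
    refine ae_eq_zero_of_integral_contDiff_smul_eq_zero hc.locallyIntegrable fun ψ hψ hψc => ?_
    have h := key ψ hψ.continuous hψc (pt 0 q.re) hy
    simpa only [potential, pt_sub_pt, zero_sub] using h
  have h1 := congrFun ((Continuous.ae_eq_iff_eq volume hc continuous_const).mp hae)
    (-!₂[q.imI, q.imJ, q.imK])
  rw [neg_neg] at h1
  exact h1

end Uniqueness

/-! ### `u` is the real part of its Cauchy integral. -/

section Representation

open scoped ENNReal

variable {u : Quaternion ℝ → ℝ} {f : E3 → ℝ}

theorem lintegral_enorm_sub_sq_le_add {α : Type*} [MeasurableSpace α] {μ : Measure α}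
    {a b : α → ℝ} (hb : AEStronglyMeasurable b μ) :
    ∫⁻ x, ‖a x - b x‖ₑ ^ 2 ∂μ ≤ 2 * (∫⁻ x, ‖a x‖ₑ ^ 2 ∂μ + ∫⁻ x, ‖b x‖ₑ ^ 2 ∂μ) := by
  rw [← lintegral_add_right' _ (hb.enorm.pow_const 2), ← lintegral_const_mul' _ _ (by norm_num)]
  refine lintegral_mono fun x => ?_
  have h1 : ∀ r : ℝ, ‖r‖ₑ ^ 2 = ENNReal.ofReal (r ^ 2) := fun r => by
    rw [← sq_abs, ENNReal.ofReal_pow (abs_nonneg r), ← Real.norm_eq_abs, ofReal_norm]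
  simp only [h1]
  rw [← ENNReal.ofReal_add (sq_nonneg _) (sq_nonneg _),
    show (2 : ℝ≥0∞) = ENNReal.ofReal 2 by simp, ← ENNReal.ofReal_mul (by norm_num)]
  exact ENNReal.ofReal_le_ofReal (by nlinarith [sq_nonneg (a x + b x)])

theorem contDiffOn_re_canonicalExtension (hf : MemLp f 2 volume) :
    ContDiffOn ℝ 2 (fun q => (canonicalExtension f q).re) upperHalf :=
  quatReL.contDiff.comp_contDiffOn (contDiffOn_canonicalExtension hf)

theorem quatTrace_sub_smul (S T : Quaternion ℝ →L[ℝ] Quaternion ℝ →L[ℝ] ℝ) (c : ℝ) :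
    quatTrace (S - c • T) = quatTrace S - c * quatTrace T :=
  (map_sub quatTraceL _ _).trans (congrArg _ (quatTraceL.map_smul c T))

/-- A function of the Dirichlet space is the real part of its canonical extension. -/
theorem IsBoundaryFunction.re_canonicalExtension_eq (hf : IsBoundaryFunction u f)
    (hu : MemDirichlet u) {q : Quaternion ℝ} (hq : q ∈ upperHalf) :
    (canonicalExtension f q).re = u q := by
  have hf2 := hf.memLp hu
  have hP := contDiffOn_re_canonicalExtension hf2
  have hc : ∀ y : ℝ, 0 < y → Continuous fun t : E3 => (canonicalExtension f (pt t y)).re :=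
    fun y hy => continuous_slice hP.continuousOn hy
  have hk := isHomKernel_quarticKernel quatConjL
  have hrep : ∀ q ∈ upperHalf, u q - (canonicalExtension f q).re =
      u q - (1 / Real.pi ^ 2) * potential f (fun t => pt t 0) (quarticKernel quatReL) q :=
    fun q hq => by
      rw [re_canonicalExtension f q (integrable_potential hf2.1 continuous_pt_zero
        sub_pt_mem_upperHalf (contDiffOn_of_isHomKernel hk (n := 0)).continuousOn
        (locallyDominated_of_isHomKernel (by norm_num) hk hf2) hq)]
  have hG : ∫⁻ t, ‖fourierL2 f (memLp_ofReal hf2) t‖ₑ ^ 2 ≠ ⊤ := by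
    rw [← eLpNorm_two_sq]
    exact (ENNReal.pow_lt_top (Lp.memLp _).2).ne
  have hlim : Tendsto (fun y : ℝ => ENNReal.ofReal y * gradientEnergy u) (𝓝[>] 0) (𝓝 0) := by
    have h1 := ENNReal.Tendsto.mul_const (b := gradientEnergy u)
      ((ENNReal.continuous_ofReal.tendsto 0).mono_left (nhdsWithin_le_nhds (s := Ioi 0)))
      (Or.inr hu.energy.ne)
    simpa using h1
  refine (sub_eq_zero.mp (eq_zero_of_tendsto_lintegral
    (w := fun q => u q - (canonicalExtension f q).re) (hu.contDiffOn.sub hP) (fun q hq => ?_)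
    (M := 2 * (hardyNorm u ^ 2 + ∫⁻ t, ‖fourierL2 f (memLp_ofReal hf2) t‖ₑ ^ 2)) ?_
    (fun y hy => ?_) ?_ hq)).symm
  · rw [fderiv_fderiv_sub_const_mul isOpen_upperHalf hu.contDiffOn
      (contDiffOn_two_quarticPotential hf2 quatReL) hrep hq, quatTrace_sub_smul,
      quatTrace_fderiv_fderiv_poissonPotential hf2 hq, ← laplacian_eq_quatTrace,
      (hu.harmonic q hq).2.self_of_nhds]
    simp
  · refine ENNReal.mul_ne_top (by norm_num) (ENNReal.add_ne_top.mpr ⟨?_, hG⟩)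
    exact (ENNReal.pow_lt_top hu.hardy).ne
  · refine (lintegral_enorm_sub_sq_le_add (hc y hy).aestronglyMeasurable).trans ?_
    refine mul_le_mul' le_rfl (add_le_add ?_ (lintegral_enorm_sq_poisson_le hf2 hy))
    rw [← eLpNorm_two_sq]
    gcongr
    exact eLpNorm_slice_le_hardyNorm u hy
  · have h2 : Tendsto (fun y : ℝ => 2 * (ENNReal.ofReal y * gradientEnergy u +
        ∫⁻ x : E3, ‖(canonicalExtension f (pt x y)).re - f x‖ₑ ^ 2)) (𝓝[>] 0) (𝓝 0) := by
      simpa using ENNReal.Tendsto.const_mul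
        (hlim.add (tendsto_lintegral_enorm_sq_poisson_sub hf2)) (Or.inr (by norm_num))
    refine tendsto_of_tendsto_of_tendsto_of_le_of_le' tendsto_const_nhds h2
      (Eventually.of_forall fun _ => zero_le) ?_
    filter_upwards [self_mem_nhdsWithin] with y hy
    have h3 := lintegral_enorm_sub_sq_le_add (μ := volume) (a := fun x : E3 => u (pt x y) - f x)
      (b := fun x : E3 => (canonicalExtension f (pt x y)).re - f x)
      ((hc y hy).aestronglyMeasurable.sub hf2.1)
    simp only [sub_sub_sub_cancel_right] at h3
    refine h3.trans ?_
    gcongr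
    exact hf.lintegral_enorm_sub_sq_le hu hy

end Representation

/-! ### The Dirichlet energy by Plancherel on horizontal slices. -/

section Energy

open scoped ENNReal FourierTransform RealInnerProductSpace

variable (g : Lp ℂ 2 (volume : Measure E3))

theorem integrable_norm_mul_poissonSymbol_mul {y : ℝ} (hy : 0 < y) :
    Integrable (fun t => ((‖t‖ * poissonSymbol y t : ℝ) : ℂ) * g t) volume := by
  have h : MemLp (fun t : E3 => ((‖t‖ * poissonSymbol y t : ℝ) : ℂ)) 2 volume := by
    simpa using (memLp_norm_pow_mul_poissonSymbol hy 1).ofReal (K := ℂ)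
  exact h.integrable_mul (Lp.memLp g)

theorem memLp_norm_mul_poissonSymbol_mul {y : ℝ} (hy : 0 < y) :
    MemLp (fun t => ((‖t‖ * poissonSymbol y t : ℝ) : ℂ) * g t) 2 volume := by
  have hm : AEStronglyMeasurable (fun t => ((‖t‖ * poissonSymbol y t : ℝ) : ℂ) * g t) volume := by
    refine AEStronglyMeasurable.mul (Continuous.aestronglyMeasurable ?_) (Lp.memLp g).1
    exact Complex.continuous_ofReal.comp (continuous_norm.mul (continuous_poissonSymbol y))
  -- The multiplier satisfies `|t| e^{-2πy|t|} ≤ 1/(2πy)`, a consequence of `1 + s ≤ e^s`.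
  refine MemLp.of_le_mul (c := (2 * Real.pi * y)⁻¹) (Lp.memLp g) hm
    (Eventually.of_forall fun t => ?_)
  rw [norm_mul, Complex.norm_real, Real.norm_of_nonneg
    (mul_nonneg (norm_nonneg _) (poissonSymbol_nonneg y t))]
  gcongr
  have hp : 0 < 2 * Real.pi * y := by have := Real.pi_pos; positivity
  rw [inv_eq_one_div, le_div_iff₀ hp, poissonSymbol, mul_right_comm, ← le_div_iff₀ (Real.exp_pos _),
    Real.exp_neg, one_div, inv_inv]
  linarith [Real.add_one_le_exp (2 * Real.pi * y * ‖t‖)]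

/-- Vertical derivative of the Poisson integral. -/
theorem hasDerivAt_fourier_poissonSymbol (x : E3) {y : ℝ} (hy : 0 < y) :
    HasDerivAt (fun y : ℝ => 𝓕 (fun t => (poissonSymbol y t : ℂ) * g t) x)
      (𝓕 (fun t => -(2 * Real.pi : ℂ) * (((‖t‖ * poissonSymbol y t : ℝ) : ℂ) * g t)) x) y := by
  simp only [Real.fourier_eq]
  have hmeas : ∀ h : E3 → ℂ, AEStronglyMeasurable h volume →
      AEStronglyMeasurable (fun t => Real.fourierChar (-⟪t, x⟫) • h t) volume := fun h hh =>
    (Continuous.aestronglyMeasurable (by fun_prop)).smul hh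
  have hpos : 0 < y / 2 := half_pos hy
  refine (hasDerivAt_integral_of_dominated_loc_of_deriv_le (Metric.ball_mem_nhds y hpos)
    -- Heights within `y / 2` of `y` are at least `y / 2`, and the symbol decreases with height.
    (bound := fun t => ‖(2 * Real.pi : ℂ) * (((‖t‖ * poissonSymbol (y / 2) t : ℝ) : ℂ) * g t)‖)
    (F' := fun y t => Real.fourierChar (-⟪t, x⟫) •
      (-(2 * Real.pi : ℂ) * (((‖t‖ * poissonSymbol y t : ℝ) : ℂ) * g t)))
    ?_ ?_ ?_ ?_ ?_ ?_).2
  · filter_upwards [Ioi_mem_nhds hy] with z hz using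
      hmeas _ (integrable_poissonSymbol_mul hz g).1
  · exact (Real.fourierIntegral_convergent_iff x).mpr (integrable_poissonSymbol_mul hy g)
  · exact hmeas _ ((integrable_norm_mul_poissonSymbol_mul g hy).const_mul _).1
  · refine Eventually.of_forall fun t z hz => ?_
    rw [Circle.norm_smul, norm_mul, norm_neg, norm_mul (2 * Real.pi : ℂ)]
    refine mul_le_mul_of_nonneg_left ?_ (norm_nonneg _)
    rw [norm_mul, norm_mul, Complex.norm_real, Complex.norm_real,
      Real.norm_of_nonneg (mul_nonneg (norm_nonneg _) (poissonSymbol_nonneg _ t)),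
      Real.norm_of_nonneg (mul_nonneg (norm_nonneg _) (poissonSymbol_nonneg _ t))]
    have hz' : y / 2 ≤ z := by
      rw [Metric.mem_ball, Real.dist_eq, abs_lt] at hz
      linarith [hz.1]
    gcongr
    unfold poissonSymbol
    gcongr
  · exact ((integrable_norm_mul_poissonSymbol_mul g hpos).const_mul _).norm
  · refine Eventually.of_forall fun t z _ => ?_
    have h1 : HasDerivAt (fun z : ℝ => poissonSymbol z t)
        (-(2 * Real.pi) * (‖t‖ * poissonSymbol z t)) z := by
      have h2 : HasDerivAt (fun z : ℝ => -(2 * Real.pi * z * ‖t‖)) (-(2 * Real.pi * 1 * ‖t‖)) z :=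
        (((hasDerivAt_id z).const_mul (2 * Real.pi)).mul_const ‖t‖).neg
      refine h2.exp.congr_deriv ?_
      rw [poissonSymbol]
      ring
    have h3 := (h1.ofReal_comp.mul_const (g t)).const_smul (Real.fourierChar (-⟪t, x⟫))
    refine h3.congr_deriv ?_
    push_cast
    congr 1
    ring

/-- Horizontal derivatives of the Poisson integral. -/
theorem hasFDerivAt_fourier_poissonSymbol {y : ℝ} (hy : 0 < y) (x : E3) :
    ∃ T : E3 →L[ℝ] ℂ, HasFDerivAt (𝓕 (fun t => (poissonSymbol y t : ℂ) * g t)) T x ∧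
      ∀ e : E3, T e = 𝓕 (fun t => -(2 * Real.pi * Complex.I) *
        ((⟪t, e⟫ : ℂ) * ((poissonSymbol y t : ℂ) * g t))) x := by
  have h1 : Integrable (fun t => ‖t‖ * ‖(poissonSymbol y t : ℂ) * g t‖) volume := by
    refine (integrable_norm_mul_poissonSymbol_mul g hy).norm.congr (Eventually.of_forall fun t => ?_)
    simp [mul_assoc]
  have h0 := integrable_poissonSymbol_mul hy g
  refine ⟨_, Real.hasFDerivAt_fourier h0 h1 x, fun e => ?_⟩
  have h2 : Integrable (VectorFourier.fourierSMulRight (innerSL ℝ)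
      fun t => (poissonSymbol y t : ℂ) * g t) volume :=
    (h1.const_mul (2 * Real.pi * ‖innerSL (E := E3) ℝ‖)).mono' h0.1.fourierSMulRight
      (Eventually.of_forall fun t =>
        (VectorFourier.norm_fourierSMulRight_le _ _ t).trans_eq (mul_assoc _ _ _))
  rw [Real.fourier_continuousLinearMap_apply h2]
  rfl

theorem enorm_sq_eq_ofReal {G : Type*} [SeminormedAddCommGroup G] (z : G) :
    ‖z‖ₑ ^ 2 = ENNReal.ofReal (‖z‖ ^ 2) := by
  rw [ENNReal.ofReal_pow (norm_nonneg z), ofReal_norm]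

theorem norm_mul_norm_mul_sq (a b c : ℝ) (z : ℂ) :
    ‖(a : ℂ) * (((b * c : ℝ) : ℂ) * z)‖ ^ 2 = a ^ 2 * b ^ 2 * c ^ 2 * ‖z‖ ^ 2 := by
  rw [norm_mul, norm_mul, Complex.norm_real, Complex.norm_real, mul_pow, mul_pow, Real.norm_eq_abs,
    Real.norm_eq_abs, sq_abs, sq_abs]
  ring

variable {g} {u : Quaternion ℝ → ℝ}

/-- By uniqueness of derivatives, `∂_y u` is the Fourier transform of `-2π|t| e^{-2πy|t|} g`; then
Plancherel. -/
theorem lintegral_fderiv_one_sq (hu : ContDiffOn ℝ 1 u upperHalf)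
    (hrep : ∀ x : E3, ∀ y : ℝ, 0 < y →
      (u (pt x y) : ℂ) = 𝓕 (fun t => (poissonSymbol y t : ℂ) * g t) x) {y : ℝ} (hy : 0 < y) :
    ∫⁻ x : E3, ENNReal.ofReal (fderiv ℝ u (pt x y) 1 ^ 2) =
      ∫⁻ t, ENNReal.ofReal ((2 * Real.pi) ^ 2 * ‖t‖ ^ 2 * poissonSymbol y t ^ 2 * ‖g t‖ ^ 2) := by
  have key : ∀ x : E3, ((fderiv ℝ u (pt x y) 1 : ℝ) : ℂ) =
      𝓕 (fun t => -(2 * Real.pi : ℂ) * (((‖t‖ * poissonSymbol y t : ℝ) : ℂ) * g t)) x := by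
    intro x
    have h1 : HasFDerivAt u (fderiv ℝ u (pt x y)) (pt x y) :=
      ((hu.differentiableOn (by norm_num)).differentiableAt
        (isOpen_upperHalf.mem_nhds (pt_mem_upperHalf hy))).hasFDerivAt
    have h2 := (h1.comp_hasDerivAt y (hasDerivAt_pt_right x y)).ofReal_comp
    refine h2.unique ((hasDerivAt_fourier_poissonSymbol g x hy).congr_of_eventuallyEq ?_)
    filter_upwards [Ioi_mem_nhds hy] with z hz using hrep x z hz
  have h3 : ∀ x : E3, ENNReal.ofReal (fderiv ℝ u (pt x y) 1 ^ 2) =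
      ‖𝓕 (fun t => -(2 * Real.pi : ℂ) * (((‖t‖ * poissonSymbol y t : ℝ) : ℂ) * g t)) x‖ₑ ^ 2 := by
    intro x
    rw [← key, enorm_sq_eq_ofReal, Complex.norm_real, Real.norm_eq_abs, sq_abs]
  simp only [h3]
  rw [lintegral_enorm_sq_fourier ((integrable_norm_mul_poissonSymbol_mul g hy).const_mul _)
    ((memLp_norm_mul_poissonSymbol_mul g hy).const_mul _)]
  refine lintegral_congr fun t => ?_
  rw [enorm_sq_eq_ofReal, neg_mul, norm_neg, ← norm_mul_norm_mul_sq]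
  push_cast
  rfl

theorem lintegral_fderiv_pt_zero_sq (hu : ContDiffOn ℝ 1 u upperHalf)
    (hrep : ∀ x : E3, ∀ y : ℝ, 0 < y →
      (u (pt x y) : ℂ) = 𝓕 (fun t => (poissonSymbol y t : ℂ) * g t) x) {y : ℝ} (hy : 0 < y)
    (e : E3) :
    ∫⁻ x : E3, ENNReal.ofReal (fderiv ℝ u (pt x y) (pt e 0) ^ 2) =
      ∫⁻ t, ENNReal.ofReal ((2 * Real.pi) ^ 2 * ⟪t, e⟫ ^ 2 * poissonSymbol y t ^ 2 *
        ‖g t‖ ^ 2) := by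
  set H : E3 → ℂ := fun t => -(2 * Real.pi * Complex.I) *
    ((⟪t, e⟫ : ℂ) * ((poissonSymbol y t : ℂ) * g t)) with hH
  have key : ∀ x : E3, ((fderiv ℝ u (pt x y) (pt e 0) : ℝ) : ℂ) = 𝓕 H x := by
    intro x
    have h1 : HasFDerivAt u (fderiv ℝ u (pt x y)) (pt x y) :=
      ((hu.differentiableOn (by norm_num)).differentiableAt
        (isOpen_upperHalf.mem_nhds (pt_mem_upperHalf hy))).hasFDerivAt
    have h2 : HasFDerivAt (fun x : E3 => pt x y) (ptL.comp (ContinuousLinearMap.inl ℝ E3 ℝ)) x :=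
      ptL.hasFDerivAt.comp x (hasFDerivAt_prodMk_left x y)
    have h3 := Complex.ofRealCLM.hasFDerivAt.comp x (h1.comp x h2)
    obtain ⟨T, hT, hTe⟩ := hasFDerivAt_fourier_poissonSymbol g hy x
    have h4 : HasFDerivAt (fun x : E3 => (u (pt x y) : ℂ)) T x :=
      hT.congr_of_eventuallyEq (Eventually.of_forall fun x => hrep x y hy)
    rw [← hTe, ← h3.unique h4]
    rfl
  have hn : ∀ t, ‖H t‖ ^ 2 =
      (2 * Real.pi) ^ 2 * ⟪t, e⟫ ^ 2 * poissonSymbol y t ^ 2 * ‖g t‖ ^ 2 := by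
    intro t
    rw [← norm_mul_norm_mul_sq, hH]
    simp [mul_assoc]
  have hHm : AEStronglyMeasurable H volume := by
    have h1 : Continuous fun t : E3 => (⟪t, e⟫ : ℂ) :=
      Complex.continuous_ofReal.comp (by fun_prop)
    exact (h1.aestronglyMeasurable.mul (integrable_poissonSymbol_mul hy g).1).const_mul _
  have hle : ∀ t, ‖H t‖ ≤ 2 * Real.pi * ‖e‖ * ‖((‖t‖ * poissonSymbol y t : ℝ) : ℂ) * g t‖ := by
    intro t
    rw [← sq_le_sq₀ (norm_nonneg _) (by have := Real.pi_pos; positivity), hn]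
    have h1 : ⟪t, e⟫ ^ 2 ≤ (‖t‖ * ‖e‖) ^ 2 := by
      rw [← sq_abs]
      gcongr
      exact abs_real_inner_le_norm t e
    calc _ ≤ (2 * Real.pi) ^ 2 * (‖t‖ * ‖e‖) ^ 2 * poissonSymbol y t ^ 2 * ‖g t‖ ^ 2 := by gcongr
      _ = _ := by
        rw [norm_mul, Complex.norm_real,
          Real.norm_of_nonneg (mul_nonneg (norm_nonneg t) (poissonSymbol_nonneg y t))]
        ring
  have h3 : ∀ x : E3, ENNReal.ofReal (fderiv ℝ u (pt x y) (pt e 0) ^ 2) = ‖𝓕 H x‖ₑ ^ 2 := by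
    intro x
    rw [← key, enorm_sq_eq_ofReal, Complex.norm_real, Real.norm_eq_abs, sq_abs]
  simp only [h3]
  rw [lintegral_enorm_sq_fourier
    (((integrable_norm_mul_poissonSymbol_mul g hy).norm.const_mul _).mono' hHm
      (Eventually.of_forall hle))
    ((memLp_norm_mul_poissonSymbol_mul g hy).of_le_mul hHm (Eventually.of_forall hle))]
  exact lintegral_congr fun t => by rw [enorm_sq_eq_ofReal, hn]

theorem pt_single_zero : pt (EuclideanSpace.single 0 1) 0 = qi ∧
    pt (EuclideanSpace.single 1 1) 0 = qj ∧ pt (EuclideanSpace.single 2 1) 0 = qk := by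
  refine ⟨?_, ?_, ?_⟩ <;> ext <;> simp

theorem lintegral_add_four {α : Type*} [MeasurableSpace α] {μ : Measure α} {a b c d : α → ℝ≥0∞}
    (ha : Measurable a) (hb : Measurable b) (hc : Measurable c) :
    ∫⁻ x, (a x + (b x + c x + d x)) ∂μ =
      ∫⁻ x, a x ∂μ + (∫⁻ x, b x ∂μ + ∫⁻ x, c x ∂μ + ∫⁻ x, d x ∂μ) := by
  rw [lintegral_add_left ha, lintegral_add_left (f := fun x => b x + c x) (hb.add hc),
    lintegral_add_left hb]

/-- The vertical derivative contributes `(2π|t|)²`, and the three horizontal ones together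
contribute `∑ (2πtᵢ)²`, the same amount; hence the factor `2`. -/
theorem lintegral_norm_gradient_sq_slice (hu : ContDiffOn ℝ 1 u upperHalf)
    (hrep : ∀ x : E3, ∀ y : ℝ, 0 < y →
      (u (pt x y) : ℂ) = 𝓕 (fun t => (poissonSymbol y t : ℂ) * g t) x) {y : ℝ} (hy : 0 < y) :
    ∫⁻ x : E3, ENNReal.ofReal (‖gradient u (pt x y)‖ ^ 2) =
      ∫⁻ t, ENNReal.ofReal (2 * (2 * Real.pi) ^ 2 * ‖t‖ ^ 2 * poissonSymbol y t ^ 2 *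
        ‖g t‖ ^ 2) := by
  have hg : Measurable g := (Lp.stronglyMeasurable g).measurable
  have hP : Measurable fun t => poissonSymbol y t := (continuous_poissonSymbol y).measurable
  have hL : ∀ e, Measurable fun x : E3 => ENNReal.ofReal (fderiv ℝ u (pt x y) e ^ 2) := by
    intro e
    have h1 : ContinuousOn (fun q => fderiv ℝ u q e) upperHalf :=
      (ContinuousLinearMap.apply ℝ ℝ e).continuous.comp_continuousOn
        (hu.continuousOn_fderiv_of_isOpen isOpen_upperHalf le_rfl)
    exact ((continuous_slice h1 hy).pow 2).measurable.ennreal_ofReal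
  have hR : ∀ e : E3, Measurable fun t => ENNReal.ofReal ((2 * Real.pi) ^ 2 * ⟪t, e⟫ ^ 2 *
      poissonSymbol y t ^ 2 * ‖g t‖ ^ 2) := fun e => by fun_prop
  obtain ⟨e1, e2, e3⟩ := pt_single_zero
  have i1 := lintegral_fderiv_pt_zero_sq hu hrep hy (EuclideanSpace.single 0 1)
  have i2 := lintegral_fderiv_pt_zero_sq hu hrep hy (EuclideanSpace.single 1 1)
  have i3 := lintegral_fderiv_pt_zero_sq hu hrep hy (EuclideanSpace.single 2 1)
  rw [e1] at i1
  rw [e2] at i2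
  rw [e3] at i3
  calc ∫⁻ x : E3, ENNReal.ofReal (‖gradient u (pt x y)‖ ^ 2)
      = ∫⁻ x : E3, (ENNReal.ofReal (fderiv ℝ u (pt x y) 1 ^ 2) +
          (ENNReal.ofReal (fderiv ℝ u (pt x y) qi ^ 2) +
          ENNReal.ofReal (fderiv ℝ u (pt x y) qj ^ 2) +
          ENNReal.ofReal (fderiv ℝ u (pt x y) qk ^ 2))) := by
        refine lintegral_congr fun x => ?_
        rw [norm_gradient_sq, ENNReal.ofReal_add (by positivity) (by positivity),
          ENNReal.ofReal_add (by positivity) (by positivity),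
          ENNReal.ofReal_add (by positivity) (by positivity)]
    _ = _ := by
        rw [lintegral_add_four (hL _) (hL _) (hL _), i1, i2, i3,
          lintegral_fderiv_one_sq hu hrep hy,
          ← lintegral_add_four (by fun_prop) (hR _) (hR _)]
        refine lintegral_congr fun t => ?_
        rw [← ENNReal.ofReal_add (by positivity) (by positivity),
          ← ENNReal.ofReal_add (by positivity) (by positivity),
          ← ENNReal.ofReal_add (by positivity) (by positivity)]
        congr 1
        have hn : ‖t‖ ^ 2 = t 0 ^ 2 + t 1 ^ 2 + t 2 ^ 2 := by
          rw [EuclideanSpace.norm_sq_eq, Fin.sum_univ_three]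
          simp
        simp only [EuclideanSpace.inner_single_right, one_mul, conj_trivial]
        rw [hn]
        ring

/-- For `t ≠ 0` the exponential `e^{-4πy|t|}` integrates to `1/(4π|t|)`, and `8π²|t|²/(4π|t|) =
2π|t|`. At `t = 0` both sides vanish. -/
theorem lintegral_poissonSymbol_sq (t : E3) (c : ℝ) (hc : 0 ≤ c) :
    ∫⁻ y in Ioi (0 : ℝ), ENNReal.ofReal
        (2 * (2 * Real.pi) ^ 2 * ‖t‖ ^ 2 * poissonSymbol y t ^ 2 * c) =
      ENNReal.ofReal (2 * Real.pi) * ENNReal.ofReal (‖t‖ * c) := by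
  rcases (norm_nonneg t).eq_or_lt with h | h
  · simp [← h]
  have hp := Real.pi_pos
  have ha : -(4 * Real.pi * ‖t‖) < 0 := neg_lt_zero.mpr (by positivity)
  have e : ∀ y : ℝ, 2 * (2 * Real.pi) ^ 2 * ‖t‖ ^ 2 * poissonSymbol y t ^ 2 * c =
      2 * (2 * Real.pi) ^ 2 * ‖t‖ ^ 2 * c * Real.exp (-(4 * Real.pi * ‖t‖) * y) := fun y => by
    rw [poissonSymbol, ← Real.exp_nat_mul, mul_right_comm]
    congr 2
    push_cast
    ring
  simp only [e]
  rw [← ofReal_integral_eq_lintegral_ofReal ((integrableOn_exp_mul_Ioi ha 0).const_mul _)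
    (Eventually.of_forall fun y => by positivity), integral_const_mul, integral_exp_mul_Ioi ha,
    ← ENNReal.ofReal_mul (by positivity)]
  congr 1
  simp
  field_simp
  ring

/-- The energy of a Poisson integral on the Fourier side. -/
theorem gradientEnergy_eq_fourier (hu : ContDiffOn ℝ 1 u upperHalf)
    (hrep : ∀ x : E3, ∀ y : ℝ, 0 < y →
      (u (pt x y) : ℂ) = 𝓕 (fun t => (poissonSymbol y t : ℂ) * g t) x) :
    gradientEnergy u =
      ENNReal.ofReal (2 * Real.pi) * ∫⁻ t : E3, ENNReal.ofReal (‖t‖ * ‖g t‖ ^ 2) := by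
  have hg : Measurable g := (Lp.stronglyMeasurable g).measurable
  rw [gradientEnergy, integralUpper_eq_symm (continuousOn_norm_gradient_sq hu),
    setLIntegral_congr_fun measurableSet_Ioi
      fun y hy => lintegral_norm_gradient_sq_slice hu hrep hy,
    lintegral_lintegral_swap, ← lintegral_const_mul _ (by fun_prop)]
  · exact lintegral_congr fun t => lintegral_poissonSymbol_sq t _ (by positivity)
  · refine Measurable.aemeasurable ?_
    unfold Function.uncurry poissonSymbol
    fun_prop

end Energy

/-! ### The double integral on the Fourier side. -/

section DoubleIntegral

open scoped ENNReal FourierTransform RealInnerProductSpace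

/-- The Gagliardo-type double integral of an `L²` function in terms of its Fourier transform. -/
theorem lintegral_lintegral_norm_sub_sq_div (g : Lp ℂ 2 (volume : Measure E3)) :
    ∫⁻ t₁ : E3, ∫⁻ t₂ : E3, ENNReal.ofReal
        (‖(𝓕 g : Lp ℂ 2 (volume : Measure E3)) t₁ - (𝓕 g : Lp ℂ 2 (volume : Measure E3)) t₂‖ ^ 2 /
          ‖t₁ - t₂‖ ^ 4) =
      ENNReal.ofReal (4 * Real.pi ^ 3) * ∫⁻ t : E3, ENNReal.ofReal (‖t‖ * ‖g t‖ ^ 2) := by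
  set G : E3 → ℂ := ⇑(𝓕 g : Lp ℂ 2 (volume : Measure E3)) with hG
  have hGm : Measurable G := (Lp.stronglyMeasurable _).measurable
  have hg : Measurable g := (Lp.stronglyMeasurable g).measurable
  have hsplit : ∀ a b : ℝ, ENNReal.ofReal (a ^ 2 / b ^ 4) =
      ENNReal.ofReal (b ^ 4)⁻¹ * ENNReal.ofReal (a ^ 2) := fun a b => by
    rw [← ENNReal.ofReal_mul (by positivity), div_eq_inv_mul]
  have hchar : Continuous fun p : E3 × E3 => (Real.fourierChar ⟪p.2, -p.1⟫ : ℂ) :=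
    continuous_subtype_val.comp (Real.continuous_fourierChar.comp (by fun_prop))
  calc ∫⁻ t₁ : E3, ∫⁻ t₂ : E3, ENNReal.ofReal (‖G t₁ - G t₂‖ ^ 2 / ‖t₁ - t₂‖ ^ 4)
      -- In the displacement `h = t₂ - t₁` the weight no longer depends on `t₁`, so after Tonelli
      -- the inner integral is the squared `L²` norm of a difference of translates.
      = ∫⁻ t₁ : E3, ∫⁻ h : E3, ENNReal.ofReal (‖G (t₁ + h) - G t₁‖ ^ 2 / ‖h‖ ^ 4) := by
        refine lintegral_congr fun t₁ => ?_
        rw [← lintegral_add_left_eq_self _ t₁]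
        refine lintegral_congr fun h => ?_
        rw [norm_sub_rev, sub_add_cancel_left, norm_neg]
    _ = ∫⁻ h : E3, ∫⁻ x : E3, ENNReal.ofReal (‖G (x + h) - G x‖ ^ 2 / ‖h‖ ^ 4) := by
        rw [lintegral_lintegral_swap]
        refine Measurable.aemeasurable ?_
        unfold Function.uncurry
        fun_prop
    _ = ∫⁻ h : E3, ∫⁻ t : E3, ENNReal.ofReal
          (‖(Real.fourierChar ⟪t, -h⟫ : ℂ) - 1‖ ^ 2 / ‖h‖ ^ 4) * ENNReal.ofReal (‖g t‖ ^ 2) := by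
        refine lintegral_congr fun h => ?_
        simp only [hsplit, mul_assoc]
        rw [lintegral_const_mul' _ _ ENNReal.ofReal_ne_top,
          lintegral_const_mul' _ _ ENNReal.ofReal_ne_top]
        simp only [← enorm_sq_eq_ofReal]
        rw [hG, lintegral_enorm_sq_fourier_Lp_add_sub]
    _ = ∫⁻ t : E3, ∫⁻ h : E3, ENNReal.ofReal
          (‖(Real.fourierChar ⟪t, -h⟫ : ℂ) - 1‖ ^ 2 / ‖h‖ ^ 4) * ENNReal.ofReal (‖g t‖ ^ 2) := by
        rw [lintegral_lintegral_swap]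
        refine Measurable.aemeasurable ?_
        unfold Function.uncurry
        have := hchar.measurable
        fun_prop
    _ = ∫⁻ t : E3, ENNReal.ofReal (4 * Real.pi ^ 3) * ENNReal.ofReal (‖t‖ * ‖g t‖ ^ 2) := by
        refine lintegral_congr fun t => ?_
        rw [lintegral_mul_const' _ _ ENNReal.ofReal_ne_top, lintegral_char_sub_one_sq_div_norm_pow,
          ← ENNReal.ofReal_mul (by have := Real.pi_pos; positivity),
          ← ENNReal.ofReal_mul (by have := Real.pi_pos; positivity), mul_assoc]
    _ = _ := lintegral_const_mul' _ _ ENNReal.ofReal_ne_top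

theorem lintegral_lintegral_abs_sub_sq_div {f : E3 → ℝ} (hf : MemLp f 2 volume) :
    ∫⁻ t₁ : E3, ∫⁻ t₂ : E3, ENNReal.ofReal (|f t₁ - f t₂| ^ 2 / ‖t₁ - t₂‖ ^ 4) =
      ENNReal.ofReal (4 * Real.pi ^ 3) *
        ∫⁻ t : E3, ENNReal.ofReal (‖t‖ * ‖fourierL2 f (memLp_ofReal hf) t‖ ^ 2) := by
  rw [← lintegral_lintegral_norm_sub_sq_div, fourier_fourierL2]
  have h := (memLp_ofReal hf).coeFn_toLp
  refine lintegral_congr_ae (h.mono fun t₁ h₁ => lintegral_congr_ae (h.mono fun t₂ h₂ => ?_))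
  simp only
  rw [h₁, h₂, ← Complex.ofReal_sub, Complex.norm_real, Real.norm_eq_abs]

end DoubleIntegral

/-! ### The three energy identities for the Dirichlet space. -/

section Dirichlet

variable {u : Quaternion ℝ → ℝ} {f : E3 → ℝ}

theorem IsBoundaryFunction.gradientEnergy_eq_opDbar (hf : IsBoundaryFunction u f)
    (hu : MemDirichlet u) :
    gradientEnergy u =
      integralUpper (fun q => ENNReal.ofReal (‖opDbar (canonicalExtension f) q‖ ^ 2)) := by
  refine setLIntegral_congr_fun (MeasurableSet.univ.prod measurableSet_Ioi) fun p hp => ?_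
  simp only
  rw [norm_gradient_sq_eq_opDbar (hf.memLp hu) (fun q hq => hf.re_canonicalExtension_eq hu hq)
    (pt_mem_upperHalf hp.2)]

theorem IsBoundaryFunction.gradientEnergy_eq_fourierL2 (hf : IsBoundaryFunction u f)
    (hu : MemDirichlet u) :
    gradientEnergy u = ENNReal.ofReal (2 * Real.pi) * ∫⁻ t : E3,
      ENNReal.ofReal (‖t‖ * ‖fourierL2 f (memLp_ofReal (hf.memLp hu)) t‖ ^ 2) :=
  gradientEnergy_eq_fourier hu.contDiffOn_one fun x y hy => by
    rw [← re_canonicalExtension_eq_fourier (hf.memLp hu) x hy,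
      hf.re_canonicalExtension_eq hu (pt_mem_upperHalf hy)]

theorem IsBoundaryFunction.gradientEnergy_eq_double_lintegral (hf : IsBoundaryFunction u f)
    (hu : MemDirichlet u) :
    gradientEnergy u = ENNReal.ofReal (1 / (2 * Real.pi ^ 2)) *
      ∫⁻ t₁ : E3, ∫⁻ t₂ : E3, ENNReal.ofReal (|f t₁ - f t₂| ^ 2 / ‖t₁ - t₂‖ ^ 4) := by
  have hp := Real.pi_pos
  rw [lintegral_lintegral_abs_sub_sq_div (hf.memLp hu), hf.gradientEnergy_eq_fourierL2 hu,
    ← mul_assoc, ← ENNReal.ofReal_mul (by positivity)]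
  congr 2
  field_simp
  norm_num

end Dirichlet

end QuatDirichlet

end

theorem mainTheorem6 (u : Quaternion ℝ → ℝ) (hu : QuatDirichlet.MemDirichlet u)
    (f : QuatDirichlet.E3 → ℝ) (hf : QuatDirichlet.IsBoundaryFunction u f) :
    (QuatDirichlet.LeftRegularOn (QuatDirichlet.canonicalExtension f) QuatDirichlet.upperHalf ∧
      ∀ q ∈ QuatDirichlet.upperHalf, (QuatDirichlet.canonicalExtension f q).re = u q) ∧
    ∃ hfL2 : MemLp (fun x => (f x : ℂ)) 2 (volume : Measure QuatDirichlet.E3),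
      QuatDirichlet.gradientEnergy u =
          QuatDirichlet.integralUpper (fun q => ENNReal.ofReal
            (‖QuatDirichlet.opDbar (QuatDirichlet.canonicalExtension f) q‖ ^ 2)) ∧
      QuatDirichlet.gradientEnergy u =
          ENNReal.ofReal (2 * Real.pi) * ∫⁻ t : QuatDirichlet.E3,
            ENNReal.ofReal (‖t‖ * ‖QuatDirichlet.fourierL2 f hfL2 t‖ ^ 2) ∧
      QuatDirichlet.gradientEnergy u =
          ENNReal.ofReal (1 / (2 * Real.pi ^ 2)) *
            ∫⁻ t₁ : QuatDirichlet.E3, ∫⁻ t₂ : QuatDirichlet.E3,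
              ENNReal.ofReal (|f t₁ - f t₂| ^ 2 / ‖t₁ - t₂‖ ^ 4) :=
  ⟨⟨QuatDirichlet.leftRegularOn_canonicalExtension (hf.memLp hu),
      fun _ hq => hf.re_canonicalExtension_eq hu hq⟩,
    QuatDirichlet.memLp_ofReal (hf.memLp hu), hf.gradientEnergy_eq_opDbar hu,
    hf.gradientEnergy_eq_fourierL2 hu, hf.gradientEnergy_eq_double_lintegral hu⟩
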